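/- Let $0<q<1$ and $[z]:=(q^z-q^{-z})/(q-q^{-1})$. All algebras are unital complex $*$-algebras given by generators and relations (together with the adjoint relations): * $\mathcal A(S^4_q)$: generators $x_0=x_0^*,x_1,x_2$ and relations $x_ix_k=q^2x_kx_i$ ($0\le i<k\le 2$), $x_i^*x_k=q^2x_kx_i^*$ ($i\ne k$), $[x_1^*,x_1]=(1-q^4)x_0^2$, $[x_2^*,x_2]=x_1^*x_1-q^4x_1x_1^*$, $x_0^2+x_1x_1^*+x_2x_2^*=1$. * $\mathcal A(SU_q(2))$: generators $\alpha,\beta$ and relations $\beta\alpha=q\alpha\beta$, $\beta^*\alpha=q\alpha\beta^*$, $[\beta,\beta^*]=0$, $\alpha\alpha^*+\beta\beta^*=1$, $\alpha^*\alpha+q^2\beta^*\beta=1$. * $\mathcal A(S^2_q)$: generators $A=A^*,B$ and relations $AB=q^2BA$, $BB^*+A^2=1$, $B^*B+q^4A^2=1$. Let $\varphi:\mathcal A(S^4_q)\to\mathcal A(SU_q(2))\otimes\mathcal A(S^2_q)$ be the $*$-homomorphism with $\varphi(x_0)=-(\alpha\beta+\beta^*\alpha^*)\otimes A$, $\varphi(x_1)=(-\alpha^2+q(\beta^*)^2)\otimes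 A$, $\varphi(x_2)=1\otimes B$. Let $I$ be the set of $(l,m_1,m_2,j)$ with $l\in\mathbb N+\frac12$, $j\in\{\frac12,\frac32,\dots,l\}$, $j-|m_1|\in\mathbb N$, $l+\frac12-j-|m_2|\in\mathbb N$, and let $\hat I\supset I$ be the set of $(l,m_1,m_2,j)$ with $l\in\frac12\mathbb Z$, $l+j\in\mathbb Z$, $j+m_1\in\mathbb N$, $l+\frac12-j+m_2\in\mathbb N$. Put $\epsilon=\epsilon(l,j,m_2):=\frac12(-1)^{l+\frac12-j-m_2}$. Let $\mathcal H=\mathcal H_+\oplus\mathcal H_-$ and $\hat{\mathcal H}$ be the Hilbert spaces with orthonormal bases $|l,m_1,m_2;j\rangle_\pm$ (labels in $I$) and $|l,m_1,m_2;j\rangle\rangle_\pm$ (labels in $\hat I$). Vectors whose label is not in the index set are read as $0$. Let $Q:\mathcal H\to\hat{\mathcal H}$ be the isometry $Q|l,m_1,m_2;j\rangle_\pm=|l,m_1,m_2;j\rangle\rangle_\pm$ and $P=Q^*$. (1) There is a unique $*$-representation of $\mathcal A(S^4_q)$ by bounded operators on $\mathcal H$ (written $a\mapsto a$) such that, for all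 basis vectors, $$\begin{aligned} x_0|l,m_1,m_2;j\rangle_\pm={}&A^+_{j,m_1}C^+_{l,j,m_2}|l+1,m_1,m_2;j+1\rangle_\pm\mp A^+_{j,m_1}C^0_{l,j,m_2}|l,m_1,m_2;j+1\rangle_\pm+A^+_{j,m_1}C^-_{l,j,m_2}|l-1,m_1,m_2;j+1\rangle_\pm\\ &+A^0_{j,m_1}H^+_{l,j,m_2}|l+1,m_1,m_2;j\rangle_\pm\pm A^0_{j,m_1}H^0_{l,j,m_2}|l,m_1,m_2;j\rangle_\pm+A^0_{j,m_1}H^+_{l-1,j,m_2}|l-1,m_1,m_2;j\rangle_\pm\\ &+A^+_{j-1,m_1}C^-_{l+1,j-1,m_2}|l+1,m_1,m_2;j-1\rangle_\pm\mp A^+_{j-1,m_1}C^0_{l,j-1,m_2}|l,m_1,m_2;j-1\rangle_\pm+A^+_{j-1,m_1}C^+_{l-1,j-1,m_2}|l-1,m_1,m_2;j-1\rangle_\pm,\\ x_1|l,m_1,m_2;j\rangle_\pm={}&B^+_{j,m_1}C^+_{l,j,m_2}|l+1,m_1+1,m_2;j+1\rangle_\pm\mp B^+_{j,m_1}C^0_{l,j,m_2}|l,m_1+1,m_2;j+1\rangle_\pm+B^+_{j,m_1}C^-_{l,j,m_2}|l-1,m_1+1,m_2;j+1\rangle_\pm\\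 &+B^0_{j,m_1}H^+_{l,j,m_2}|l+1,m_1+1,m_2;j\rangle_\pm\pm B^0_{j,m_1}H^0_{l,j,m_2}|l,m_1+1,m_2;j\rangle_\pm+B^0_{j,m_1}H^+_{l-1,j,m_2}|l-1,m_1+1,m_2;j\rangle_\pm\\ &+B^-_{j,m_1}C^-_{l+1,j-1,m_2}|l+1,m_1+1,m_2;j-1\rangle_\pm\mp B^-_{j,m_1}C^0_{l,j-1,m_2}|l,m_1+1,m_2;j-1\rangle_\pm+B^-_{j,m_1}C^+_{l-1,j-1,m_2}|l-1,m_1+1,m_2;j-1\rangle_\pm,\\ x_2|l,m_1,m_2;j\rangle_\pm={}&D^+_{l,j,m_2}|l+1,m_1,m_2+1;j\rangle_\pm\pm D^0_{l,j,m_2}|l,m_1,m_2+1;j\rangle_\pm+D^-_{l,j,m_2}|l-1,m_1,m_2+1;j\rangle_\pm, \end{aligned}$$ where $$\begin{aligned} A^+_{j,m_1}&=q^{m_1-1}\tfrac{\sqrt{[j+m_1+1][j-m_1+1]}}{[2j+2]},& A^0_{j,m_1}&=q^{-2}\tfrac{q^{j+m_1+1}[2][j-m_1]-[2j]}{[2j][2j+2]},\\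 B^+_{j,m_1}&=q^{-j+m_1-\frac12}\tfrac{\sqrt{[j+m_1+1][j+m_1+2]}}{[2j+2]},& B^0_{j,m_1}&=(1+q^2)q^{m_1-\frac12}\tfrac{\sqrt{[j-m_1][j+m_1+1]}}{[2j][2j+2]},\\ B^-_{j,m_1}&=-q^{j+m_1+\frac12}\tfrac{\sqrt{[j-m_1][j-m_1-1]}}{[2j]}, \end{aligned}$$ $$\begin{aligned} C^+_{l,j,m_2}&=-q^{m_2-1-\epsilon}\tfrac{\sqrt{[l+j+m_2+3+\epsilon][l+j-m_2+3-\epsilon]}}{[2l+4]},\\ C^0_{l,j,m_2}&=[4\epsilon]\,q^{2\epsilon l+m_2-1+3\epsilon}\tfrac{\sqrt{[l+\frac12+j-2\epsilon m_2+2][l+\frac12-j-2\epsilon m_2]}}{[2l+2][2l+4]},\\ C^-_{l,j,m_2}&=-q^{m_2-1+\epsilon}\tfrac{\sqrt{[l-j+m_2-\epsilon][l-j-m_2+\epsilon]}}{[2l+2]},\\ H^+_{l,j,m_2}&=q^{m_2-1+\epsilon(2j+1)}\tfrac{\sqrt{[l+2\epsilon j-m_2+2+\epsilon][l-2\epsilon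 j+m_2+2-\epsilon]}}{[2l+4]},\\ H^0_{l,j,m_2}&=\tfrac{[l-\epsilon(2j+1)-m_2+1][l-\epsilon(2j+1)+m_2+2]-q^{-2}[l+\epsilon(2j+1)-m_2+2][l+\epsilon(2j+1)+m_2+1]}{[2l+2][2l+4]},\\ D^+_{l,j,m_2}&=q^{-l+m_2-\frac32}\tfrac{\sqrt{[l+j+m_2+3+\epsilon][l-j+m_2+2-\epsilon]}}{[2l+4]},\\ D^0_{l,j,m_2}&=[2]q^{m_2+\frac12}\tfrac{\sqrt{[l-2\epsilon j-m_2+1-\epsilon][l-2\epsilon j+m_2+2-\epsilon]}}{[2l+2][2l+4]},\\ D^-_{l,j,m_2}&=-q^{l+m_2+\frac32}\tfrac{\sqrt{[l-j-m_2+\epsilon][l+j-m_2+1-\epsilon]}}{[2l+2]}, \end{aligned}$$ and $\epsilon$ is always computed from the indices $(l,j,m_2)$ of the coefficient in which it occurs. (2) There is a unique $*$-representation of $\mathcal A(SU_q(2))\otimes\mathcal A(S^2_q)$ by bounded operators on $\hat{\mathcal H}$ such that, for all basis vectors, $$\begin{aligned} \alpha|l,m_1,m_2;j\rangle\rangle_\pm&=\sqrt{1-q^{2(j+m_1+1)}}\,|l+\tfrac12,m_1+\tfrac12,m_2;j+\tfrac12\rangle\rangle_\pm,&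 A|l,m_1,m_2;j\rangle\rangle_\pm&=q^{l-j+m_2-\epsilon}|l,m_1,m_2;j\rangle\rangle_\pm,\\ \beta|l,m_1,m_2;j\rangle\rangle_\pm&=q^{j+m_1}|l+\tfrac12,m_1-\tfrac12,m_2;j+\tfrac12\rangle\rangle_\pm,& B|l,m_1,m_2;j\rangle\rangle_\pm&=\sqrt{1-q^{2(l-j+m_2+2-\epsilon)}}\,|l+1,m_1,m_2+1;j\rangle\rangle_\pm. \end{aligned}$$ (3) Let $\pi:\mathcal A(S^4_q)\to\mathcal B(\hat{\mathcal H})$ be the composition of $\varphi$ with the representation in (2), and $\tilde\pi(a):=P\pi(a)Q$. Let $D|l,m_1,m_2;j\rangle_\pm=(l+\frac32)|l,m_1,m_2;j\rangle_\mp$ (self-adjoint, with its maximal domain), so that $|D|\,|l,m_1,m_2;j\rangle_\pm=(l+\frac32)|l,m_1,m_2;j\rangle_\pm$; let $\delta=[|D|,\,\cdot\,]$ be the associated unbounded derivation of $\mathcal B(\mathcal H)$, whose domain consists of the bounded $T$ that map $\mathrm{dom}\,|D|$ into itself and for which $|D|T-T|D|$ extends to a bounded operator, and let $\mathrm{OP}^0=\bigcap_{n\in\mathbb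 N}\mathrm{dom}\,\delta^n$. Put $$\mathcal I=\{T\in\mathrm{OP}^0 : T|D|^{-p}\text{ is trace class for all } p>2\}.$$ Then $a-\tilde\pi(a)\in\mathcal I$ for every $a\in\mathcal A(S^4_q)$. -/

import Mathlib

open scoped TensorProduct ComplexConjugate InnerProductSpace

noncomputable section

/-! ### Complex `*`-algebras given by generators and relations -/

/-- The free unital complex `*`-algebra on a set `Y`: noncommutative complex polynomials in the
letters `y = (y, false)` and `y^* = (y, true)`. -/
def FreeStarAlg (Y : Type) : Type := FreeAlgebra ℂ (Y × Bool)

namespace FreeStarAlg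

variable {Y : Type}

instance : Ring (FreeStarAlg Y) := inferInstanceAs (Ring (FreeAlgebra ℂ (Y × Bool)))

instance : Algebra ℂ (FreeStarAlg Y) := inferInstanceAs (Algebra ℂ (FreeAlgebra ℂ (Y × Bool)))

/-- The letters `y` and `y^*`. -/
def letter (p : Y × Bool) : FreeStarAlg Y := (FreeAlgebra.ι ℂ p : FreeAlgebra ℂ (Y × Bool))

/-- The free generators. -/
def gen (y : Y) : FreeStarAlg Y := letter (y, false)

/-- Scalars act on the opposite algebra through complex conjugation. -/
abbrev conjAlgebra (Y : Type) : Algebra ℂ (FreeStarAlg Y)ᵐᵒᵖ :=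
  RingHom.toAlgebra' ((algebraMap ℂ (FreeStarAlg Y)ᵐᵒᵖ).comp (starRingEnd ℂ))
    (fun c x => Algebra.commutes (conj c) x)

/-- The antilinear, product reversing involution `y ↔ y^*`, as a ring homomorphism. -/
def starHom (Y : Type) : FreeStarAlg Y →+* (FreeStarAlg Y)ᵐᵒᵖ :=
  letI := conjAlgebra Y
  ((FreeAlgebra.lift ℂ (A := (FreeStarAlg Y)ᵐᵒᵖ)
    (fun p : Y × Bool => MulOpposite.op (letter (p.1, !p.2)))) :
      FreeAlgebra ℂ (Y × Bool) →ₐ[ℂ] (FreeStarAlg Y)ᵐᵒᵖ).toRingHom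

theorem starHom_letter (p : Y × Bool) :
    starHom Y (letter p) =
      MulOpposite.op (letter (p.1, !p.2)) := by
  let _ := conjAlgebra Y
  exact FreeAlgebra.lift_ι_apply (R := ℂ) (A := (FreeStarAlg Y)ᵐᵒᵖ) _ p

theorem starHom_algebraMap (c : ℂ) :
    starHom Y (algebraMap ℂ (FreeStarAlg Y) c) =
      MulOpposite.op (algebraMap ℂ (FreeStarAlg Y) (conj c)) := by
  let _ := conjAlgebra Y
  exact AlgHom.commutes ((FreeAlgebra.lift ℂ (A := (FreeStarAlg Y)ᵐᵒᵖ)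
    (fun p : Y × Bool => MulOpposite.op (letter (p.1, !p.2)))) :
      FreeAlgebra ℂ (Y × Bool) →ₐ[ℂ] (FreeStarAlg Y)ᵐᵒᵖ) c

theorem induction {C : FreeStarAlg Y → Prop}
    (h_scalar : ∀ c : ℂ, C (algebraMap ℂ (FreeStarAlg Y) c))
    (h_gen : ∀ p : Y × Bool, C (letter p))
    (h_mul : ∀ a b, C a → C b → C (a * b)) (h_add : ∀ a b, C a → C b → C (a + b))
    (a : FreeStarAlg Y) : C a :=
  FreeAlgebra.induction ℂ (Y × Bool) (motive := C) h_scalar h_gen h_mul h_add a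

instance : StarRing (FreeStarAlg Y) where
  star a := (starHom Y a).unop
  star_involutive a := by
    induction a using FreeStarAlg.induction with
    | h_scalar c => simp [starHom_algebraMap]
    | h_gen p => simp [starHom_letter]
    | h_mul a b ha hb => simp [ha, hb]
    | h_add a b ha hb => simp [ha, hb]
  star_mul a b := by simp
  star_add a b := by simp

theorem star_def (a : FreeStarAlg Y) : star a = (starHom Y a).unop := rfl

instance : StarModule ℂ (FreeStarAlg Y) where
  star_smul c a := by
    simp only [Algebra.smul_def, star_def, map_mul, starHom_algebraMap, MulOpposite.unop_mul,
      MulOpposite.unop_op]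
    exact (Algebra.commutes _ _).symm

theorem star_letter (p : Y × Bool) :
    star (letter p) =
      letter (p.1, !p.2) := by
  rw [star_def, starHom_letter]; rfl

/-- The universal property: a map from `Y` to a `*`-algebra extends to a `*`-homomorphism. -/
def lift {C : Type} [Ring C] [Algebra ℂ C] [StarRing C] [StarModule ℂ C] (f : Y → C) :
    FreeStarAlg Y →⋆ₐ[ℂ] C :=
  { (FreeAlgebra.lift ℂ (fun p : Y × Bool => if p.2 then star (f p.1) else f p.1) :
      FreeAlgebra ℂ (Y × Bool) →ₐ[ℂ] C) with
    map_star' := by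
      intro a
      let g : FreeStarAlg Y →ₐ[ℂ] C :=
        (FreeAlgebra.lift ℂ (fun p : Y × Bool => if p.2 then star (f p.1) else f p.1) :
          FreeAlgebra ℂ (Y × Bool) →ₐ[ℂ] C)
      have hg : ∀ p : Y × Bool, g (letter p) =
          if p.2 then star (f p.1) else f p.1 := fun p => FreeAlgebra.lift_ι_apply _ p
      change g (star a) = star (g a)
      induction a using FreeStarAlg.induction with
      | h_scalar c =>
        rw [star_def, starHom_algebraMap, MulOpposite.unop_op, AlgHom.commutes, AlgHom.commutes]
        exact algebraMap_star_comm c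
      | h_gen p =>
        rw [star_letter, hg, hg]
        rcases p with ⟨y, _ | _⟩ <;> simp
      | h_mul a b ha hb => rw [star_mul, map_mul, map_mul, star_mul, ha, hb]
      | h_add a b ha hb => rw [star_add, map_add, map_add, star_add, ha, hb] }

theorem lift_gen {C : Type} [Ring C] [Algebra ℂ C] [StarRing C] [StarModule ℂ C] (f : Y → C)
    (y : Y) : lift f (gen y) = f y :=
  (FreeAlgebra.lift_ι_apply (R := ℂ) _ (y, false)).trans (by simp)

end FreeStarAlg

/-- The relations of `r` together with their adjoints. -/
inductive StarClosure {Y : Type} (r : FreeStarAlg Y → FreeStarAlg Y → Prop) :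
    FreeStarAlg Y → FreeStarAlg Y → Prop
  | base {a b : FreeStarAlg Y} (h : r a b) : StarClosure r a b
  | adj {a b : FreeStarAlg Y} (h : r a b) : StarClosure r (star a) (star b)

/-- The unital complex `*`-algebra with generators `Y` and relations `a = b` whenever `r a b`. -/
def StarPresented {Y : Type} (r : FreeStarAlg Y → FreeStarAlg Y → Prop) : Type :=
  RingQuot (StarClosure r)

namespace StarPresented

variable {Y : Type} {r : FreeStarAlg Y → FreeStarAlg Y → Prop}

instance : Ring (StarPresented r) := inferInstanceAs (Ring (RingQuot (StarClosure r)))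

instance : Algebra ℂ (StarPresented r) := inferInstanceAs (Algebra ℂ (RingQuot (StarClosure r)))

instance : StarRing (StarPresented r) :=
  RingQuot.starRing (StarClosure r) (by
    rintro a b (h | h)
    · exact .adj h
    · rw [star_star, star_star]; exact .base h)

/-- The quotient map, as a homomorphism of algebras. -/
def mkAlg (r : FreeStarAlg Y → FreeStarAlg Y → Prop) : FreeStarAlg Y →ₐ[ℂ] StarPresented r :=
  RingQuot.mkAlgHom ℂ (StarClosure r)

theorem mkAlg_surjective : Function.Surjective (mkAlg r) :=
  RingQuot.mkAlgHom_surjective ℂ (StarClosure r)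

theorem mkAlg_star (a : FreeStarAlg Y) : mkAlg r (star a) = star (mkAlg r a) := by
  have h : ∀ b : FreeStarAlg Y, RingQuot.mkAlgHom ℂ (StarClosure r) b = ⟨Quot.mk _ b⟩ := by
    intro b
    simp [RingQuot.mkAlgHom_def, RingQuot.mkRingHom_def]
  exact (h (star a)).trans (congrArg (star : StarPresented r → StarPresented r) (h a)).symm

instance : StarModule ℂ (StarPresented r) where
  star_smul c x := by
    obtain ⟨a, rfl⟩ := mkAlg_surjective x
    rw [← map_smul, ← mkAlg_star, star_smul, map_smul, mkAlg_star]

/-- The generators. -/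
def gen (r : FreeStarAlg Y → FreeStarAlg Y → Prop) (y : Y) : StarPresented r :=
  mkAlg r (FreeStarAlg.gen y)

theorem mkAlg_eq {a b : FreeStarAlg Y} (h : r a b) : mkAlg r a = mkAlg r b :=
  RingQuot.mkAlgHom_rel ℂ (StarClosure.base h)

/-- The universal property of the algebra with generators `Y` and relations `r`. -/
def lift {C : Type} [Ring C] [Algebra ℂ C] [StarRing C] [StarModule ℂ C] (f : Y → C)
    (hf : ∀ a b, r a b → FreeStarAlg.lift f a = FreeStarAlg.lift f b) :
    StarPresented r →⋆ₐ[ℂ] C :=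
  let g : StarPresented r →ₐ[ℂ] C := RingQuot.liftAlgHom ℂ
    ⟨(FreeStarAlg.lift f : FreeStarAlg Y →⋆ₐ[ℂ] C).toAlgHom, by
      rintro a b (h | h)
      · exact hf _ _ h
      · change FreeStarAlg.lift f (star _) = FreeStarAlg.lift f (star _)
        rw [map_star, map_star, hf _ _ h]⟩
  { g with
    map_star' := by
      intro x
      obtain ⟨a, rfl⟩ := mkAlg_surjective x
      have hg : ∀ b, g (mkAlg r b) = FreeStarAlg.lift f b := fun b =>
        RingQuot.liftAlgHom_mkAlgHom_apply ℂ _ _ b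
      change g (star (mkAlg r a)) = star (g (mkAlg r a))
      rw [← mkAlg_star, hg, hg, map_star] }

theorem lift_gen {C : Type} [Ring C] [Algebra ℂ C] [StarRing C] [StarModule ℂ C] (f : Y → C)
    (hf : ∀ a b, r a b → FreeStarAlg.lift f a = FreeStarAlg.lift f b) (y : Y) :
    lift f hf (gen r y) = f y :=
  (RingQuot.liftAlgHom_mkAlgHom_apply ℂ _ _ _).trans (FreeStarAlg.lift_gen f y)

end StarPresented

/-! ### The algebras of `SU_q(2)`, of the equatorial Podles sphere and of the quantum `4`-sphere -/

/-- Defining relations of `A(SU_q(2))`; the generators are `α = gen 0` and `β = gen 1`. -/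
inductive SURel (q : ℝ) : FreeStarAlg (Fin 2) → FreeStarAlg (Fin 2) → Prop
  | βα : SURel q (.gen 1 * .gen 0) ((q : ℂ) • (.gen 0 * .gen 1))
  | βsα : SURel q (star (.gen 1) * .gen 0) ((q : ℂ) • (.gen 0 * star (.gen 1)))
  | normal : SURel q (.gen 1 * star (.gen 1)) (star (.gen 1) * .gen 1)
  | unit : SURel q (.gen 0 * star (.gen 0) + .gen 1 * star (.gen 1)) 1
  | unit' : SURel q (star (.gen 0) * .gen 0 + (q : ℂ) ^ 2 • (star (.gen 1) * .gen 1)) 1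

/-- The `*`-algebra `A(SU_q(2))`. -/
abbrev SUAlg (q : ℝ) : Type := StarPresented (SURel q)

/-- Defining relations of `A(S²_q)`; the generators are `A = gen 0` and `B = gen 1`. -/
inductive PodlesRel (q : ℝ) : FreeStarAlg (Fin 2) → FreeStarAlg (Fin 2) → Prop
  | selfadj : PodlesRel q (star (.gen 0)) (.gen 0)
  | AB : PodlesRel q (.gen 0 * .gen 1) ((q : ℂ) ^ 2 • (.gen 1 * .gen 0))
  | unit : PodlesRel q (.gen 1 * star (.gen 1) + .gen 0 ^ 2) 1
  | unit' : PodlesRel q (star (.gen 1) * .gen 1 + (q : ℂ) ^ 4 • .gen 0 ^ 2) 1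

/-- The `*`-algebra `A(S²_q)`. -/
abbrev PodlesAlg (q : ℝ) : Type := StarPresented (PodlesRel q)

/-- Defining relations of `A(S⁴_q)`; the generators are `x_i = gen i`, `i = 0, 1, 2`. -/
inductive Sphere4Rel (q : ℝ) : FreeStarAlg (Fin 3) → FreeStarAlg (Fin 3) → Prop
  | selfadj : Sphere4Rel q (star (.gen 0)) (.gen 0)
  | comm (i k : Fin 3) (h : i < k) :
      Sphere4Rel q (.gen i * .gen k) ((q : ℂ) ^ 2 • (.gen k * .gen i))
  | comm_star (i k : Fin 3) (h : i ≠ k) :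
      Sphere4Rel q (star (.gen i) * .gen k) ((q : ℂ) ^ 2 • (.gen k * star (.gen i)))
  | bracket₁ : Sphere4Rel q (star (.gen 1) * .gen 1 - .gen 1 * star (.gen 1))
      ((1 - (q : ℂ) ^ 4) • .gen 0 ^ 2)
  | bracket₂ : Sphere4Rel q (star (.gen 2) * .gen 2 - .gen 2 * star (.gen 2))
      (star (.gen 1) * .gen 1 - (q : ℂ) ^ 4 • (.gen 1 * star (.gen 1)))
  | radius : Sphere4Rel q (.gen 0 ^ 2 + .gen 1 * star (.gen 1) + .gen 2 * star (.gen 2)) 1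

/-- The `*`-algebra `A(S⁴_q)`. -/
abbrev Sphere4Alg (q : ℝ) : Type := StarPresented (Sphere4Rel q)

/-- The generators `α`, `β` of `A(SU_q(2))`. -/
def suα (q : ℝ) : SUAlg q := StarPresented.gen (SURel q) 0
def suβ (q : ℝ) : SUAlg q := StarPresented.gen (SURel q) 1

/-- The generators `A`, `B` of `A(S²_q)`. -/
def podA (q : ℝ) : PodlesAlg q := StarPresented.gen (PodlesRel q) 0
def podB (q : ℝ) : PodlesAlg q := StarPresented.gen (PodlesRel q) 1

/-- The generators `x_i` of `A(S⁴_q)`. -/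
def sphx (q : ℝ) (i : Fin 3) : Sphere4Alg q := StarPresented.gen (Sphere4Rel q) i

section Embedding

set_option linter.unusedSimpArgs false in
theorem su_identities {R : Type*} [Ring R] [Algebra ℂ R] [StarRing R] [StarModule ℂ R]
    (q : ℝ) (a b : R) (h1 : b * a = (q : ℂ) • (a * b)) (h2 : star b * a = (q : ℂ) • (a * star b))
    (h3 : b * star b = star b * b) (h4 : a * star a + b * star b = 1)
    (h5 : star a * a + (q : ℂ) ^ 2 • (star b * b) = 1) :
    (a * b + star b * star a) * (-a ^ 2 + (q : ℂ) • star b ^ 2) =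
        (q : ℂ) ^ 2 • ((-a ^ 2 + (q : ℂ) • star b ^ 2) * (a * b + star b * star a)) ∧
      (a * b + star b * star a) ^ 2 +
        (-a ^ 2 + (q : ℂ) • star b ^ 2) * star (-a ^ 2 + (q : ℂ) • star b ^ 2) = 1 ∧
      star (-a ^ 2 + (q : ℂ) • star b ^ 2) * (-a ^ 2 + (q : ℂ) • star b ^ 2) -
        (q : ℂ) ^ 4 • ((-a ^ 2 + (q : ℂ) • star b ^ 2) *
          star (-a ^ 2 + (q : ℂ) • star b ^ 2)) = (1 - (q : ℂ) ^ 4) • 1 := by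
  have h1' : star a * star b = (q : ℂ) • (star b * star a) := by
    have := congrArg star h1
    simpa using this
  have h2' : star a * b = (q : ℂ) • (b * star a) := by
    have := congrArg star h2
    simpa using this
  have h4' : a * star a = 1 - star b * b := by rw [← h4, h3]; abel
  have h5' : star a * a = 1 - (q : ℂ) ^ 2 • (star b * b) := by rw [← h5]; abel
  clear h4 h5
  have r (x y z : R) (h : x * y = z) (w : R) : x * (y * w) = z * w := by rw [← mul_assoc, h]
  simp only [star_add, star_neg, star_mul, star_smul, star_star, Complex.star_def,
    Complex.conj_ofReal, pow_two, mul_add, add_mul, neg_mul, mul_neg, smul_mul_assoc,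
    mul_smul_comm, mul_assoc]
  generalize star a = c at *
  generalize star b = d at *
  have h7 : (q : ℂ) • (a * (a * (d * c))) = a * d - a * (d * (d * b)) := by
    have e : (q : ℂ) • (a * (a * (d * c))) = a * (a * c) * d := by
      simp only [mul_assoc, h1', mul_smul_comm]
    rw [e, h4', mul_assoc, sub_mul, one_mul, mul_sub, mul_assoc, h3]
  have h8 : (q : ℂ) ^ 2 • (a * (d * (b * c))) = d * b - d * (d * (b * b)) := by
    have e : (q : ℂ) ^ 2 • (a * (d * (b * c))) = a * c * (d * b) := by
      simp only [mul_assoc, r _ _ _ h1', h2', mul_smul_comm, smul_mul_assoc, smul_smul, pow_two]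
    rw [e, h4', sub_mul, one_mul, mul_assoc, r _ _ _ h3, mul_assoc]
  simp only [h1, h2, h3, h1', h2', h4', h5', r _ _ _ h1, r _ _ _ h2, r _ _ _ h3, r _ _ _ h1',
    r _ _ _ h2', r _ _ _ h4', r _ _ _ h5', mul_add, add_mul, mul_sub, sub_mul, mul_one, one_mul,
    smul_mul_assoc, mul_smul_comm, mul_assoc, smul_smul, smul_sub, smul_add, smul_neg]
  refine ⟨?_, ?_, ?_⟩
  · linear_combination (norm := module) (q : ℂ) • h7
  · module
  · linear_combination (norm := module) ((q : ℂ) ^ 2) • h8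

/-- The images of `x_0, x_1, x_2` under the embedding. -/
def embedGen (q : ℝ) : Fin 3 → SUAlg q ⊗[ℂ] PodlesAlg q :=
  ![-((suα q * suβ q + star (suβ q) * star (suα q)) ⊗ₜ podA q),
    (-suα q ^ 2 + (q : ℂ) • star (suβ q) ^ 2) ⊗ₜ podA q,
    1 ⊗ₜ podB q]

set_option linter.unusedSimpArgs false in
theorem embedGen_rel (q : ℝ) (a b : FreeStarAlg (Fin 3)) (h : Sphere4Rel q a b) :
    FreeStarAlg.lift (embedGen q) a = FreeStarAlg.lift (embedGen q) b := by
  have s1 : suβ q * suα q = (q : ℂ) • (suα q * suβ q) := by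
    have h := StarPresented.mkAlg_eq (SURel.βα (q := q))
    simp only [map_mul, map_add, map_one, map_smul, map_pow, StarPresented.mkAlg_star] at h
    exact h
  have s2 : star (suβ q) * suα q = (q : ℂ) • (suα q * star (suβ q)) := by
    have h := StarPresented.mkAlg_eq (SURel.βsα (q := q))
    simp only [map_mul, map_add, map_one, map_smul, map_pow, StarPresented.mkAlg_star] at h
    exact h
  have s3 : suβ q * star (suβ q) = star (suβ q) * suβ q := by
    have h := StarPresented.mkAlg_eq (SURel.normal (q := q))
    simp only [map_mul, map_add, map_one, map_smul, map_pow, StarPresented.mkAlg_star] at h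
    exact h
  have s4 : suα q * star (suα q) + suβ q * star (suβ q) = 1 := by
    have h := StarPresented.mkAlg_eq (SURel.unit (q := q))
    simp only [map_mul, map_add, map_one, map_smul, map_pow, StarPresented.mkAlg_star] at h
    exact h
  have s5 : star (suα q) * suα q + (q : ℂ) ^ 2 • (star (suβ q) * suβ q) = 1 := by
    have h := StarPresented.mkAlg_eq (SURel.unit' (q := q))
    simp only [map_mul, map_add, map_one, map_smul, map_pow, StarPresented.mkAlg_star] at h
    exact h
  have p1 : star (podA q) = podA q := by
    have h := StarPresented.mkAlg_eq (PodlesRel.selfadj (q := q))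
    simp only [map_mul, map_add, map_one, map_smul, map_pow, StarPresented.mkAlg_star] at h
    exact h
  have p2 : podA q * podB q = (q : ℂ) ^ 2 • (podB q * podA q) := by
    have h := StarPresented.mkAlg_eq (PodlesRel.AB (q := q))
    simp only [map_mul, map_add, map_one, map_smul, map_pow, StarPresented.mkAlg_star] at h
    exact h
  have p3 : podB q * star (podB q) + podA q ^ 2 = 1 := by
    have h := StarPresented.mkAlg_eq (PodlesRel.unit (q := q))
    simp only [map_mul, map_add, map_one, map_smul, map_pow, StarPresented.mkAlg_star] at h
    exact h
  have p4 : star (podB q) * podB q + (q : ℂ) ^ 4 • podA q ^ 2 = 1 := by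
    have h := StarPresented.mkAlg_eq (PodlesRel.unit' (q := q))
    simp only [map_mul, map_add, map_one, map_smul, map_pow, StarPresented.mkAlg_star] at h
    exact h
  have p2' : star (podB q) * podA q = (q : ℂ) ^ 2 • (podA q * star (podB q)) := by
    have := congrArg star p2
    simpa [p1] using this
  obtain ⟨e1, e2, e3⟩ := su_identities q _ _ s1 s2 s3 s4 s5
  have hu : star (suα q * suβ q + star (suβ q) * star (suα q)) =
      suα q * suβ q + star (suβ q) * star (suα q) := by
    simp [add_comm]
  have hg : ∀ i, FreeStarAlg.lift (embedGen q) (.gen i) = embedGen q i := FreeStarAlg.lift_gen _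
  have g0 : embedGen q 0 =
    -((suα q * suβ q + star (suβ q) * star (suα q)) ⊗ₜ podA q) := rfl
  have g1 : embedGen q 1 = (-suα q ^ 2 + (q : ℂ) • star (suβ q) ^ 2) ⊗ₜ podA q := rfl
  have g2 : embedGen q 2 = 1 ⊗ₜ podB q := rfl
  generalize suα q * suβ q + star (suβ q) * star (suα q) = u at *
  generalize -suα q ^ 2 + (q : ℂ) • star (suβ q) ^ 2 = v at *
  have e1' : star v * u = (q : ℂ) ^ 2 • (u * star v) := by
    have := congrArg star e1
    simpa [hu] using this
  have e3' : star v * v = (1 - (q : ℂ) ^ 4) • 1 + (q : ℂ) ^ 4 • (v * star v) := by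
    rw [← e3]; abel
  have e2' : v * star v = 1 - u ^ 2 := by rw [← e2]; abel
  have p3' : podB q * star (podB q) = 1 - podA q ^ 2 := by rw [← p3]; abel
  have p4' : star (podB q) * podB q = 1 - (q : ℂ) ^ 4 • podA q ^ 2 := by rw [← p4]; abel
  cases h with
  | selfadj =>
    rw [map_star, hg]
    simp [g0, hu, p1, TensorProduct.star_tmul]
  | comm i k hik =>
    have : (i = 0 ∧ k = 1) ∨ (i = 0 ∧ k = 2) ∨ (i = 1 ∧ k = 2) := by omega
    rcases this with ⟨rfl, rfl⟩ | ⟨rfl, rfl⟩ | ⟨rfl, rfl⟩ <;>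
      simp [hg, g0, g1, g2, e1, p2, TensorProduct.smul_tmul']
  | comm_star i k hik =>
    have : (i = 0 ∧ k = 1) ∨ (i = 0 ∧ k = 2) ∨ (i = 1 ∧ k = 2) ∨ (i = 1 ∧ k = 0) ∨
      (i = 2 ∧ k = 0) ∨ (i = 2 ∧ k = 1) := by omega
    rcases this with ⟨rfl, rfl⟩ | ⟨rfl, rfl⟩ | ⟨rfl, rfl⟩ | ⟨rfl, rfl⟩ | ⟨rfl, rfl⟩ | ⟨rfl, rfl⟩ <;>
      simp only [map_mul, map_smul, map_star, hg] <;>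
      simp [g0, g1, g2, e1, e1', hu, p1, p2, p2', TensorProduct.smul_tmul',
        TensorProduct.star_tmul]
  | bracket₁ =>
    simp only [map_mul, map_sub, map_smul, map_star, map_pow, hg, g0, g1, TensorProduct.star_tmul,
      p1, Algebra.TensorProduct.tmul_mul_tmul, e3', e2', neg_sq, Algebra.TensorProduct.tmul_pow,
      ← pow_two, TensorProduct.sub_tmul, TensorProduct.add_tmul, ← TensorProduct.smul_tmul']
    module
  | bracket₂ =>
    simp only [map_mul, map_sub, map_smul, map_star, hg, g1, g2, TensorProduct.star_tmul,
      p1, p3', p4', Algebra.TensorProduct.tmul_mul_tmul, e3', star_one, one_mul, ← pow_two,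
      one_pow, TensorProduct.add_tmul, TensorProduct.tmul_sub, TensorProduct.tmul_smul,
      ← TensorProduct.smul_tmul']
    module
  | radius =>
    simp only [map_mul, map_add, map_one, map_star, map_pow, hg, g0, g1, g2,
      TensorProduct.star_tmul, p1, p3', Algebra.TensorProduct.tmul_mul_tmul, e2', neg_sq,
      Algebra.TensorProduct.tmul_pow, star_one, one_pow, ← pow_two, TensorProduct.sub_tmul,
      TensorProduct.tmul_sub, Algebra.TensorProduct.one_def]
    abel

/-- The embedding `φ : A(S⁴_q) → A(SU_q(2)) ⊗ A(S²_q)`. -/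
def embed (q : ℝ) : Sphere4Alg q →⋆ₐ[ℂ] SUAlg q ⊗[ℂ] PodlesAlg q :=
  StarPresented.lift (embedGen q) (embedGen_rel q)

theorem embed_sphx (q : ℝ) (i : Fin 3) : embed q (sphx q i) = embedGen q i :=
  StarPresented.lift_gen _ _ _

end Embedding

/-! ### The Hilbert spaces `H` and `Ĥ` -/

/-- Labels `(l, m₁, m₂, j)` of basis vectors. -/
@[ext]
structure Label where
  l : ℝ
  m₁ : ℝ
  m₂ : ℝ
  j : ℝ

/-- The set `I` of labels of the chiral spinor spaces `H_±`:
`l ∈ ℕ + 1/2`, `j = 1/2, 3/2, …, l`, `j - |m₁| ∈ ℕ`, `l + 1/2 - j - |m₂| ∈ ℕ`. -/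
def spinorLabels : Set Label :=
  {t | (∃ n : ℕ, t.l = n + 1 / 2) ∧ (∃ n : ℕ, t.j = n + 1 / 2) ∧ t.j ≤ t.l ∧
    (∃ n : ℕ, t.j - |t.m₁| = n) ∧ ∃ n : ℕ, t.l + 1 / 2 - t.j - |t.m₂| = n}

/-- The set of labels of `Ĥ`:
`l ∈ ½ℤ`, `l + j ∈ ℤ`, `j + m₁ ∈ ℕ`, `l + 1/2 - j + m₂ ∈ ℕ`. -/
def hatLabels : Set Label :=
  {t | (∃ n : ℤ, t.l = n / 2) ∧ (∃ n : ℤ, t.l + t.j = n) ∧ (∃ n : ℕ, t.j + t.m₁ = n) ∧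
    ∃ n : ℕ, t.l + 1 / 2 - t.j + t.m₂ = n}

/-- `H = H_+ ⊕ H_-`; the sign `±` is an element of `ℤˣ = {1, -1}`. -/
abbrev SpinorSpace : Type := lp (fun _ : spinorLabels × ℤˣ => ℂ) 2

/-- The auxiliary Hilbert space `Ĥ`. -/
abbrev HatSpace : Type := lp (fun _ : hatLabels × ℤˣ => ℂ) 2

open Classical in
/-- The basis vector `|l, m₁, m₂; j⟩_s` of `H` if `(l, m₁, m₂, j)` is a label of `H`, else `0`. -/
def ket (l m₁ m₂ j : ℝ) (s : ℤˣ) : SpinorSpace :=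
  if h : (⟨l, m₁, m₂, j⟩ : Label) ∈ spinorLabels then lp.single 2 (⟨_, h⟩, s) (1 : ℂ) else 0

open Classical in
/-- The basis vector `|l, m₁, m₂; j⟩⟩_s` of `Ĥ` if `(l, m₁, m₂, j)` is a label of `Ĥ`, else `0`. -/
def hatKet (l m₁ m₂ j : ℝ) (s : ℤˣ) : HatSpace :=
  if h : (⟨l, m₁, m₂, j⟩ : Label) ∈ hatLabels then lp.single 2 (⟨_, h⟩, s) (1 : ℂ) else 0

theorem spinorLabels_subset : spinorLabels ⊆ hatLabels := by
  rintro ⟨l, m₁, m₂, j⟩ ⟨⟨a, ha⟩, ⟨b, hb⟩, hjl, ⟨c, hc⟩, ⟨d, hd⟩⟩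
  dsimp only at ha hb hjl hc hd
  have hba : b ≤ a := by
    have : (b : ℝ) ≤ a := by linarith
    exact_mod_cast this
  obtain ⟨e, rfl⟩ := Nat.exists_eq_add_of_le hba
  push_cast at ha
  refine ⟨⟨2 * (b + e) + 1, ?_⟩, ⟨2 * b + e + 1, ?_⟩, ?_, ?_⟩
  · push_cast; linarith
  · push_cast; linarith
  · rcases abs_cases m₁ with ⟨h, h'⟩ | ⟨h, h'⟩
    · have hcb : c ≤ 2 * b + 1 := by
        have : (c : ℝ) ≤ 2 * b + 1 := by linarith
        exact_mod_cast this
      refine ⟨2 * b + 1 - c, ?_⟩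
      push_cast [Nat.cast_sub hcb]; linarith
    · exact ⟨c, by linarith⟩
  · rcases abs_cases m₂ with ⟨h, h'⟩ | ⟨h, h'⟩
    · have hcb : d ≤ 2 * e + 1 := by
        have : (d : ℝ) ≤ 2 * e + 1 := by linarith
        exact_mod_cast this
      refine ⟨2 * e + 1 - d, ?_⟩
      push_cast [Nat.cast_sub hcb]; linarith
    · exact ⟨d, by linarith⟩

/-- The inclusion of the index set of `H` into that of `Ĥ`. -/
def labelIncl (i : spinorLabels × ℤˣ) : hatLabels × ℤˣ :=
  (⟨i.1.1, spinorLabels_subset i.1.2⟩, i.2)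

theorem labelIncl_injective : Function.Injective labelIncl := by
  rintro ⟨⟨t, ht⟩, s⟩ ⟨⟨t', ht'⟩, s'⟩ h
  simp only [labelIncl, Prod.mk.injEq, Subtype.mk.injEq] at h
  simp [h.1, h.2]

/-- The projection `P : Ĥ → H`, which forgets the coordinates outside the index set of `H`. -/
def projP : HatSpace →L[ℂ] SpinorSpace :=
  LinearMap.mkContinuous
    { toFun := fun y => ⟨fun i => y (labelIncl i), by
        have h := (memℓp_gen_iff (by norm_num : 0 < (2 : ENNReal).toReal)).1 (lp.memℓp y)
        exact memℓp_gen (h.comp_injective labelIncl_injective)⟩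
      map_add' := fun _ _ => rfl
      map_smul' := fun _ _ => rfl } 1 (by
    intro y
    rw [one_mul]
    have h2 : 0 < (2 : ENNReal).toReal := by norm_num
    refine lp.norm_le_of_tsum_le h2 (norm_nonneg _) ?_
    rw [lp.norm_rpow_eq_tsum h2 y]
    have h := (memℓp_gen_iff h2).1 (lp.memℓp y)
    exact tsum_comp_le_tsum_of_inj h (fun _ => by positivity) labelIncl_injective)

theorem projP_apply (y : HatSpace) (i : spinorLabels × ℤˣ) : projP y i = y (labelIncl i) := rfl

/-- The inclusion `Q : H → Ĥ`, the adjoint of `P`. -/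
def inclQ : SpinorSpace →L[ℂ] HatSpace := ContinuousLinearMap.adjoint projP

theorem projP_hatKet {t : Label} (ht : t ∈ hatLabels) (s : ℤˣ) :
    projP (hatKet t.l t.m₁ t.m₂ t.j s) = ket t.l t.m₁ t.m₂ t.j s := by
  classical
  rcases t with ⟨l, m₁, m₂, j⟩
  ext ⟨⟨t', ht'⟩, s'⟩
  rw [projP_apply]
  simp only [hatKet, ket, labelIncl]
  rw [dif_pos ht]
  split_ifs with h
  · simp [lp.single_apply, Pi.single_apply]
  · have : ¬ (t' = ⟨l, m₁, m₂, j⟩) := by rintro rfl; exact h ht'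
    simp [lp.single_apply, this]

theorem inclQ_ket {t : Label} (ht : t ∈ spinorLabels) (s : ℤˣ) :
    inclQ (ket t.l t.m₁ t.m₂ t.j s) = hatKet t.l t.m₁ t.m₂ t.j s := by
  classical
  rcases t with ⟨l, m₁, m₂, j⟩
  have ht' : (⟨l, m₁, m₂, j⟩ : Label) ∈ hatLabels := spinorLabels_subset ht
  refine ext_inner_right ℂ fun y => ?_
  rw [inclQ, ContinuousLinearMap.adjoint_inner_left]
  simp only [hatKet, ket]
  rw [dif_pos ht, dif_pos ht', lp.inner_single_left, lp.inner_single_left, projP_apply]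
  rfl

/-! ### The representation of `A(S⁴_q)` on chiral spinors -/

/-- The `q`-number `[z] = (q^z - q^{-z}) / (q - q^{-1})`. -/
def qnum (q z : ℝ) : ℝ := (q ^ z - q ^ (-z)) / (q - q⁻¹)

open Classical in
/-- `ε = ½ (-1)^{l + 1/2 - j - m₂}`. -/
def eps (l j m₂ : ℝ) : ℝ := if ∃ k : ℤ, l + 1 / 2 - j - m₂ = 2 * k then 1 / 2 else -(1 / 2)

/-- The coefficient `A⁺_{j,m₁}`. -/
def coefAp (q j m₁ : ℝ) : ℝ :=
  q ^ (m₁ - 1) * (√(qnum q (j + m₁ + 1) * qnum q (j - m₁ + 1)) / qnum q (2 * j + 2))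

/-- The coefficient `A⁰_{j,m₁}`. -/
def coefA0 (q j m₁ : ℝ) : ℝ :=
  q ^ (-2 : ℝ) * ((q ^ (j + m₁ + 1) * qnum q 2 * qnum q (j - m₁) - qnum q (2 * j)) /
    (qnum q (2 * j) * qnum q (2 * j + 2)))

/-- The coefficient `B⁺_{j,m₁}`. -/
def coefBp (q j m₁ : ℝ) : ℝ :=
  q ^ (-j + m₁ - 1 / 2) * (√(qnum q (j + m₁ + 1) * qnum q (j + m₁ + 2)) / qnum q (2 * j + 2))

/-- The coefficient `B⁰_{j,m₁}`. -/
def coefB0 (q j m₁ : ℝ) : ℝ :=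
  (1 + q ^ 2) * q ^ (m₁ - 1 / 2) *
    (√(qnum q (j - m₁) * qnum q (j + m₁ + 1)) / (qnum q (2 * j) * qnum q (2 * j + 2)))

/-- The coefficient `B⁻_{j,m₁}`. -/
def coefBm (q j m₁ : ℝ) : ℝ :=
  -(q ^ (j + m₁ + 1 / 2) * (√(qnum q (j - m₁) * qnum q (j - m₁ - 1)) / qnum q (2 * j)))

/-- The coefficient `C⁺_{l,j,m₂}`. -/
def coefCp (q l j m₂ : ℝ) : ℝ :=
  let ε := eps l j m₂;
  -(q ^ (m₂ - 1 - ε) *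
    (√(qnum q (l + j + m₂ + 3 + ε) * qnum q (l + j - m₂ + 3 - ε)) / qnum q (2 * l + 4)))

/-- The coefficient `C⁰_{l,j,m₂}`. -/
def coefC0 (q l j m₂ : ℝ) : ℝ :=
  let ε := eps l j m₂;
  qnum q (4 * ε) * q ^ (2 * ε * l + m₂ - 1 + 3 * ε) *
    (√(qnum q (l + 1 / 2 + j - 2 * ε * m₂ + 2) * qnum q (l + 1 / 2 - j - 2 * ε * m₂)) /
      (qnum q (2 * l + 2) * qnum q (2 * l + 4)))

/-- The coefficient `C⁻_{l,j,m₂}`. -/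
def coefCm (q l j m₂ : ℝ) : ℝ :=
  let ε := eps l j m₂;
  -(q ^ (m₂ - 1 + ε) *
    (√(qnum q (l - j + m₂ - ε) * qnum q (l - j - m₂ + ε)) / qnum q (2 * l + 2)))

/-- The coefficient `H⁺_{l,j,m₂}`. -/
def coefHp (q l j m₂ : ℝ) : ℝ :=
  let ε := eps l j m₂;
  q ^ (m₂ - 1 + ε * (2 * j + 1)) *
    (√(qnum q (l + 2 * ε * j - m₂ + 2 + ε) * qnum q (l - 2 * ε * j + m₂ + 2 - ε)) /
      qnum q (2 * l + 4))

/-- The coefficient `H⁰_{l,j,m₂}`. -/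
def coefH0 (q l j m₂ : ℝ) : ℝ :=
  let ε := eps l j m₂;
  (qnum q (l - ε * (2 * j + 1) - m₂ + 1) * qnum q (l - ε * (2 * j + 1) + m₂ + 2) -
      q ^ (-2 : ℝ) *
        (qnum q (l + ε * (2 * j + 1) - m₂ + 2) * qnum q (l + ε * (2 * j + 1) + m₂ + 1))) /
    (qnum q (2 * l + 2) * qnum q (2 * l + 4))

/-- The coefficient `D⁺_{l,j,m₂}`. -/
def coefDp (q l j m₂ : ℝ) : ℝ :=
  let ε := eps l j m₂;
  q ^ (-l + m₂ - 3 / 2) *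
    (√(qnum q (l + j + m₂ + 3 + ε) * qnum q (l - j + m₂ + 2 - ε)) / qnum q (2 * l + 4))

/-- The coefficient `D⁰_{l,j,m₂}`. -/
def coefD0 (q l j m₂ : ℝ) : ℝ :=
  let ε := eps l j m₂;
  qnum q 2 * q ^ (m₂ + 1 / 2) *
    (√(qnum q (l - 2 * ε * j - m₂ + 1 - ε) * qnum q (l - 2 * ε * j + m₂ + 2 - ε)) /
      (qnum q (2 * l + 2) * qnum q (2 * l + 4)))

/-- The coefficient `D⁻_{l,j,m₂}`. -/
def coefDm (q l j m₂ : ℝ) : ℝ :=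
  let ε := eps l j m₂;
  -(q ^ (l + m₂ + 3 / 2) *
    (√(qnum q (l - j - m₂ + ε) * qnum q (l + j - m₂ + 1 - ε)) / qnum q (2 * l + 2)))

/-- The vector `x_0 |l, m₁, m₂; j⟩_s`. -/
def x0Ket (q l m₁ m₂ j : ℝ) (s : ℤˣ) : SpinorSpace :=
  let σ : ℝ := ((s : ℤ) : ℝ);
  Complex.ofReal (coefAp q j m₁ * coefCp q l j m₂) • ket (l + 1) m₁ m₂ (j + 1) s
  + Complex.ofReal (-σ * (coefAp q j m₁ * coefC0 q l j m₂)) • ket l m₁ m₂ (j + 1) s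
  + Complex.ofReal (coefAp q j m₁ * coefCm q l j m₂) • ket (l - 1) m₁ m₂ (j + 1) s
  + Complex.ofReal (coefA0 q j m₁ * coefHp q l j m₂) • ket (l + 1) m₁ m₂ j s
  + Complex.ofReal (σ * (coefA0 q j m₁ * coefH0 q l j m₂)) • ket l m₁ m₂ j s
  + Complex.ofReal (coefA0 q j m₁ * coefHp q (l - 1) j m₂) • ket (l - 1) m₁ m₂ j s
  + Complex.ofReal (coefAp q (j - 1) m₁ * coefCm q (l + 1) (j - 1) m₂) • ket (l + 1) m₁ m₂ (j - 1) s
  + Complex.ofReal (-σ * (coefAp q (j - 1) m₁ * coefC0 q l (j - 1) m₂)) • ket l m₁ m₂ (j - 1) s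
  + Complex.ofReal (coefAp q (j - 1) m₁ * coefCp q (l - 1) (j - 1) m₂) • ket (l - 1) m₁ m₂ (j - 1) s

/-- The vector `x_1 |l, m₁, m₂; j⟩_s`. -/
def x1Ket (q l m₁ m₂ j : ℝ) (s : ℤˣ) : SpinorSpace :=
  let σ : ℝ := ((s : ℤ) : ℝ);
  Complex.ofReal (coefBp q j m₁ * coefCp q l j m₂) • ket (l + 1) (m₁ + 1) m₂ (j + 1) s
  + Complex.ofReal (-σ * (coefBp q j m₁ * coefC0 q l j m₂)) • ket l (m₁ + 1) m₂ (j + 1) s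
  + Complex.ofReal (coefBp q j m₁ * coefCm q l j m₂) • ket (l - 1) (m₁ + 1) m₂ (j + 1) s
  + Complex.ofReal (coefB0 q j m₁ * coefHp q l j m₂) • ket (l + 1) (m₁ + 1) m₂ j s
  + Complex.ofReal (σ * (coefB0 q j m₁ * coefH0 q l j m₂)) • ket l (m₁ + 1) m₂ j s
  + Complex.ofReal (coefB0 q j m₁ * coefHp q (l - 1) j m₂) • ket (l - 1) (m₁ + 1) m₂ j s
  + Complex.ofReal (coefBm q j m₁ * coefCm q (l + 1) (j - 1) m₂) • ket (l + 1) (m₁ + 1) m₂ (j - 1) s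
  + Complex.ofReal (-σ * (coefBm q j m₁ * coefC0 q l (j - 1) m₂)) • ket l (m₁ + 1) m₂ (j - 1) s
  + Complex.ofReal (coefBm q j m₁ * coefCp q (l - 1) (j - 1) m₂) • ket (l - 1) (m₁ + 1) m₂ (j - 1) s

/-- The vector `x_2 |l, m₁, m₂; j⟩_s`. -/
def x2Ket (q l m₁ m₂ j : ℝ) (s : ℤˣ) : SpinorSpace :=
  let σ : ℝ := ((s : ℤ) : ℝ);
  Complex.ofReal (coefDp q l j m₂) • ket (l + 1) m₁ (m₂ + 1) j s
  + Complex.ofReal (σ * coefD0 q l j m₂) • ket l m₁ (m₂ + 1) j s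
  + Complex.ofReal (coefDm q l j m₂) • ket (l - 1) m₁ (m₂ + 1) j s

/-- `ρ` is the chiral spinor representation of `A(S⁴_q)` on `H = H_+ ⊕ H_-`. A `*`-homomorphism
is determined by its values on the generators, and a bounded operator on `H` by its values on the
basis vectors. -/
structure IsSpinorRep (q : ℝ) (ρ : Sphere4Alg q →⋆ₐ[ℂ] (SpinorSpace →L[ℂ] SpinorSpace)) :
    Prop where
  x0 : ∀ t ∈ spinorLabels, ∀ s : ℤˣ,
    ρ (sphx q 0) (ket t.l t.m₁ t.m₂ t.j s) = x0Ket q t.l t.m₁ t.m₂ t.j s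
  x1 : ∀ t ∈ spinorLabels, ∀ s : ℤˣ,
    ρ (sphx q 1) (ket t.l t.m₁ t.m₂ t.j s) = x1Ket q t.l t.m₁ t.m₂ t.j s
  x2 : ∀ t ∈ spinorLabels, ∀ s : ℤˣ,
    ρ (sphx q 2) (ket t.l t.m₁ t.m₂ t.j s) = x2Ket q t.l t.m₁ t.m₂ t.j s

/-! ### The representation of `A(SU_q(2)) ⊗ A(S²_q)` on `Ĥ` -/

/-- `π` is the representation of `A(SU_q(2)) ⊗ A(S²_q)` on `Ĥ`, determined by the images of the
generators `α`, `β`, `A`, `B` on the basis vectors. -/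
structure IsHatRep (q : ℝ)
    (π : SUAlg q ⊗[ℂ] PodlesAlg q →⋆ₐ[ℂ] (HatSpace →L[ℂ] HatSpace)) : Prop where
  α : ∀ t ∈ hatLabels, ∀ s : ℤˣ,
    π (suα q ⊗ₜ 1) (hatKet t.l t.m₁ t.m₂ t.j s) =
      ((√(1 - q ^ (2 * (t.j + t.m₁ + 1))) : ℝ) : ℂ) •
        hatKet (t.l + 1 / 2) (t.m₁ + 1 / 2) t.m₂ (t.j + 1 / 2) s
  β : ∀ t ∈ hatLabels, ∀ s : ℤˣ,
    π (suβ q ⊗ₜ 1) (hatKet t.l t.m₁ t.m₂ t.j s) =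
      ((q ^ (t.j + t.m₁) : ℝ) : ℂ) •
        hatKet (t.l + 1 / 2) (t.m₁ - 1 / 2) t.m₂ (t.j + 1 / 2) s
  A : ∀ t ∈ hatLabels, ∀ s : ℤˣ,
    π (1 ⊗ₜ podA q) (hatKet t.l t.m₁ t.m₂ t.j s) =
      ((q ^ (t.l - t.j + t.m₂ - eps t.l t.j t.m₂) : ℝ) : ℂ) • hatKet t.l t.m₁ t.m₂ t.j s
  B : ∀ t ∈ hatLabels, ∀ s : ℤˣ,
    π (1 ⊗ₜ podB q) (hatKet t.l t.m₁ t.m₂ t.j s) =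
      ((√(1 - q ^ (2 * (t.l - t.j + t.m₂ + 2 - eps t.l t.j t.m₂))) : ℝ) : ℂ) •
        hatKet (t.l + 1) t.m₁ (t.m₂ + 1) t.j s

/-! ### The operator `|D|`, the algebra `OP⁰` and the ideal `𝓘` -/

/-- The flip `F |l, m₁, m₂; j⟩_± = |l, m₁, m₂; j⟩_∓`, on coordinate sequences. -/
def flipIdx (i : spinorLabels × ℤˣ) : spinorLabels × ℤˣ := (i.1, -i.2)

/-- The Dirac operator `D |l, m₁, m₂; j⟩_± = (l + 3/2) |l, m₁, m₂; j⟩_∓`, with its natural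
(maximal) domain, on which it is self-adjoint. -/
def dirac : SpinorSpace →ₗ.[ℂ] SpinorSpace where
  domain :=
    { carrier := {x | Memℓp (fun i => (((flipIdx i).1.1.l + 3 / 2 : ℝ) : ℂ) * x (flipIdx i)) 2}
      add_mem' := fun {x y} hx hy => by
        have h := hx.add hy
        refine (congrArg (Memℓp · 2) (funext fun i => ?_)).mp h
        exact (mul_add _ _ _).symm
      zero_mem' := by
        have h : Memℓp (fun _ : spinorLabels × ℤˣ => (0 : ℂ)) 2 := zero_memℓp
        simpa using h
      smul_mem' := fun c x hx => by
        have h := hx.const_smul c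
        refine (congrArg (Memℓp · 2) (funext fun i => ?_)).mp h
        exact (mul_left_comm _ _ _).symm }
  toFun :=
    { toFun := fun x => ⟨_, x.2⟩
      map_add' := fun x y => by ext i; exact mul_add _ _ _
      map_smul' := fun c x => by ext i; exact mul_left_comm _ _ _ }

/-- `|D| |l, m₁, m₂; j⟩_± = (l + 3/2) |l, m₁, m₂; j⟩_±`, with its natural (maximal) domain. -/
def absDirac : SpinorSpace →ₗ.[ℂ] SpinorSpace where
  domain :=
    { carrier := {x | Memℓp (fun i => ((i.1.1.l + 3 / 2 : ℝ) : ℂ) * x i) 2}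
      add_mem' := fun {x y} hx hy => by
        have h := hx.add hy
        refine (congrArg (Memℓp · 2) (funext fun i => ?_)).mp h
        exact (mul_add _ _ _).symm
      zero_mem' := by
        have h : Memℓp (fun _ : spinorLabels × ℤˣ => (0 : ℂ)) 2 := zero_memℓp
        simpa using h
      smul_mem' := fun c x hx => by
        have h := hx.const_smul c
        refine (congrArg (Memℓp · 2) (funext fun i => ?_)).mp h
        exact (mul_left_comm _ _ _).symm }
  toFun :=
    { toFun := fun x => ⟨_, x.2⟩
      map_add' := fun x y => by ext i; exact mul_add _ _ _
      map_smul' := fun c x => by ext i; exact mul_left_comm _ _ _ }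

/-- `|D|` has the same domain as `D`, and `|D|² = D²`. -/
theorem absDirac_sq (x y : dirac.domain) (hy : (y : SpinorSpace) = dirac x) :
    ∃ x' y' : absDirac.domain, (x' : SpinorSpace) = x ∧ (y' : SpinorSpace) = absDirac x' ∧
      absDirac y' = dirac y := by
  have h2 : 0 < (2 : ENNReal).toReal := by norm_num
  have hinv : ∀ i, flipIdx (flipIdx i) = i := fun i => by simp [flipIdx]
  have hx : (x : SpinorSpace) ∈ absDirac.domain := by
    have h := (memℓp_gen_iff h2).1 x.2
    have h' := memℓp_gen (p := 2) (f := fun i => ((i.1.1.l + 3 / 2 : ℝ) : ℂ) * x.1 i)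
      ((h.comp_injective (Function.LeftInverse.injective hinv)).congr fun i => by
        simp only [Function.comp_apply, hinv])
    exact h'
  have e : ∀ i, ((i.1.1.l + 3 / 2 : ℝ) : ℂ) * (absDirac ⟨x, hx⟩ : SpinorSpace) i =
      (dirac y : SpinorSpace) i := by
    intro i
    change ((i.1.1.l + 3 / 2 : ℝ) : ℂ) * (((i.1.1.l + 3 / 2 : ℝ) : ℂ) * x.1 i) =
      ((i.1.1.l + 3 / 2 : ℝ) : ℂ) * y.1 (flipIdx i)
    rw [hy]
    change _ = ((i.1.1.l + 3 / 2 : ℝ) : ℂ) * (((i.1.1.l + 3 / 2 : ℝ) : ℂ) *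
      x.1 (flipIdx (flipIdx i)))
    rw [hinv]
  refine ⟨⟨x, hx⟩, ⟨absDirac ⟨x, hx⟩, ?_⟩, rfl, rfl, ?_⟩
  · have h := lp.memℓp (dirac y)
    rw [← funext e] at h
    exact h
  · ext i
    exact e i

theorem spinor_l_pos (i : spinorLabels) : 2 ≤ i.1.l + 3 / 2 := by
  obtain ⟨n, hn⟩ := i.2.1
  have : (0 : ℝ) ≤ n := n.cast_nonneg
  linarith

/-- The bounded operator `|D|^{-p}`, `p ≥ 0`:
`|D|^{-p} |l, m₁, m₂; j⟩_± = (l + 3/2)^{-p} |l, m₁, m₂; j⟩_±`. -/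
def absDiracNegPow (p : ℝ) (hp : 0 ≤ p) : SpinorSpace →L[ℂ] SpinorSpace :=
  have hle : ∀ (x : SpinorSpace) (i : spinorLabels × ℤˣ),
      ‖(((i.1.1.l + 3 / 2) ^ (-p) : ℝ) : ℂ) * x i‖ ≤ ‖x i‖ := by
    intro x i
    have h2 := spinor_l_pos i.1
    have h0 : 0 ≤ (i.1.1.l + 3 / 2) ^ (-p) := by positivity
    have h1 : (i.1.1.l + 3 / 2) ^ (-p) ≤ 1 :=
      Real.rpow_le_one_of_one_le_of_nonpos (by linarith) (by linarith)
    rw [norm_mul, Complex.norm_real, Real.norm_of_nonneg h0]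
    exact mul_le_of_le_one_left (norm_nonneg _) h1
  LinearMap.mkContinuous
    { toFun := fun x => ⟨fun i => (((i.1.1.l + 3 / 2) ^ (-p) : ℝ) : ℂ) * x i,
        (lp.memℓp x).mono' (hle x)⟩
      map_add' := fun x y => by ext i; exact mul_add _ _ _
      map_smul' := fun c x => by ext i; exact mul_left_comm _ _ _ } 1 (by
    intro x
    rw [one_mul]
    exact lp.norm_mono (by norm_num) (hle x))

/-- `S = δ(T)` where `δ = [|D|, ·]`: `T` maps the domain of `|D|` into itself and the operator
`|D| T - T |D|` extends to the bounded operator `S`. -/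
def IsDelta (T S : SpinorSpace →L[ℂ] SpinorSpace) : Prop :=
  ∀ x : absDirac.domain, ∃ h : T x ∈ absDirac.domain,
    absDirac ⟨T x, h⟩ - T (absDirac x) = S x

/-- The domain of `δ^n`. -/
def domDelta : ℕ → Set (SpinorSpace →L[ℂ] SpinorSpace)
  | 0 => Set.univ
  | n + 1 => {T | ∃ S, IsDelta T S ∧ S ∈ domDelta n}

/-- The smooth domain `OP⁰` of `δ`. -/
def OP0 : Set (SpinorSpace →L[ℂ] SpinorSpace) := ⋂ n, domDelta n

/-- `T` is trace class: `Tr |T| < ∞`, the trace being computed in an orthonormal basis. -/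
def IsTraceClass {E : Type} [NormedAddCommGroup E] [InnerProductSpace ℂ E] [CompleteSpace E]
    (T : E →L[ℂ] E) : Prop :=
  ∃ (ι : Type) (b : HilbertBasis ι ℂ E),
    Summable fun i => RCLike.re (inner ℂ (b i) (CFC.abs T (b i)))

/-- `𝓘 = {T ∈ OP⁰ : T |D|^{-p} is trace class for all p > 2}`. -/
def idealI : Set (SpinorSpace →L[ℂ] SpinorSpace) :=
  {T | T ∈ OP0 ∧ ∀ (p : ℝ) (hp : 2 < p),
    IsTraceClass (T ∘L absDiracNegPow p (zero_le_two.trans hp.le))}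

end

/-! Existence on H. A matrix element of x₀ or x₁ is a factor in (j, m₁) times a factor in (l, j,
m₂); one of x₂ has only the second factor. In the integer coordinates of `lab`, the square roots in
these factors have the form √(1 - q^{2z}), where z lies on a coordinate that the arrow raises or
lowers. Rescaling the basis by products of 1/√(1 - q^{2k}) (`gSpin`, `gCell`) therefore makes all
coefficients rational in powers of q, and 1 - q^0 = 0 kills each arrow that would enter the index
set from outside. Hence one may compute with formal combinations of all integer cells and push the
result to H (`famOp_toSp`).

On cells, let C, H, T be the parts of x₀, x₁ that raise, preserve and lower j, and D, E the parts of
x₂, x₂^*. Then (`op_relations`) H and D satisfy the relations of A(S²_q), namely HD = q²DH, H² = 1 -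
DE and ED = 1 - q⁴H²; moreover CT = TC = H², both C and T commute with H, and both q²-commute with
D. With these the relations of A(S⁴_q) turn into rational identities in q^i and q^u
(`opX_relations`). Adjoints are reversed arrows.

Existence on Ĥ. There α, β, A, B are weighted shifts with coefficients in q^{j+m₁} and q^{l-j+m₂-ε}
only, and the coefficient of a shift vanishes where the shift would leave the index set; the
relations are checked on basis vectors. In both cases uniqueness holds because the generators
generate and the basis vectors span a dense subspace.

Comparison. For large j every arrow of x₀, x₁, x₁^* is O(q^j) except those moving (l, j) by (1, 1)
or (-1, -1), and every arrow of x₂ (of x₂^*) except the one raising (lowering) l. The survivors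
agree up to O(q^j) with the matrix elements of π (`near_leadX`, `near_leadY`). So QT - RQ maps the
basis vectors to vectors of norm O(q^j), where T and R are the two images of a generator or of its
adjoint. This passes to products through QTT' - RR'Q = (QT - RQ)T' + R(QT' - R'Q), since arrows move
j by at most 1 (`agree_rep`), and T - PRQ = P(QT - RQ).

Membership in the ideal. All operators involved are finite sums of operators shifting l by a fixed
k, on which δ is multiplication by k; this gives OP⁰ (`mem_OP0`). The column norms of (T -
PRQ)|D|^{-p} are O((l + 3/2)^{-p} q^j). There are O(l) values of m₂ and 2j + 1 values of m₁, so they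
are summable for p > 2 (`Small.isTraceClass`). -/

open scoped TensorProduct ComplexConjugate InnerProductSpace

noncomputable section

/-! ### Reduced operators -/

namespace Reduced

/-- `1 - q^{2n}`. -/
def qb (q : ℝ) (n : ℤ) : ℝ := 1 - q ^ (2 * n)

/-- Formal linear combinations of cells `(h, N, e)`. -/
abbrev Cells : Type := ℤ × ℤ × Bool →₀ ℝ

/-- The integers `h`, `N` are unrestricted: cells outside the index set are kept, so that
compositions need no case distinctions at the boundary. The spin index i is a parameter of the
operators and not part of a cell, because it also enters the factors in (j, m₁). -/
def cell (h N : ℤ) (e : Bool) : Cells := Finsupp.single (h, N, e) 1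

def opOf (f : ℤ → ℤ → Bool → Cells) : Cells →ₗ[ℝ] Cells :=
  Finsupp.linearCombination ℝ fun c => f c.1 c.2.1 c.2.2

theorem opOf_cell (f : ℤ → ℤ → Bool → Cells) (h N : ℤ) (e : Bool) :
    opOf f (cell h N e) = f h N e := by
  simp [opOf, cell]

theorem cell_ext {M : Type*} [AddCommGroup M] [Module ℝ M] {f g : Cells →ₗ[ℝ] M}
    (H : ∀ h N e, f (cell h N e) = g (cell h N e)) : f = g := by
  refine Finsupp.lhom_ext fun ⟨h, N, e⟩ b => ?_
  have : Finsupp.single (h, N, e) b = b • cell h N e := by simp [cell]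
  rw [this, map_smul, map_smul, H]

variable (q σ : ℝ)

/-- The spin raising operator. -/
def opC (i : ℤ) : Cells →ₗ[ℝ] Cells := opOf fun h N e =>
  match e with
  | true =>
    (-(q ^ (2 * N) * qb q (2 * (i + N) + 5) * qb q (2 * (h - N) + 3) / qb q (2 * (h + 2) + 1))) •
      cell (h + 1) N true +
    (-(σ * qb q 2 * q ^ (2 * (h + i + 2 * N) + 6) * qb q (2 * (h - N) + 3) /
      (qb q (2 * (h + 1) + 1) * qb q (2 * (h + 2) + 1)))) • cell h N false +
    (-(q ^ (2 * (i + N) + 3) / qb q (2 * (h + 1) + 1))) • cell (h - 1) (N - 1) true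
  | false =>
    (-(q ^ (2 * N) * qb q (2 * (i + N) + 3) * qb q (2 * (h - N) + 5) / qb q (2 * (h + 2) + 1))) •
      cell (h + 1) N false +
    (σ * qb q 2 * q ^ (2 * h + 1) * qb q (2 * (i + N) + 3) /
      (qb q (2 * (h + 1) + 1) * qb q (2 * (h + 2) + 1))) • cell h (N - 1) true +
    (-(q ^ (2 * (i + N) + 1) / qb q (2 * (h + 1) + 1))) • cell (h - 1) (N - 1) false

/-- The spin preserving operator. -/
def opH (i : ℤ) : Cells →ₗ[ℝ] Cells := opOf fun h N e =>
  match e with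
  | true =>
    (q ^ (2 * (i + N) + 3) * qb q (2 * (h - N) + 3) * qb q (2 * N + 2) / qb q (2 * (h + 2) + 1)) •
      cell (h + 1) (N + 1) false +
    (σ * (q ^ (2 * (h + i) + 6) * qb q (2 * (h - i - N)) * qb q (2 * N + 2) -
      q ^ (2 * (h - i)) * qb q (2 * (h - N) + 3) * qb q (2 * (i + N) + 3)) /
      (qb q (2 * (h + 1) + 1) * qb q (2 * (h + 2) + 1))) • cell h N true +
    (q ^ (2 * N) / qb q (2 * (h + 1) + 1)) • cell (h - 1) N false
  | false =>
    (q ^ (2 * N) * qb q (2 * (h - i - N) + 2) * qb q (2 * (i + N) + 3) / qb q (2 * (h + 2) + 1)) •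
      cell (h + 1) N true +
    (σ * (q ^ (2 * (h - i) + 2) * qb q (2 * (h - N) + 3) * qb q (2 * (i + N) + 3) -
      q ^ (2 * (h + i) + 4) * qb q (2 * (h - i - N) + 2) * qb q (2 * N)) /
      (qb q (2 * (h + 1) + 1) * qb q (2 * (h + 2) + 1))) • cell h N false +
    (q ^ (2 * (i + N) + 1) / qb q (2 * (h + 1) + 1)) • cell (h - 1) (N - 1) true

/-- The spin lowering operator. -/
def opT (i : ℤ) : Cells →ₗ[ℝ] Cells := opOf fun h N e =>
  match e with
  | true =>
    (-(q ^ (2 * (i + N) + 3) * qb q (2 * N + 2) * qb q (2 * (h - i - N) + 2) /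
      qb q (2 * (h + 2) + 1))) • cell (h + 1) (N + 1) true +
    (σ * qb q 2 * q ^ (2 * h + 1) * qb q (2 * N + 2) /
      (qb q (2 * (h + 1) + 1) * qb q (2 * (h + 2) + 1))) • cell h (N + 1) false +
    (-(q ^ (2 * N) / qb q (2 * (h + 1) + 1))) • cell (h - 1) N true
  | false =>
    (-(q ^ (2 * (i + N) + 1) * qb q (2 * N + 2) * qb q (2 * (h - i - N) + 2) /
      qb q (2 * (h + 2) + 1))) • cell (h + 1) (N + 1) false +
    (-(σ * qb q 2 * q ^ (2 * (h + i + 2 * N) + 4) * qb q (2 * (h - i - N) + 2) /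
      (qb q (2 * (h + 1) + 1) * qb q (2 * (h + 2) + 1)))) • cell h N true +
    (-(q ^ (2 * N) / qb q (2 * (h + 1) + 1))) • cell (h - 1) N false

/-- The operator of `x_2`. -/
def opD (i : ℤ) : Cells →ₗ[ℝ] Cells := opOf fun h N e =>
  match e with
  | true =>
    (qb q (2 * (i + N) + 5) * qb q (2 * N + 2) / qb q (2 * (h + 2) + 1)) •
      cell (h + 1) (N + 1) true +
    (σ * qb q 2 * q ^ (2 * (h + i + N) + 6) * qb q (2 * N + 2) /
      (qb q (2 * (h + 1) + 1) * qb q (2 * (h + 2) + 1))) • cell h (N + 1) false +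
    (-(q ^ (2 * (i + 2 * N) + 5) / qb q (2 * (h + 1) + 1))) • cell (h - 1) N true
  | false =>
    (qb q (2 * (i + N) + 3) * qb q (2 * N + 2) / qb q (2 * (h + 2) + 1)) •
      cell (h + 1) (N + 1) false +
    (σ * qb q 2 * q ^ (2 * (h + N) + 3) * qb q (2 * (i + N) + 3) /
      (qb q (2 * (h + 1) + 1) * qb q (2 * (h + 2) + 1))) • cell h N true +
    (-(q ^ (2 * (i + 2 * N) + 3) / qb q (2 * (h + 1) + 1))) • cell (h - 1) N false

/-- The operator of `x_2^*`. -/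
def opE (i : ℤ) : Cells →ₗ[ℝ] Cells := opOf fun h N e =>
  match e with
  | true =>
    (-(q ^ (2 * (i + 2 * N) + 5) * qb q (2 * (h - i - N) + 2) * qb q (2 * (h - N) + 3) /
      qb q (2 * (h + 2) + 1))) • cell (h + 1) N true +
    (σ * qb q 2 * q ^ (2 * (h + N) + 3) * qb q (2 * (h - N) + 3) /
      (qb q (2 * (h + 1) + 1) * qb q (2 * (h + 2) + 1))) • cell h N false +
    (1 / qb q (2 * (h + 1) + 1)) • cell (h - 1) (N - 1) true
  | false =>
    (-(q ^ (2 * (i + 2 * N) + 3) * qb q (2 * (h - i - N) + 2) * qb q (2 * (h - N) + 5) /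
      qb q (2 * (h + 2) + 1))) • cell (h + 1) N false +
    (σ * qb q 2 * q ^ (2 * (h + i + N) + 4) * qb q (2 * (h - i - N) + 2) /
      (qb q (2 * (h + 1) + 1) * qb q (2 * (h + 2) + 1))) • cell h (N - 1) true +
    (1 / qb q (2 * (h + 1) + 1)) • cell (h - 1) (N - 1) false

variable {q σ}

/-- All denominators sit at odd indices, where the exponent of q cannot be 0. Negative `n` is
included since cells are arbitrary. -/
theorem qb_odd_ne_zero (hq₀ : 0 < q) (hq₁ : q < 1) (n : ℤ) : qb q (2 * n + 1) ≠ 0 := by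
  intro h
  have h1 : q ^ (2 * (2 * n + 1)) = 1 := by unfold qb at h; linarith
  have h2 := (zpow_eq_one_iff_right₀ hq₀.le hq₁.ne).1 h1
  omega

-- The whole dependence on l and m₂ of the relations of A(S⁴_q) is contained here. The last two
-- identities and the fifth are the relations of A(S²_q) with `opH` as A and `opD` as B; the raising
-- and lowering operators are companions of `opH` whose products in either order equal its square.
set_option linter.unusedSimpArgs false in
set_option maxHeartbeats 10000000 in
theorem op_relations (hq₀ : 0 < q) (hq₁ : q < 1) (hσ : σ ^ 2 = 1) (i : ℤ) :
    opC q σ i ∘ₗ opH q σ i = opH q σ (i + 1) ∘ₗ opC q σ i ∧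
    opT q σ i ∘ₗ opH q σ i = opH q σ (i - 1) ∘ₗ opT q σ i ∧
    opC q σ i ∘ₗ opD q σ i = q ^ 2 • opD q σ (i + 1) ∘ₗ opC q σ i ∧
    opT q σ i ∘ₗ opD q σ i = q ^ 2 • opD q σ (i - 1) ∘ₗ opT q σ i ∧
    opH q σ i ∘ₗ opD q σ i = q ^ 2 • opD q σ i ∘ₗ opH q σ i ∧
    opT q σ (i + 1) ∘ₗ opC q σ i = 1 - opD q σ i ∘ₗ opE q σ i ∧
    opC q σ (i - 1) ∘ₗ opT q σ i = 1 - opD q σ i ∘ₗ opE q σ i ∧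
    opH q σ i ∘ₗ opH q σ i = 1 - opD q σ i ∘ₗ opE q σ i ∧
    opE q σ i ∘ₗ opD q σ i = (1 - q ^ 4) • 1 + q ^ 4 • opD q σ i ∘ₗ opE q σ i := by
  have hd := qb_odd_ne_zero hq₀ hq₁
  have hq := hq₀.ne'
  -- The denominators are kept as nonzero atoms until fractions are cleared, and expanded only
  -- afterwards.
  have key : ∀ h : ℤ, ∃ d₀ d₁ d₂ d₃ : ℝ, qb q (2 * h + 1) = d₀ ∧ qb q (2 * (h + 1) + 1) = d₁ ∧
      qb q (2 * (h + 2) + 1) = d₂ ∧ qb q (2 * (h + 3) + 1) = d₃ ∧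
      d₀ ≠ 0 ∧ d₁ ≠ 0 ∧ d₂ ≠ 0 ∧ d₃ ≠ 0 :=
    fun h => ⟨_, _, _, _, rfl, rfl, rfl, rfl, hd _, hd _, hd _, hd _⟩
  refine ⟨?_, ?_, ?_, ?_, ?_, ?_, ?_, ?_, ?_⟩ <;> refine cell_ext fun h N e => ?_
  all_goals
    obtain ⟨d₀, d₁, d₂, d₃, e₀, e₁, e₂, e₃, n₀, n₁, n₂, n₃⟩ := key h
    have k₁ : h + 1 + 1 = h + 2 := by ring
    have k₂ : h + 1 + 2 = h + 3 := by ring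
    have k₃ : h - 1 + 2 = h + 1 := by ring
    have hx := zpow_ne_zero N hq
    have hy := zpow_ne_zero h hq
    have hz := zpow_ne_zero i hq
    clear key hd
    -- Comparing coefficients of cells leaves rational identities in x = q^N, y = q^h, z = q^i. The
    -- sign occurs squared where two diagonal steps in l are composed.
    cases e <;>
      simp only [LinearMap.comp_apply, LinearMap.smul_apply, LinearMap.add_apply,
        LinearMap.sub_apply, Module.End.one_apply, opC, opT, opH, opD, opE, opOf_cell, map_add,
        map_smul, add_sub_cancel_right, sub_add_cancel, k₁, k₂, k₃, e₀, e₁, e₂, e₃] <;>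
      match_scalars <;>
      simp only [qb, zpow_add₀ hq, zpow_sub₀ hq, zpow_mul', zpow_ofNat, mul_one] at * <;>
      generalize q ^ N = x at * <;> generalize q ^ h = y at * <;> generalize q ^ i = z at * <;>
      field_simp <;> subst e₀ e₁ e₂ e₃ <;>
      first | ring1 | (ring_nf; simp only [hσ]; ring1)

end Reduced

/-! ### Weighted shifts on spaces of square summable families of labels -/

namespace LabelSpace

abbrev Sp (I : Set Label) : Type := lp (fun _ : I × ℤˣ => ℂ) 2

variable {I J : Set Label}

open Classical in
/-- The basis vector with label `t`, or `0` if `t` is not in `I`. -/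
def vec (I : Set Label) (t : Label) (s : ℤˣ) : Sp I :=
  if h : t ∈ I then lp.single 2 (⟨t, h⟩, s) (1 : ℂ) else 0

open Classical in
/-- Coordinates, extended by `0` to all labels. -/
def coord (x : Sp I) (p : Label × ℤˣ) : ℂ := if h : p.1 ∈ I then x (⟨p.1, h⟩, p.2) else 0

theorem coord_mk (x : Sp I) (i : I × ℤˣ) : coord x (i.1, i.2) = x i := by
  simp [coord]

theorem coord_of_notMem (x : Sp I) {p : Label × ℤˣ} (h : p.1 ∉ I) : coord x p = 0 := by
  simp [coord, h]

theorem coord_add (x y : Sp I) (p : Label × ℤˣ) : coord (x + y) p = coord x p + coord y p := by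
  unfold coord; split_ifs <;> simp

theorem coord_smul (c : ℂ) (x : Sp I) (p : Label × ℤˣ) : coord (c • x) p = c * coord x p := by
  unfold coord; split_ifs <;> simp

theorem ext_coord {x y : Sp I} (h : ∀ t ∈ I, ∀ s, coord x (t, s) = coord y (t, s)) : x = y := by
  ext i
  rw [← coord_mk x i, ← coord_mk y i]
  exact h _ i.1.2 _

theorem vec_of_notMem {t : Label} (h : t ∉ I) (s : ℤˣ) : vec I t s = 0 := by simp [vec, h]

theorem inner_vec {t : Label} (s : ℤˣ) (x : Sp I) : ⟪vec I t s, x⟫_ℂ = coord x (t, s) := by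
  classical
  unfold vec coord
  split_ifs with h
  · rw [lp.inner_single_left]; simp
  · simp

theorem coord_vec {t : Label} (ht : t ∈ I) (s : ℤˣ) (p : Label × ℤˣ) [Decidable (p = (t, s))] :
    coord (vec I t s) p = if p = (t, s) then 1 else 0 := by
  classical
  rcases p with ⟨t', s'⟩
  unfold coord vec
  rw [dif_pos ht]
  dsimp only
  split_ifs with h h1 h1
  · obtain ⟨rfl, rfl⟩ := Prod.mk.inj h1
    simp
  · rw [lp.single_apply, Pi.single_apply, if_neg]
    rintro h2
    apply h1
    simp only [Prod.mk.injEq, Subtype.mk.injEq] at h2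
    exact Prod.ext h2.1 h2.2
  · obtain ⟨rfl, rfl⟩ := Prod.mk.inj h1
    exact absurd ht h
  · rfl

theorem norm_vec_le (t : Label) (s : ℤˣ) : ‖vec I t s‖ ≤ 1 := by
  classical
  unfold vec
  split_ifs
  · rw [lp.norm_single (by norm_num)]; simp
  · simp

theorem hasSum_vec (x : Sp I) : HasSum (fun i : I × ℤˣ => x i • vec I i.1 i.2) x := by
  classical
  convert lp.hasSum_single (by norm_num : (2 : ENNReal) ≠ ⊤) x using 2 with i
  rw [vec, dif_pos i.1.2, ← lp.single_smul]
  simp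

theorem clm_ext {F : Type*} [NormedAddCommGroup F] [NormedSpace ℂ F] {S T : Sp I →L[ℂ] F}
    (h : ∀ t ∈ I, ∀ s, S (vec I t s) = T (vec I t s)) : S = T := by
  ext x
  refine ((hasSum_vec x).mapL S).unique ?_
  convert (hasSum_vec x).mapL T using 2 with i
  rw [map_smul, map_smul, h _ i.1.2]

theorem hasSum_coord (x : Sp I) : HasSum (fun p => ‖coord x p‖ ^ (2 : ℝ)) (‖x‖ ^ (2 : ℝ)) := by
  have h2 : 0 < (2 : ENNReal).toReal := by norm_num
  let f : I × ℤˣ → Label × ℤˣ := fun i => (i.1, i.2)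
  have hf : Function.Injective f := by
    rintro ⟨⟨a, ha⟩, b⟩ ⟨⟨c, hc⟩, d⟩ h
    simp only [f, Prod.mk.injEq] at h
    simp [h.1, h.2]
  refine (hf.hasSum_iff ?_).1 ?_
  · intro p hp
    rw [coord_of_notMem, norm_zero, Real.zero_rpow (by norm_num)]
    exact fun h => hp ⟨(⟨p.1, h⟩, p.2), rfl⟩
  · convert lp.hasSum_norm h2 x using 2 with i
    · simp only [Function.comp_apply, f]
      rw [coord_mk]; norm_num
    · norm_num

/-- The coefficients `c` are bounded on the arrows `t → σ t` of `I`. -/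
def BddCoef (I : Set Label) (σ : Equiv.Perm Label) (c : Label → ℤˣ → ℝ) : Prop :=
  ∃ B : ℝ, 0 ≤ B ∧ ∀ t ∈ I, σ t ∈ I → ∀ s, |c t s| ≤ B

theorem summable_shift (σ : Equiv.Perm Label) (x : Sp I) :
    Summable (fun i : I × ℤˣ => ‖coord x (σ.symm i.1, i.2)‖ ^ (2 : ℝ)) ∧
      ∑' i : I × ℤˣ, ‖coord x (σ.symm i.1, i.2)‖ ^ (2 : ℝ) ≤ ‖x‖ ^ (2 : ℝ) := by
  let f : I × ℤˣ → Label × ℤˣ := fun i => (σ.symm i.1, i.2)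
  have hf : Function.Injective f := by
    rintro ⟨⟨a, ha⟩, b⟩ ⟨⟨c, hc⟩, d⟩ h
    simp only [f, Prod.mk.injEq, EmbeddingLike.apply_eq_iff_eq] at h
    simp [h.1, h.2]
  have hs := hasSum_coord x
  refine ⟨hs.summable.comp_injective hf, ?_⟩
  rw [← hs.tsum_eq]
  exact tsum_comp_le_tsum_of_inj hs.summable (fun _ => by positivity) hf

theorem norm_wshift_coord_le {σ : Equiv.Perm Label} {c : Label → ℤˣ → ℝ} {B : ℝ}
    (hB : ∀ t ∈ I, σ t ∈ I → ∀ s, |c t s| ≤ B) (h0 : 0 ≤ B) (x : Sp I) (i : I × ℤˣ) :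
    ‖(c (σ.symm i.1) i.2 : ℂ) * coord x (σ.symm i.1, i.2)‖ ^ (2 : ℝ) ≤
      B ^ (2 : ℝ) * ‖coord x (σ.symm i.1, i.2)‖ ^ (2 : ℝ) := by
  rw [← Real.mul_rpow h0 (norm_nonneg _)]
  refine Real.rpow_le_rpow (norm_nonneg _) ?_ (by norm_num)
  rw [norm_mul, Complex.norm_real, Real.norm_eq_abs]
  by_cases h : σ.symm i.1 ∈ I
  · exact mul_le_mul_of_nonneg_right (hB _ h (by simp) _) (norm_nonneg _)
  · rw [coord_of_notMem x (by exact h)]; simp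

/-- The operator `|t⟩ ↦ c(t) |σ t⟩`. -/
def wshift (σ : Equiv.Perm Label) (c : Label → ℤˣ → ℝ) (hc : BddCoef I σ c) :
    Sp I →L[ℂ] Sp I :=
  LinearMap.mkContinuousOfExistsBound
    { toFun := fun x => ⟨fun i => (c (σ.symm i.1) i.2 : ℂ) * coord x (σ.symm i.1, i.2), by
        obtain ⟨B, h0, hB⟩ := hc
        refine memℓp_gen ?_
        simpa using (Summable.of_nonneg_of_le (fun _ => by positivity)
          (norm_wshift_coord_le hB h0 x) ((summable_shift σ x).1.mul_left _))⟩
      map_add' := fun x y => by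
        ext i
        simp only [coord_add, mul_add, lp.coeFn_add, Pi.add_apply]
      map_smul' := fun a x => by
        ext i
        simp only [coord_smul, lp.coeFn_smul, Pi.smul_apply, RingHom.id_apply, smul_eq_mul]
        ring } (by
    obtain ⟨B, h0, hB⟩ := hc
    refine ⟨B, fun x => ?_⟩
    have h2 : 0 < (2 : ENNReal).toReal := by norm_num
    refine lp.norm_le_of_tsum_le h2 (by positivity) ?_
    have e : (2 : ENNReal).toReal = 2 := by norm_num
    change ∑' i : I × ℤˣ, ‖(c (σ.symm i.1) i.2 : ℂ) * coord x (σ.symm i.1, i.2)‖ ^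
      (2 : ENNReal).toReal ≤ (B * ‖x‖) ^ (2 : ENNReal).toReal
    rw [e, Real.mul_rpow h0 (norm_nonneg _)]
    have hs := summable_shift σ x
    refine (Summable.tsum_le_tsum (norm_wshift_coord_le hB h0 x)
      (Summable.of_nonneg_of_le (fun _ => by positivity)
          (norm_wshift_coord_le hB h0 x) (hs.1.mul_left _)) (hs.1.mul_left _)).trans ?_
    rw [tsum_mul_left]
    exact mul_le_mul_of_nonneg_left hs.2 (by positivity))

variable {σ : Equiv.Perm Label} {c : Label → ℤˣ → ℝ}

theorem coord_wshift (hc : BddCoef I σ c) (x : Sp I) {t : Label} (ht : t ∈ I) (s : ℤˣ) :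
    coord (wshift σ c hc x) (t, s) = c (σ.symm t) s * coord x (σ.symm t, s) := by
  conv_lhs => unfold coord
  rw [dif_pos (show (t, s).1 ∈ I from ht)]
  rfl

theorem wshift_vec (hc : BddCoef I σ c) {t : Label} (ht : t ∈ I) (s : ℤˣ) :
    wshift σ c hc (vec I t s) = (c t s : ℂ) • vec I (σ t) s := by
  classical
  refine ext_coord fun t' ht' s' => ?_
  rw [coord_wshift hc _ ht', coord_vec ht, coord_smul]
  by_cases h : σ t = t'
  · subst h
    rw [coord_vec ht']
    by_cases h' : s' = s <;> simp [h']
  · have h1 : ¬ σ.symm t' = t := fun h1 => h (by rw [← h1]; simp)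
    by_cases h2 : σ t ∈ I
    · rw [coord_vec h2]
      simp [h1, Ne.symm h]
    · rw [vec_of_notMem h2]
      simp [h1, coord]

theorem BddCoef.symm (hc : BddCoef I σ c) : BddCoef I σ.symm (fun t => c (σ.symm t)) := by
  obtain ⟨B, h0, hB⟩ := hc
  exact ⟨B, h0, fun t ht ht' s => hB _ ht' (by simpa using ht) s⟩

/-- The reversed arrow carries the same coefficient, read at its new target; no conjugation appears
because the coefficients are real. -/
theorem star_wshift (hc : BddCoef I σ c) :
    star (wshift σ c hc) = wshift σ.symm (fun t => c (σ.symm t)) hc.symm := by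
  refine ContinuousLinearMap.ext fun x => ext_coord fun t ht s => ?_
  rw [coord_wshift _ _ ht, ← inner_vec, ContinuousLinearMap.star_eq_adjoint,
    ContinuousLinearMap.adjoint_inner_right, wshift_vec hc ht, inner_smul_left, inner_vec]
  simp

open Classical in
/-- The operator `|t⟩ ↦ c(t) |σ t⟩` if it is bounded. -/
def W (I : Set Label) (σ : Equiv.Perm Label) (c : Label → ℤˣ → ℝ) : Sp I →L[ℂ] Sp I :=
  if hc : BddCoef I σ c then wshift σ c hc else 0

theorem W_vec (hc : BddCoef I σ c) {t : Label} (ht : t ∈ I) (s : ℤˣ) :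
    W I σ c (vec I t s) = (c t s : ℂ) • vec I (σ t) s := by
  rw [W, dif_pos hc, wshift_vec hc ht]

theorem star_W (hc : BddCoef I σ c) : star (W I σ c) = W I σ.symm (fun t => c (σ.symm t)) := by
  rw [W, W, dif_pos hc, dif_pos hc.symm, star_wshift]

/-- `T` raises the degree `l` by `k`. -/
def IsHomog (k : ℝ) (T : Sp I →L[ℂ] Sp J) : Prop :=
  ∀ x y : Sp I, (∀ i, y i = ((i.1.1.l + 3 / 2 : ℝ) : ℂ) * x i) →
    ∀ i, ((i.1.1.l + 3 / 2 : ℝ) : ℂ) * T x i = (T y + (k : ℂ) • T x) i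

theorem IsHomog.comp {K : Set Label} {k k' : ℝ} {S : Sp J →L[ℂ] Sp K} {T : Sp I →L[ℂ] Sp J}
    (hS : IsHomog k' S) (hT : IsHomog k T) : IsHomog (k' + k) (S ∘L T) := by
  intro x y h i
  have := hS (T x) (T y + (k : ℂ) • T x) (fun i => (hT x y h i).symm) i
  rw [ContinuousLinearMap.comp_apply, this]
  simp only [map_add, map_smul, ContinuousLinearMap.comp_apply, lp.coeFn_add, lp.coeFn_smul,
    Pi.add_apply, Pi.smul_apply, smul_eq_mul, Complex.ofReal_add]
  ring

theorem isHomog_wshift {k : ℝ} (hc : BddCoef I σ c) (hσ : ∀ t, (σ t).l = t.l + k) :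
    IsHomog k (wshift σ c hc) := by
  intro x y h i
  have e : ∀ p : Label × ℤˣ, coord y p = ((p.1.l + 3 / 2 : ℝ) : ℂ) * coord x p := by
    intro p
    unfold coord
    split_ifs with hp
    · rw [h]
    · simp
  have h1 : ∀ z, wshift σ c hc z i = c (σ.symm i.1) i.2 * coord z (σ.symm i.1, i.2) := fun z => by
    rw [← coord_wshift hc z i.1.2, coord_mk]
  have h2 : i.1.1.l = (σ.symm i.1).l + k := by rw [← hσ]; simp
  simp only [lp.coeFn_add, lp.coeFn_smul, Pi.add_apply, Pi.smul_apply, smul_eq_mul, h1, e, h2]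
  push_cast
  ring

/-- Translations of labels. -/
def translate (a b c d : ℝ) : Equiv.Perm Label where
  toFun t := ⟨t.l + a, t.m₁ + b, t.m₂ + c, t.j + d⟩
  invFun t := ⟨t.l - a, t.m₁ - b, t.m₂ - c, t.j - d⟩
  left_inv t := by simp
  right_inv t := by simp

/-- No boundedness is needed: in the unbounded case `W` is 0, which is homogeneous of every degree.
-/
theorem isHomog_W (a b c' d : ℝ) (c : Label → ℤˣ → ℝ) :
    IsHomog a (W I (translate a b c' d) c) := by
  unfold W
  split_ifs with hc
  · exact isHomog_wshift hc fun _ => rfl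
  · intro x y _ i
    simp

end LabelSpace

/-! ### Labels in integer coordinates, and the coefficients in these coordinates -/

namespace Reduced

open LabelSpace

def sgn (e : Bool) : ℝ := if e then 1 / 2 else -(1 / 2)

@[simp] theorem sgn_true : sgn true = 1 / 2 := rfl
@[simp] theorem sgn_false : sgn false = -(1 / 2) := rfl

/-- The label with `l = h + 1/2`, `j = i + 1/2`, `j + m₁ = u`, `ε = ± 1/2` and
`l + 1/2 - j + m₂ = 2 N + ε + 1/2`. -/
def lab (i u h N : ℤ) (e : Bool) : Label :=
  ⟨h + 1 / 2, u - i - 1 / 2, 2 * N + i - h + sgn e, i + 1 / 2⟩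

/-- The bound on |m₂| reads -1/2 - ε ≤ 2N and 2N ≤ 2(h - i) + 1/2 - ε. As ε = ±1/2 only moves the
bounds by less than the spacing 2, both signs give the same range of N. The conditions on l and on j
≤ l are then automatic. -/
theorem lab_mem {i u h N : ℤ} {e : Bool} :
    lab i u h N e ∈ spinorLabels ↔ (0 ≤ u ∧ u ≤ 2 * i + 1) ∧ 0 ≤ N ∧ i + N ≤ h := by
  constructor
  · rintro ⟨-, ⟨b, hb⟩, -, ⟨c, hc⟩, ⟨d, hd⟩⟩
    simp only [lab] at hb hc hd
    have hc' : (0 : ℝ) ≤ c := c.cast_nonneg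
    have hd' : (0 : ℝ) ≤ d := d.cast_nonneg
    have h1 := abs_le.1 (show |(u : ℝ) - i - 1 / 2| ≤ i + 1 / 2 by linarith)
    have h2 := abs_le.1 (show |2 * (N : ℝ) + i - h + sgn e| ≤ h + 1 / 2 + 1 / 2 - (i + 1 / 2) by
      linarith)
    have a1 : (0 : ℝ) ≤ u := by linarith
    have a2 : (u : ℝ) ≤ 2 * i + 1 := by linarith
    have a3 : (0 : ℝ) < 2 * N + 2 := by cases e <;> simp at h2 <;> linarith
    have a4 : (2 * i + 2 * N : ℝ) < 2 * h + 2 := by cases e <;> simp at h2 <;> linarith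
    norm_cast at a1 a2 a3 a4
    omega
  · rintro ⟨⟨h1, h2⟩, h3, h4⟩
    lift N to ℕ using h3
    obtain ⟨k, rfl⟩ : ∃ k : ℕ, h = i + N + k := ⟨(h - i - N).toNat, by omega⟩
    obtain ⟨v, hv⟩ : ∃ v : ℕ, (v : ℤ) = 2 * i + 1 - u := ⟨(2 * i + 1 - u).toNat, by omega⟩
    lift i to ℕ using by omega
    lift u to ℕ using h1
    have hv' : (v : ℝ) = 2 * i + 1 - u := by exact_mod_cast hv
    have p1 : (0 : ℝ) ≤ N := N.cast_nonneg
    have p2 : (0 : ℝ) ≤ k := k.cast_nonneg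
    simp only [lab, spinorLabels, Set.mem_ofPred_eq]
    refine ⟨⟨i + N + k, by push_cast; ring⟩, ⟨i, by push_cast; ring⟩, by push_cast; linarith,
      ?_, ?_⟩
    · rcases abs_cases ((u : ℝ) - i - 1 / 2) with ⟨h, -⟩ | ⟨h, -⟩
      · exact ⟨v, by push_cast; rw [h, hv']; ring⟩
      · exact ⟨u, by push_cast; rw [h]; ring⟩
    · push_cast
      rcases abs_cases (2 * (N : ℝ) + i - (i + N + k) + sgn e) with ⟨h, -⟩ | ⟨h, -⟩ <;> rw [h] <;>
        cases e
      · exact ⟨2 * k + 1, by push_cast; simp; ring⟩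
      · exact ⟨2 * k, by push_cast; simp; ring⟩
      · exact ⟨2 * N, by push_cast; simp; ring⟩
      · exact ⟨2 * N + 1, by push_cast; simp; ring⟩

theorem exists_lab {t : Label} (ht : t ∈ spinorLabels) : ∃ i u h N e, t = lab i u h N e := by
  obtain ⟨⟨a, ha⟩, ⟨b, hb⟩, -, ⟨c, hc⟩, ⟨d, hd⟩⟩ := ht
  rcases t with ⟨l, m₁, m₂, j⟩
  dsimp only at *
  obtain ⟨u, hu⟩ : ∃ u : ℤ, m₁ = u - b - 1 / 2 := by
    rcases abs_cases m₁ with ⟨h, -⟩ | ⟨h, -⟩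
    · exact ⟨2 * b + 1 - c, by push_cast; linarith⟩
    · exact ⟨c, by push_cast; linarith⟩
  obtain ⟨n, hn⟩ : ∃ n : ℤ, m₂ = n + b - a - 1 / 2 := by
    rcases abs_cases m₂ with ⟨h, -⟩ | ⟨h, -⟩
    · exact ⟨2 * (a - b) + 1 - d, by push_cast; linarith⟩
    · exact ⟨d, by push_cast; linarith⟩
  rcases Int.even_or_odd' n with ⟨N, rfl | rfl⟩
  · refine ⟨b, u, a, N, false, ?_⟩
    ext <;> simp [lab, *]; ring
  · refine ⟨b, u, a, N, true, ?_⟩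
    ext <;> simp [lab, *]; ring

theorem eps_lab {l j m₂ : ℝ} (e : Bool) (k : ℤ) (h : l + 1 / 2 - j - m₂ = 2 * k + 1 / 2 - sgn e) :
    eps l j m₂ = sgn e := by
  unfold eps
  cases e
  · rw [if_neg, sgn_false]
    rintro ⟨k', hk⟩
    rw [h, sgn_false] at hk
    have : (2 * k + 1 : ℝ) = 2 * k' := by linarith
    norm_cast at this
    omega
  · rw [if_pos, sgn_true]
    exact ⟨k, by rw [h, sgn_true]; ring⟩

/-! ### q-numbers rewritten through 1 - q^{2n} -/

variable {q : ℝ}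

/-- `√(1 - q^{2n})`. -/
def sq (q : ℝ) (n : ℤ) : ℝ := √(qb q n)

theorem qb_nonneg (hq₀ : 0 < q) (hq₁ : q < 1) {n : ℤ} (hn : 0 ≤ n) : 0 ≤ qb q n := by
  unfold qb
  have := zpow_le_one₀ hq₀ hq₁.le (show 0 ≤ 2 * n by omega)
  linarith

theorem qb_pos (hq₀ : 0 < q) (hq₁ : q < 1) {n : ℤ} (hn : 0 < n) : 0 < qb q n := by
  unfold qb
  have := zpow_lt_one₀ hq₀ hq₁ (show 0 < 2 * n by omega)
  linarith

theorem sq_pos (hq₀ : 0 < q) (hq₁ : q < 1) {n : ℤ} (hn : 0 < n) : 0 < sq q n :=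
  Real.sqrt_pos.2 (qb_pos hq₀ hq₁ hn)

theorem sq_sq (hq₀ : 0 < q) (hq₁ : q < 1) {n : ℤ} (hn : 0 ≤ n) : sq q n * sq q n = qb q n :=
  Real.mul_self_sqrt (qb_nonneg hq₀ hq₁ hn)

theorem qb_zero : qb q 0 = 0 := by simp [qb]

theorem qnum_eq (hq₀ : 0 < q) {a : ℝ} {a' : ℤ} (ha : a = a') :
    qnum q a = q ^ (-a) * qb q a' / (q⁻¹ - q) := by
  subst ha
  have h1 : (q : ℝ) ^ (2 * a') = q ^ (a' : ℝ) * q ^ (a' : ℝ) := by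
    rw [← Real.rpow_add hq₀, ← Real.rpow_intCast]; congr 1; push_cast; ring
  have h2 : (q : ℝ) ^ (-(a' : ℝ)) * q ^ (a' : ℝ) = 1 := by
    rw [← Real.rpow_add hq₀]; simp
  rw [qnum, ← neg_div_neg_eq, qb, h1, mul_sub, ← mul_assoc, h2]
  ring

theorem sqrt_qnum_mul (hq₀ : 0 < q) (hq₁ : q < 1) {a c : ℝ} {a' c' : ℤ} (ha : a = a')
    (hc : c = c') (h : 0 ≤ a') :
    √(qnum q a * qnum q c) = q ^ (-((a + c) / 2)) * (sq q a' * sq q c') / (q⁻¹ - q) := by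
  have h0 : 0 < q⁻¹ - q := by
    have := one_lt_inv_iff₀.2 ⟨hq₀, hq₁⟩
    linarith
  have h2 : qnum q a * qnum q c =
      (q ^ (-((a + c) / 2)) / (q⁻¹ - q)) ^ 2 * (qb q a' * qb q c') := by
    rw [qnum_eq hq₀ ha, qnum_eq hq₀ hc, div_pow, pow_two (q ^ (-((a + c) / 2))),
      ← Real.rpow_add hq₀, show -((a + c) / 2) + -((a + c) / 2) = -a + -c by ring,
      Real.rpow_add hq₀]
    generalize q⁻¹ - q = c₀
    ring
  rw [h2, Real.sqrt_mul (by positivity), Real.sqrt_sq (by positivity),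
    Real.sqrt_mul (qb_nonneg hq₀ hq₁ h)]
  unfold sq
  generalize q⁻¹ - q = c₀
  ring

/-- From [a] = q^{-a}(1 - q^{2a})/(q⁻¹ - q): the root in the numerator and the denominator each
contribute one factor 1/(q⁻¹ - q), which cancel, and the powers of q collect to x + d - (a + c)/2. A
sign is needed for the first radicand only, to split the square root. -/
theorem coef_single (hq₀ : 0 < q) (hq₁ : q < 1) {x a c d : ℝ} (n a' c' d' : ℤ) (ha : a = a')
    (hc : c = c') (hd : d = d') (hn : x + d - (a + c) / 2 = n) (h : 0 ≤ a') :
    q ^ x * (√(qnum q a * qnum q c) / qnum q d) =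
      q ^ n * (sq q a' * sq q c') / qb q d' := by
  have h0 : 0 < q⁻¹ - q := by
    have := one_lt_inv_iff₀.2 ⟨hq₀, hq₁⟩
    linarith
  have h3 : (q : ℝ) ^ n = q ^ x * q ^ (-((a + c) / 2)) / q ^ (-d) := by
    rw [← Real.rpow_add hq₀, ← Real.rpow_sub hq₀, ← Real.rpow_intCast, ← hn]
    congr 1; ring
  have h4 : (q : ℝ) ^ (-d) ≠ 0 := (Real.rpow_pos_of_pos hq₀ _).ne'
  rw [sqrt_qnum_mul hq₀ hq₁ ha hc h, qnum_eq hq₀ hd, h3]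
  -- A vanishing denominator makes both sides 0 by the convention on division.
  by_cases h5 : qb q d' = 0
  · simp [h5]
  · generalize q⁻¹ - q = c₀ at *
    have := h0.ne'
    field_simp

theorem qnum_two_mul (hq₀ : 0 < q) (hq₁ : q < 1) :
    qnum q 2 * (q⁻¹ - q) = q ^ (-2 : ℝ) * qb q 2 := by
  have h0 : 0 < q⁻¹ - q := by
    have := one_lt_inv_iff₀.2 ⟨hq₀, hq₁⟩
    linarith
  rw [qnum_eq hq₀ (a' := 2) (by norm_num)]
  generalize q⁻¹ - q = c₀ at *
  field_simp

/-- With two q-numbers below the root, the factor [2] = q^{-2}(1 - q⁴)/(q⁻¹ - q) restores the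
balance of powers of q⁻¹ - q; its q^{-2} is the -2 in the exponent. -/
theorem coef_double (hq₀ : 0 < q) (hq₁ : q < 1) {x a c d₁ d₂ : ℝ} (n a' c' d₁' d₂' : ℤ)
    (ha : a = a') (hc : c = c') (hd₁ : d₁ = d₁') (hd₂ : d₂ = d₂')
    (hn : x + d₁ + d₂ - (a + c) / 2 - 2 = n) (h : 0 ≤ a') :
    qnum q 2 * q ^ x * (√(qnum q a * qnum q c) / (qnum q d₁ * qnum q d₂)) =
      qb q 2 * q ^ n * (sq q a' * sq q c') / (qb q d₁' * qb q d₂') := by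
  have h0 : 0 < q⁻¹ - q := by
    have := one_lt_inv_iff₀.2 ⟨hq₀, hq₁⟩
    linarith
  have h3 : (q : ℝ) ^ n =
      q ^ x * q ^ (-((a + c) / 2)) * q ^ (-2 : ℝ) / (q ^ (-d₁) * q ^ (-d₂)) := by
    rw [← Real.rpow_add hq₀, ← Real.rpow_add hq₀, ← Real.rpow_add hq₀, ← Real.rpow_sub hq₀,
      ← Real.rpow_intCast, ← hn]
    congr 1; ring
  have h4 : (q : ℝ) ^ (-d₁) ≠ 0 := (Real.rpow_pos_of_pos hq₀ _).ne'
  have h4' : (q : ℝ) ^ (-d₂) ≠ 0 := (Real.rpow_pos_of_pos hq₀ _).ne'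
  have h7 := qnum_two_mul hq₀ hq₁
  rw [sqrt_qnum_mul hq₀ hq₁ ha hc h, qnum_eq hq₀ hd₁, qnum_eq hq₀ hd₂, h3]
  by_cases h5 : qb q d₁' = 0
  · simp [h5]
  by_cases h6 : qb q d₂' = 0
  · simp [h6]
  generalize q⁻¹ - q = c₀ at *
  have := h0.ne'
  generalize (q : ℝ) ^ (-2 : ℝ) = z at *
  field_simp
  linear_combination (sq q a' * sq q c') * h7

theorem coef_quotient (hq₀ : 0 < q) (hq₁ : q < 1) {a b c d e f : ℝ} (n m a' b' c' d' e' f' : ℤ)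
    (ha : a = a') (hb : b = b') (hc : c = c') (hd : d = d') (he : e = e') (hf : f = f')
    (hn : n = e' + f' - a' - b') (hm : m = e' + f' - c' - d' - 2) :
    (qnum q a * qnum q b - q ^ (-2 : ℝ) * (qnum q c * qnum q d)) / (qnum q e * qnum q f) =
      (q ^ n * qb q a' * qb q b' - q ^ m * qb q c' * qb q d') / (qb q e' * qb q f') := by
  have h0 : 0 < q⁻¹ - q := by
    have := one_lt_inv_iff₀.2 ⟨hq₀, hq₁⟩
    linarith
  have hq := hq₀.ne'
  have h2 : (q : ℝ) ^ (-2 : ℝ) = (q ^ 2)⁻¹ := by rw [Real.rpow_neg hq₀.le]; norm_cast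
  rw [qnum_eq hq₀ ha, qnum_eq hq₀ hb, qnum_eq hq₀ hc, qnum_eq hq₀ hd, qnum_eq hq₀ he,
    qnum_eq hq₀ hf, ha, hb, hc, hd, he, hf, hn, hm, h2]
  simp only [Real.rpow_neg hq₀.le, Real.rpow_intCast, zpow_sub₀ hq, zpow_add₀ hq, zpow_ofNat]
  by_cases h5 : qb q e' = 0
  · simp [h5]
  by_cases h6 : qb q f' = 0
  · simp [h6]
  have n1 := zpow_ne_zero a' hq
  have n2 := zpow_ne_zero b' hq
  have n3 := zpow_ne_zero c' hq
  have n4 := zpow_ne_zero d' hq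
  have n5 := zpow_ne_zero e' hq
  have n6 := zpow_ne_zero f' hq
  generalize q⁻¹ - q = c₀ at *
  have := h0.ne'
  generalize q ^ a' = x1 at *
  generalize q ^ b' = x2 at *
  generalize q ^ c' = x3 at *
  generalize q ^ d' = x4 at *
  generalize q ^ e' = x5 at *
  generalize q ^ f' = x6 at *
  field_simp

theorem qnum_neg (z : ℝ) : qnum q (-z) = -qnum q z := by
  unfold qnum; rw [neg_neg]; ring

/-! ### Weights that remove the square roots -/

/-- Weights `∏ 1 / √(1 - q^{2k})` over `0 < k ≤ n`. -/
def wt₁ (q : ℝ) : ℕ → ℝ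
  | 0 => 1
  | n + 1 => wt₁ q n / sq q (n + 1)

/-- Weights `∏ 1 / √(1 - q^{2k})` over `0 < k ≤ n` of the parity of `n`. -/
def wt₂ (q : ℝ) : ℕ → ℝ
  | 0 => 1
  | 1 => 1
  | n + 2 => wt₂ q n / sq q (n + 2)

theorem wt₁_pos (hq₀ : 0 < q) (hq₁ : q < 1) : ∀ n, 0 < wt₁ q n
  | 0 => one_pos
  | n + 1 => div_pos (wt₁_pos hq₀ hq₁ n) (sq_pos hq₀ hq₁ (by omega))

theorem wt₂_pos (hq₀ : 0 < q) (hq₁ : q < 1) : ∀ n, 0 < wt₂ q n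
  | 0 => one_pos
  | 1 => one_pos
  | n + 2 => div_pos (wt₂_pos hq₀ hq₁ n) (sq_pos hq₀ hq₁ (by omega))

/-- The matrix element of a step of length `2 δ` in a coordinate `z` with weights `wt₂`. -/
def stp (q : ℝ) (z δ : ℤ) : ℝ :=
  if δ = 1 then sq q (z + 2) else if δ = -1 then sq q z else 1

/-- The matrix element of a step between weighted vectors. -/
def stpW (q : ℝ) (z δ : ℤ) : ℝ := if δ = 1 then qb q (z + 2) else 1

/-- The matrix element of a step of length `δ` in a coordinate `z` with weights `wt₁`. -/
def hop (q : ℝ) (z δ : ℤ) : ℝ :=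
  if δ = 2 then sq q (z + 1) * sq q (z + 2) else if δ = 1 then sq q (z + 1) else
    if δ = -1 then sq q z else if δ = -2 then sq q z * sq q (z - 1) else 1

/-- The matrix element of a step between weighted vectors. -/
def hopW (q : ℝ) (z δ : ℤ) : ℝ :=
  if δ = 2 then qb q (z + 1) * qb q (z + 2) else if δ = 1 then qb q (z + 1) else 1

theorem wt₂_succ (hq₀ : 0 < q) (hq₁ : q < 1) {z z' a : ℤ} (hz : 0 ≤ z) (h : z' = z + 2)
    (ha : a = z + 2) : wt₂ q z.toNat = wt₂ q z'.toNat * sq q a := by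
  subst h ha
  lift z to ℕ using hz
  have h1 := (sq_pos hq₀ hq₁ (show (0 : ℤ) < z + 2 by omega)).ne'
  rw [show ((z : ℤ) + 2).toNat = z + 2 by omega, wt₂, Int.toNat_natCast]
  field_simp

theorem wt₁_succ (hq₀ : 0 < q) (hq₁ : q < 1) {z z' a : ℤ} (hz : 0 ≤ z) (h : z' = z + 1)
    (ha : a = z + 1) : wt₁ q z.toNat = wt₁ q z'.toNat * sq q a := by
  subst h ha
  lift z to ℕ using hz
  have h1 := (sq_pos hq₀ hq₁ (show (0 : ℤ) < z + 1 by omega)).ne'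
  rw [show ((z : ℤ) + 1).toNat = z + 1 by omega, wt₁, Int.toNat_natCast]
  field_simp

/-- Moving the weight to the other end of the arrow squares the root of a raising step into 1 -
q^{2(z+2)} and cancels the root of a lowering step. The matrix loses its symmetry but becomes
rational. -/
theorem wt₂_mul_stp (hq₀ : 0 < q) (hq₁ : q < 1) {z z' δ : ℤ} (hz : 0 ≤ z) (hz' : 0 ≤ z')
    (h : z' = z + 2 * δ) (hδ : δ = 1 ∨ δ = 0 ∨ δ = -1) :
    wt₂ q z.toNat * stp q z δ = stpW q z δ * wt₂ q z'.toNat := by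
  rcases hδ with rfl | rfl | rfl
  · rw [wt₂_succ hq₀ hq₁ hz h rfl]
    simp only [stp, stpW, if_true]
    rw [mul_assoc, sq_sq hq₀ hq₁ (by omega), mul_comm]
  · simp [stp, stpW, h]
  · rw [wt₂_succ hq₀ hq₁ hz' (a := z) (z' := z) (by omega) (by omega)]
    norm_num [stp, stpW]

/-- The same mechanism for unit steps. Steps of length 2 occur because x₁ can change j and m₁
together. -/
theorem wt₁_mul_hop (hq₀ : 0 < q) (hq₁ : q < 1) {z z' δ : ℤ} (hz : 0 ≤ z) (hz' : 0 ≤ z')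
    (h : z' = z + δ) (hδ : -2 ≤ δ ∧ δ ≤ 2) :
    wt₁ q z.toNat * hop q z δ = hopW q z δ * wt₁ q z'.toNat := by
  obtain ⟨h1, h2⟩ := hδ
  interval_cases δ
  · rw [wt₁_succ hq₀ hq₁ hz' (a := z - 1) (z' := z - 1) (by omega) (by omega),
      wt₁_succ hq₀ hq₁ (z := z - 1) (a := z) (z' := z) (by omega) (by omega) (by omega)]
    norm_num [hop, hopW]
    ring
  · rw [wt₁_succ hq₀ hq₁ hz' (a := z) (z' := z) (by omega) (by omega)]
    norm_num [hop, hopW]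
  · simp [hop, hopW, h]
  · rw [wt₁_succ hq₀ hq₁ hz h rfl]
    norm_num [hop, hopW]
    rw [mul_assoc, sq_sq hq₀ hq₁ (by omega), mul_comm]
  · rw [wt₁_succ hq₀ hq₁ hz rfl rfl, wt₁_succ hq₀ hq₁ (z := z + 1) (z' := z') (a := z + 2)
      (by omega) (by omega) (by omega)]
    norm_num [hop, hopW]
    rw [← sq_sq hq₀ hq₁ (n := z + 1) (by omega), ← sq_sq hq₀ hq₁ (n := z + 2) (by omega)]
    ring

/-! ### Arrows and their coefficients in integer coordinates -/

/-- The steps `+1, 0, -1`. -/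
def dlt : Fin 3 → ℤ := ![1, 0, -1]

/-- The steps in `j` of the five families of arrows: the parts of `x_0` and `x_1` which raise,
preserve and lower `j`, the operator `x_2`, and its adjoint. -/
def stepJ : Fin 5 → ℤ := ![1, 0, -1, 0, 0]

/-- The steps in `m₂` of the five families of arrows. -/
def stepM : Fin 5 → ℤ := ![0, 0, 0, 1, -1]

/-- The matrix elements of the five families, for `l ↦ l + dlt d`. -/
def red (q : ℝ) (f : Fin 5) (d : Fin 3) (l j m₂ σ : ℝ) : ℝ :=
  match f, d with
  | 0, 0 => coefCp q l j m₂
  | 0, 1 => -σ * coefC0 q l j m₂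
  | 0, 2 => coefCm q l j m₂
  | 1, 0 => coefHp q l j m₂
  | 1, 1 => σ * coefH0 q l j m₂
  | 1, 2 => coefHp q (l - 1) j m₂
  | 2, 0 => coefCm q (l + 1) (j - 1) m₂
  | 2, 1 => -σ * coefC0 q l (j - 1) m₂
  | 2, 2 => coefCp q (l - 1) (j - 1) m₂
  | 3, 0 => coefDp q l j m₂
  | 3, 1 => σ * coefD0 q l j m₂
  | 3, 2 => coefDm q l j m₂
  | 4, 0 => coefDm q (l + 1) j (m₂ - 1)
  | 4, 1 => σ * coefD0 q l j (m₂ - 1)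
  | 4, 2 => coefDp q (l - 1) j (m₂ - 1)

/-- `1` for `ε = 1/2` and `0` for `ε = -1/2`. -/
def bi (e : Bool) : ℤ := if e then 1 else 0

@[simp] theorem bi_true : bi true = 1 := rfl
@[simp] theorem bi_false : bi false = 0 := rfl

theorem sgn_eq (e : Bool) : sgn e = bi e - 1 / 2 := by cases e <;> norm_num

/-- The sign of `ε` at the end of an arrow. -/
def newE (f : Fin 5) (d : Fin 3) (e : Bool) : Bool :=
  if (stepM f - stepJ f + dlt d) % 2 = 0 then e else !e

/-- The step in `N` of an arrow. -/
def stepN (f : Fin 5) (d : Fin 3) (e : Bool) : ℤ :=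
  (stepM f - stepJ f + dlt d + bi e - bi (newE f d e)) / 2

/-- Since m₂ - j + l equals 2N + ε up to a constant, the parity of its change decides whether ε
flips, and what remains is twice the change of N. -/
theorem two_mul_stepN (f : Fin 5) (d : Fin 3) (e : Bool) :
    2 * stepN f d e = stepM f - stepJ f + dlt d + bi e - bi (newE f d e) := by
  revert f d e; decide

theorem translate_lab (f : Fin 5) (d : Fin 3) (b i u h N : ℤ) (e : Bool) :
    LabelSpace.translate (dlt d) b (stepM f) (stepJ f) (lab i u h N e) =
      lab (i + stepJ f) (u + stepJ f + b) (h + dlt d) (N + stepN f d e) (newE f d e) := by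
  have h2 : (2 * stepN f d e : ℝ) = stepM f - stepJ f + dlt d + bi e - bi (newE f d e) := by
    exact_mod_cast two_mul_stepN f d e
  simp only [LabelSpace.translate, lab, Equiv.coe_fn_mk, sgn_eq]
  ext <;> push_cast <;> linarith

variable {q : ℝ}

section Coefficients

variable {l j m₂ : ℝ} {i h N : ℤ} {e : Bool}

theorem coefCp_eq (hq₀ : 0 < q) (hq₁ : q < 1) (hl : l = h + 1 / 2) (hj : j = i + 1 / 2)
    (hm : m₂ = 2 * N + i - h + sgn e) (hP : 0 ≤ 2 * (i + N) + 3 + 2 * bi e) :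
    coefCp q l j m₂ = -(q ^ (2 * N) / qb q (2 * (h + 2) + 1)) *
      (sq q (2 * (i + N) + 3 + 2 * bi e) * sq q (2 * (h - N) + 5 - 2 * bi e)) := by
  have he := sgn_eq e
  simp only [coefCp]
  rw [eps_lab e (h - i - N + bi e - bi e) (by push_cast; linarith),
    coef_single hq₀ hq₁ (2 * N) (2 * (i + N) + 3 + 2 * bi e) (2 * (h - N) + 5 - 2 * bi e)
      (2 * (h + 2) + 1) (by push_cast; linarith) (by push_cast; linarith)
      (by push_cast; linarith) (by push_cast; linarith) hP]
  ring

theorem coefCm_eq (hq₀ : 0 < q) (hq₁ : q < 1) (hl : l = h + 1 / 2) (hj : j = i + 1 / 2)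
    (hm : m₂ = 2 * N + i - h + sgn e) (hN : 0 ≤ N) :
    coefCm q l j m₂ = -(q ^ (2 * (i + N) + 1 + 2 * bi e) / qb q (2 * (h + 1) + 1)) *
      (sq q (2 * N) * sq q (2 * (h - i - N))) := by
  have he := sgn_eq e
  simp only [coefCm]
  rw [eps_lab e (h - i - N) (by push_cast; linarith),
    coef_single hq₀ hq₁ (2 * (i + N) + 1 + 2 * bi e) (2 * N) (2 * (h - i - N))
      (2 * (h + 1) + 1) (by push_cast; linarith) (by push_cast; linarith)
      (by push_cast; linarith) (by push_cast; linarith) (by omega)]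
  ring

theorem coefDp_eq (hq₀ : 0 < q) (hq₁ : q < 1) (hl : l = h + 1 / 2) (hj : j = i + 1 / 2)
    (hm : m₂ = 2 * N + i - h + sgn e) (hP : 0 ≤ 2 * (i + N) + 3 + 2 * bi e) :
    coefDp q l j m₂ = 1 / qb q (2 * (h + 2) + 1) *
      (sq q (2 * (i + N) + 3 + 2 * bi e) * sq q (2 * N + 2)) := by
  have he := sgn_eq e
  simp only [coefDp]
  rw [eps_lab e (h - i - N) (by push_cast; linarith),
    coef_single hq₀ hq₁ 0 (2 * (i + N) + 3 + 2 * bi e) (2 * N + 2)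
      (2 * (h + 2) + 1) (by push_cast; linarith) (by push_cast; linarith)
      (by push_cast; linarith) (by push_cast; linarith) hP, zpow_zero]
  ring

theorem coefDm_eq (hq₀ : 0 < q) (hq₁ : q < 1) (hl : l = h + 1 / 2) (hj : j = i + 1 / 2)
    (hm : m₂ = 2 * N + i - h + sgn e) (hK : 0 ≤ h - i - N) :
    coefDm q l j m₂ = -(q ^ (2 * (i + 2 * N) + 3 + 2 * bi e) / qb q (2 * (h + 1) + 1)) *
      (sq q (2 * (h - i - N)) * sq q (2 * (h - N) + 3 - 2 * bi e)) := by
  have he := sgn_eq e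
  simp only [coefDm]
  rw [eps_lab e (h - i - N) (by push_cast; linarith),
    coef_single hq₀ hq₁ (2 * (i + 2 * N) + 3 + 2 * bi e) (2 * (h - i - N))
      (2 * (h - N) + 3 - 2 * bi e) (2 * (h + 1) + 1) (by push_cast; linarith)
      (by push_cast; linarith) (by push_cast; linarith) (by push_cast; linarith) (by omega)]
  ring

theorem coefC0_eq (hq₀ : 0 < q) (hq₁ : q < 1) (hl : l = h + 1 / 2) (hj : j = i + 1 / 2)
    (hm : m₂ = 2 * N + i - h + sgn e) (hi : 0 ≤ i) (hN : 0 ≤ N) (hh : i + N ≤ h) :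
    coefC0 q l j m₂ = qb q 2 / (qb q (2 * (h + 1) + 1) * qb q (2 * (h + 2) + 1)) *
      if e then q ^ (2 * (h + i + 2 * N) + 6) * (sq q (2 * (h - N) + 3) * sq q (2 * (h - i - N)))
      else -(q ^ (2 * h + 1) * (sq q (2 * (i + N) + 3) * sq q (2 * N))) := by
  simp only [coefC0]
  rw [eps_lab e (h - i - N) (by push_cast; linarith)]
  cases e
  · rw [sgn_false] at *
    rw [show (4 : ℝ) * -(1 / 2) = -2 by norm_num, qnum_neg, neg_mul, neg_mul,
      coef_double hq₀ hq₁ (2 * h + 1) (2 * (i + N) + 3) (2 * N) (2 * (h + 1) + 1)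
      (2 * (h + 2) + 1) (by push_cast; linarith) (by push_cast; linarith)
      (by push_cast; linarith) (by push_cast; linarith) (by push_cast; linarith) (by omega)]
    simp only [Bool.false_eq_true, if_false]
    ring
  · rw [sgn_true] at *
    rw [show (4 : ℝ) * (1 / 2) = 2 by norm_num,
      coef_double hq₀ hq₁ (2 * (h + i + 2 * N) + 6) (2 * (h - N) + 3) (2 * (h - i - N))
      (2 * (h + 1) + 1)
      (2 * (h + 2) + 1) (by push_cast; linarith) (by push_cast; linarith)
      (by push_cast; linarith) (by push_cast; linarith) (by push_cast; linarith) (by omega)]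
    simp only [if_true]
    ring

theorem coefHp_eq (hq₀ : 0 < q) (hq₁ : q < 1) (hl : l = h + 1 / 2) (hj : j = i + 1 / 2)
    (hm : m₂ = 2 * N + i - h + sgn e) (hi : 0 ≤ i) (hN : 0 ≤ 2 * (N + bi e))
    (hh : i + N ≤ h + 1 - bi e) :
    coefHp q l j m₂ = 1 / qb q (2 * (h + 2) + 1) *
      if e then q ^ (2 * (i + N) + 3) * (sq q (2 * (h - N) + 3) * sq q (2 * N + 2))
      else q ^ (2 * N) * (sq q (2 * (h - i - N) + 2) * sq q (2 * (i + N) + 3)) := by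
  simp only [coefHp]
  rw [eps_lab e (h - i - N) (by push_cast; linarith)]
  cases e
  · simp only [sgn_false, bi_false] at *
    rw [coef_single hq₀ hq₁ (2 * N) (2 * (h - i - N) + 2) (2 * (i + N) + 3) (2 * (h + 2) + 1)
      (by push_cast; linarith) (by push_cast; linarith)
      (by push_cast; linarith) (by push_cast; linarith) (by omega)]
    simp only [Bool.false_eq_true, if_false]
    ring
  · simp only [sgn_true, bi_true] at *
    rw [coef_single hq₀ hq₁ (2 * (i + N) + 3) (2 * (h - N) + 3) (2 * N + 2) (2 * (h + 2) + 1)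
      (by push_cast; linarith) (by push_cast; linarith)
      (by push_cast; linarith) (by push_cast; linarith) (by omega)]
    simp only [if_true]
    ring

theorem coefD0_eq (hq₀ : 0 < q) (hq₁ : q < 1) (hl : l = h + 1 / 2) (hj : j = i + 1 / 2)
    (hm : m₂ = 2 * N + i - h + sgn e) (hi : 0 ≤ i) (hh : i + N ≤ h) :
    coefD0 q l j m₂ = qb q 2 / (qb q (2 * (h + 1) + 1) * qb q (2 * (h + 2) + 1)) *
      if e then q ^ (2 * (h + i + N) + 6) * (sq q (2 * (h - i - N)) * sq q (2 * N + 2))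
      else q ^ (2 * (h + N) + 3) * (sq q (2 * (h - N) + 3) * sq q (2 * (i + N) + 3)) := by
  simp only [coefD0]
  rw [eps_lab e (h - i - N) (by push_cast; linarith)]
  cases e
  · rw [sgn_false] at *
    rw [coef_double hq₀ hq₁ (2 * (h + N) + 3) (2 * (h - N) + 3) (2 * (i + N) + 3)
      (2 * (h + 1) + 1)
      (2 * (h + 2) + 1) (by push_cast; linarith) (by push_cast; linarith)
      (by push_cast; linarith) (by push_cast; linarith) (by push_cast; linarith) (by omega)]
    simp only [Bool.false_eq_true, if_false]
    ring
  · rw [sgn_true] at *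
    rw [coef_double hq₀ hq₁ (2 * (h + i + N) + 6) (2 * (h - i - N)) (2 * N + 2) (2 * (h + 1) + 1)
      (2 * (h + 2) + 1) (by push_cast; linarith) (by push_cast; linarith)
      (by push_cast; linarith) (by push_cast; linarith) (by push_cast; linarith) (by omega)]
    simp only [if_true]
    ring

theorem coefH0_eq (hq₀ : 0 < q) (hq₁ : q < 1) (hl : l = h + 1 / 2) (hj : j = i + 1 / 2)
    (hm : m₂ = 2 * N + i - h + sgn e) :
    coefH0 q l j m₂ = (if e then q ^ (2 * (h + i) + 6) * qb q (2 * (h - i - N)) * qb q (2 * N + 2) -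
        q ^ (2 * (h - i)) * qb q (2 * (h - N) + 3) * qb q (2 * (i + N) + 3)
      else q ^ (2 * (h - i) + 2) * qb q (2 * (h - N) + 3) * qb q (2 * (i + N) + 3) -
        q ^ (2 * (h + i) + 4) * qb q (2 * (h - i - N) + 2) * qb q (2 * N)) /
        (qb q (2 * (h + 1) + 1) * qb q (2 * (h + 2) + 1)) := by
  simp only [coefH0]
  rw [eps_lab e (h - i - N) (by push_cast; linarith)]
  cases e
  · rw [sgn_false] at *
    rw [coef_quotient hq₀ hq₁ (2 * (h - i) + 2) (2 * (h + i) + 4) (2 * (h - N) + 3)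
      (2 * (i + N) + 3) (2 * (h - i - N) + 2) (2 * N) (2 * (h + 1) + 1) (2 * (h + 2) + 1)
      (by push_cast; linarith) (by push_cast; linarith) (by push_cast; linarith)
      (by push_cast; linarith) (by push_cast; linarith) (by push_cast; linarith) (by omega)
      (by omega)]
    simp only [Bool.false_eq_true, if_false]
  · rw [sgn_true] at *
    rw [coef_quotient hq₀ hq₁ (2 * (h + i) + 6) (2 * (h - i)) (2 * (h - i - N)) (2 * N + 2)
      (2 * (h - N) + 3) (2 * (i + N) + 3) (2 * (h + 1) + 1) (2 * (h + 2) + 1)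
      (by push_cast; linarith) (by push_cast; linarith) (by push_cast; linarith)
      (by push_cast; linarith) (by push_cast; linarith) (by push_cast; linarith) (by omega)
      (by omega)]
    simp only [if_true]

end Coefficients

/-- The part of the matrix element of an arrow which does not depend on the weights. -/
def arr (q σ : ℝ) (f : Fin 5) (d : Fin 3) (i h N : ℤ) (e : Bool) : ℝ :=
  let d₁ := qb q (2 * (h + 1) + 1)
  let d₂ := qb q (2 * (h + 2) + 1)
  match f, d with
  | 0, 0 => -(q ^ (2 * N) / d₂)
  | 0, 1 => σ * qb q 2 * (if e then -q ^ (2 * (h + i + 2 * N) + 6) else q ^ (2 * h + 1)) / (d₁ * d₂)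
  | 0, 2 => -(q ^ (2 * (i + N) + 1 + 2 * bi e) / d₁)
  | 1, 0 => q ^ (if e then 2 * (i + N) + 3 else 2 * N) / d₂
  | 1, 1 => σ * (if e then q ^ (2 * (h + i) + 6) * qb q (2 * (h - i - N)) * qb q (2 * N + 2) -
        q ^ (2 * (h - i)) * qb q (2 * (h - N) + 3) * qb q (2 * (i + N) + 3)
      else q ^ (2 * (h - i) + 2) * qb q (2 * (h - N) + 3) * qb q (2 * (i + N) + 3) -
        q ^ (2 * (h + i) + 4) * qb q (2 * (h - i - N) + 2) * qb q (2 * N)) / (d₁ * d₂)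
  | 1, 2 => q ^ (if e then 2 * N else 2 * (i + N) + 1) / d₁
  | 2, 0 => -(q ^ (2 * (i + N) + 1 + 2 * bi e) / d₂)
  | 2, 1 => σ * qb q 2 * (if e then q ^ (2 * h + 1) else -q ^ (2 * (h + i + 2 * N) + 4)) / (d₁ * d₂)
  | 2, 2 => -(q ^ (2 * N) / d₁)
  | 3, 0 => 1 / d₂
  | 3, 1 => σ * qb q 2 * q ^ (if e then 2 * (h + i + N) + 6 else 2 * (h + N) + 3) / (d₁ * d₂)
  | 3, 2 => -(q ^ (2 * (i + 2 * N) + 3 + 2 * bi e) / d₁)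
  | 4, 0 => -(q ^ (2 * (i + 2 * N) + 3 + 2 * bi e) / d₂)
  | 4, 1 => σ * qb q 2 * q ^ (if e then 2 * (h + N) + 3 else 2 * (h + i + N) + 4) / (d₁ * d₂)
  | 4, 2 => 1 / d₁

/-- A product over the four coordinates of a cell. -/
def cellProd (F : ℤ → ℤ → ℝ) (f : Fin 5) (d : Fin 3) (i h N : ℤ) (e : Bool) : ℝ :=
  F (2 * N) (stepN f d e) * F (2 * (h - i - N)) (dlt d - stepJ f - stepN f d e) *
    F (2 * (i + N) + 1 + 2 * bi e) (stepJ f + stepN f d e + bi (newE f d e) - bi e) *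
    F (2 * (h - N) + 3 - 2 * bi e) (dlt d - stepN f d e - bi (newE f d e) + bi e)

/-- `i + N ≤ h` and `0 ≤ i, N`. -/
def CellMem (i h N : ℤ) : Prop := 0 ≤ i ∧ 0 ≤ N ∧ i + N ≤ h

-- The four coordinates in `cellProd` are exactly the arguments of the square roots: a coordinate z
-- raised by 2 contributes √(1 - q^{2(z+2)}), one lowered by 2 contributes √(1 - q^{2z}), and a
-- fixed one contributes nothing.
set_option linter.unusedSimpArgs false in
theorem red_lab (hq₀ : 0 < q) (hq₁ : q < 1) (f : Fin 5) (d : Fin 3) {i h N : ℤ} {e : Bool}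
    (u : ℤ) (σ : ℝ) (hs : CellMem i h N)
    (ht : CellMem (i + stepJ f) (h + dlt d) (N + stepN f d e)) :
    red q f d (lab i u h N e).l (lab i u h N e).j (lab i u h N e).m₂ σ =
      arr q σ f d i h N e * cellProd (stp q) f d i h N e := by
  obtain ⟨hi, hN, hh⟩ := hs
  obtain ⟨hi', hN', hh'⟩ := ht
  obtain ⟨l, hl⟩ : ∃ l, l = (lab i u h N e).l := ⟨_, rfl⟩
  obtain ⟨j, hj⟩ : ∃ j, j = (lab i u h N e).j := ⟨_, rfl⟩
  obtain ⟨m, hm⟩ : ∃ m, m = (lab i u h N e).m₂ := ⟨_, rfl⟩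
  rw [← hl, ← hj, ← hm]
  simp only [lab] at hl hj hm
  have hb : bi e = 0 ∨ bi e = 1 := by cases e <;> simp
  -- Several arrows carry the coefficient of the reversed arrow, which is evaluated at the target
  -- label; hence its coordinates are prepared as well as those of the source.
  have hl' : l + dlt d = (h + dlt d : ℤ) + 1 / 2 := by push_cast; linarith
  have hj' : j + stepJ f = (i + stepJ f : ℤ) + 1 / 2 := by push_cast; linarith
  have hm' : m + stepM f = 2 * (N + stepN f d e : ℤ) + (i + stepJ f : ℤ) - (h + dlt d : ℤ) +
      sgn (newE f d e) := by
    have h2 : (2 * stepN f d e : ℝ) = stepM f - stepJ f + dlt d + bi e - bi (newE f d e) := by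
      exact_mod_cast two_mul_stepN f d e
    rw [sgn_eq] at *
    push_cast; linarith
  generalize hl₀ : l + dlt d = l' at hl'
  generalize hj₀ : j + stepJ f = j' at hj'
  generalize hm₀ : m + stepM f = m' at hm'
  generalize hh₀ : h + dlt d = h' at *
  generalize hi₀ : i + stepJ f = i' at *
  generalize hN₀ : N + stepN f d e = N' at *
  generalize he₀ : newE f d e = e' at *
  have hb' : bi e' = 0 ∨ bi e' = 1 := by cases e' <;> simp
  fin_cases f <;> fin_cases d <;>
    simp [red, arr, dlt, stepM, stepJ, ← sub_eq_add_neg] at hl₀ hm₀ hj₀ hh₀ hi₀ ⊢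
  all_goals
    first
      | rw [coefCp_eq hq₀ hq₁ hl hj hm (by omega)]
      | rw [coefC0_eq hq₀ hq₁ hl hj hm (by omega) (by omega) (by omega)]
      | rw [coefCm_eq hq₀ hq₁ hl hj hm (by omega)]
      | rw [coefHp_eq hq₀ hq₁ hl hj hm (by omega) (by omega) (by omega)]
      | rw [coefH0_eq hq₀ hq₁ hl hj hm]
      | rw [coefDp_eq hq₀ hq₁ hl hj hm (by omega)]
      | rw [coefD0_eq hq₀ hq₁ hl hj hm (by omega) (by omega)]
      | rw [coefDm_eq hq₀ hq₁ hl hj hm (by omega)]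
      | rw [hl₀, hj₀, hm₀]
        first
        | rw [coefCp_eq hq₀ hq₁ hl' hj' hm' (by omega)]
        | rw [coefC0_eq hq₀ hq₁ hl' hj' hm' (by omega) (by omega) (by omega)]
        | rw [coefCm_eq hq₀ hq₁ hl' hj' hm' (by omega)]
        | rw [coefHp_eq hq₀ hq₁ hl' hj' hm' (by omega) (by omega) (by omega)]
        | rw [coefDp_eq hq₀ hq₁ hl' hj' hm' (by omega)]
        | rw [coefD0_eq hq₀ hq₁ hl' hj' hm' (by omega) (by omega)]
        | rw [coefDm_eq hq₀ hq₁ hl' hj' hm' (by omega)]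
  all_goals
    clear hl hj hm hl' hj' hm' hl₀ hj₀ hm₀ hi hi' hN hN' hh hh' hb hb'
    subst hh₀ hi₀ he₀ hN₀
    cases e <;> simp [cellProd, stp, stepN, newE, stepM, stepJ, dlt, -mul_eq_mul_left_iff,
      -mul_eq_mul_right_iff] <;> ring_nf

/-- The part of the weight of a label which depends on `(i, h, N, e)`. -/
def gCell (q : ℝ) (i h N : ℤ) (e : Bool) : ℝ :=
  wt₂ q (2 * N).toNat * wt₂ q (2 * (h - i - N)).toNat * wt₂ q (2 * (i + N) + 1 + 2 * bi e).toNat *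
    wt₂ q (2 * (h - N) + 3 - 2 * bi e).toNat

theorem gCell_mul (hq₀ : 0 < q) (hq₁ : q < 1) (f : Fin 5) (d : Fin 3) {i h N : ℤ} {e : Bool}
    (hs : CellMem i h N) (ht : CellMem (i + stepJ f) (h + dlt d) (N + stepN f d e)) :
    gCell q i h N e * cellProd (stp q) f d i h N e = cellProd (stpW q) f d i h N e *
      gCell q (i + stepJ f) (h + dlt d) (N + stepN f d e) (newE f d e) := by
  obtain ⟨hi, hN, hh⟩ := hs
  obtain ⟨hi', hN', hh'⟩ := ht
  have hb : ∀ e, bi e = 0 ∨ bi e = 1 := by decide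
  have h0 := hb e
  have h1 := hb (newE f d e)
  have h2 := two_mul_stepN f d e
  -- A finite check that each of the four coordinates moves by at most one double step.
  have h3 : (stepN f d e = 1 ∨ stepN f d e = 0 ∨ stepN f d e = -1) ∧
    (dlt d - stepJ f - stepN f d e = 1 ∨ dlt d - stepJ f - stepN f d e = 0 ∨
      dlt d - stepJ f - stepN f d e = -1) ∧
    (stepJ f + stepN f d e + bi (newE f d e) - bi e = 1 ∨
      stepJ f + stepN f d e + bi (newE f d e) - bi e = 0 ∨
      stepJ f + stepN f d e + bi (newE f d e) - bi e = -1) ∧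
    (dlt d - stepN f d e - bi (newE f d e) + bi e = 1 ∨
      dlt d - stepN f d e - bi (newE f d e) + bi e = 0 ∨
      dlt d - stepN f d e - bi (newE f d e) + bi e = -1) := by
    clear hi' hN' hh' h0 h1 h2
    revert f d e; decide
  obtain ⟨a1, a2, a3, a4⟩ := h3
  have w1 := wt₂_mul_stp hq₀ hq₁ (z := 2 * N) (z' := 2 * (N + stepN f d e)) (by omega) (by omega)
    (by ring) a1
  have w2 := wt₂_mul_stp hq₀ hq₁ (z := 2 * (h - i - N))
    (z' := 2 * (h + dlt d - (i + stepJ f) - (N + stepN f d e))) (by omega) (by omega) (by ring) a2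
  have w3 := wt₂_mul_stp hq₀ hq₁ (z := 2 * (i + N) + 1 + 2 * bi e)
    (z' := 2 * (i + stepJ f + (N + stepN f d e)) + 1 + 2 * bi (newE f d e)) (by omega) (by omega)
    (by ring) a3
  have w4 := wt₂_mul_stp hq₀ hq₁ (z := 2 * (h - N) + 3 - 2 * bi e)
    (z' := 2 * (h + dlt d - (N + stepN f d e)) + 3 - 2 * bi (newE f d e)) (by omega) (by omega)
    (by ring) a4
  rw [gCell, gCell, cellProd, cellProd, mul_mul_mul_comm, mul_mul_mul_comm (wt₂ q _ * _),
    mul_mul_mul_comm (wt₂ q _), w1, w2, w3, w4]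
  ring

/-- A cell outside the region has N < 0 or h - i - N < 0. These two quantities rise by at most 1
along an arrow, so the offending one equals -1 and rises to 0, and its raising factor is 1 - q^0. -/
theorem cellProd_stpW_eq_zero (f : Fin 5) (d : Fin 3) {i h N : ℤ} {e : Bool}
    (hi : 0 ≤ i) (hs : ¬ CellMem i h N)
    (ht : CellMem (i + stepJ f) (h + dlt d) (N + stepN f d e)) :
    cellProd (stpW q) f d i h N e = 0 := by
  obtain ⟨hi', hN', hh'⟩ := ht
  have h3 : stepN f d e ≤ 1 ∧ dlt d - stepJ f - stepN f d e ≤ 1 := by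
    clear hi' hN' hh'
    revert f d e; decide
  by_cases hN : 0 ≤ N
  · have hh : ¬ i + N ≤ h := fun hh => hs ⟨hi, hN, hh⟩
    have e1 : dlt d - stepJ f - stepN f d e = 1 := by omega
    have e2 : 2 * (h - i - N) + 2 = 0 := by omega
    rw [cellProd, e1, stpW.eq_def q (2 * (h - i - N)), if_pos rfl, e2, qb_zero]
    ring
  · have e1 : stepN f d e = 1 := by omega
    have e2 : 2 * N + 2 = 0 := by omega
    rw [cellProd, e1, stpW.eq_def q (2 * N), if_pos rfl, e2, qb_zero]
    ring

theorem gCell_pos (hq₀ : 0 < q) (hq₁ : q < 1) (i h N : ℤ) (e : Bool) : 0 < gCell q i h N e := by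
  have := wt₂_pos hq₀ hq₁
  exact mul_pos (mul_pos (mul_pos (this _) (this _)) (this _)) (this _)

/-- The five families of operators on formal combinations of cells. -/
def opFam (q σ : ℝ) (f : Fin 5) : ℤ → Cells →ₗ[ℝ] Cells :=
  ![opC q σ, opH q σ, opT q σ, opD q σ, opE q σ] f

-- This identifies the explicit operators of `op_relations` with the weighted form of the
-- coefficient tables.
set_option linter.unusedSimpArgs false in
theorem opFam_cell (q σ : ℝ) (f : Fin 5) (i h N : ℤ) (e : Bool) :
    opFam q σ f i (cell h N e) = ∑ d : Fin 3,
      (arr q σ f d i h N e * cellProd (stpW q) f d i h N e) •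
        cell (h + dlt d) (N + stepN f d e) (newE f d e) := by
  fin_cases f <;> cases e <;>
    simp [Fin.sum_univ_three, opFam, opC, opH, opT, opD, opE, opOf_cell, arr, cellProd, stpW,
      stepN, newE, stepM, stepJ, dlt, ← sub_eq_add_neg] <;>
    match_scalars <;> ring_nf

/-! ### The factors depending on j and m₁ -/

/-- The steps in `m₁` of `x_0`, `x_1` and the adjoint of `x_1`. -/
def stepB : Fin 3 → ℤ := ![0, 1, -1]

/-- The factors `A` and `B` of the matrix elements of `x_0`, `x_1` and the adjoint of `x_1`, for
`j ↦ j + dlt k`. -/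
def spin (q : ℝ) (g k : Fin 3) (j m₁ : ℝ) : ℝ :=
  match g, k with
  | 0, 0 => coefAp q j m₁
  | 0, 1 => coefA0 q j m₁
  | 0, 2 => coefAp q (j - 1) m₁
  | 1, 0 => coefBp q j m₁
  | 1, 1 => coefB0 q j m₁
  | 1, 2 => coefBm q j m₁
  | 2, 0 => coefBm q (j + 1) (m₁ - 1)
  | 2, 1 => coefB0 q j (m₁ - 1)
  | 2, 2 => coefBp q (j - 1) (m₁ - 1)

/-- The part of the factors `A` and `B` which does not depend on the weights. -/
def spinArr (q : ℝ) (g k : Fin 3) (i u : ℤ) : ℝ :=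
  let d₁ := qb q (2 * i + 1)
  let d₂ := qb q (2 * (i + 1) + 1)
  match g, k with
  | 0, 0 => q ^ u / d₂
  | 0, 1 => q ^ (2 * i) * (q ^ (2 * u) * qb q 2 * qb q (2 * i + 1 - u) -
      qb q 1 * qb q (2 * i + 1)) / (d₁ * d₂)
  | 0, 2 => q ^ (u - 1) / d₁
  | 1, 0 => 1 / d₂
  | 1, 1 => qb q 2 * q ^ (2 * i + 1 + u) / (d₁ * d₂)
  | 1, 2 => -(q ^ (2 * u + 1) / d₁)
  | 2, 0 => -(q ^ (2 * u + 1) / d₂)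
  | 2, 1 => qb q 2 * q ^ (2 * i + u) / (d₁ * d₂)
  | 2, 2 => 1 / d₁

/-- A product over the two coordinates `j + m₁` and `j - m₁`. -/
def spinProd (F : ℤ → ℤ → ℝ) (g k : Fin 3) (i u : ℤ) : ℝ :=
  F u (dlt k + stepB g) * F (2 * i + 1 - u) (dlt k - stepB g)

section Coefficients

variable {j m₁ : ℝ} {i u : ℤ}

theorem coefAp_eq (hq₀ : 0 < q) (hq₁ : q < 1) (hj : j = i + 1 / 2) (hm : m₁ = u - i - 1 / 2)
    (hu : 0 ≤ u + 1) : coefAp q j m₁ = q ^ u / qb q (2 * (i + 1) + 1) *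
      (sq q (u + 1) * sq q (2 * i + 1 - u + 1)) := by
  rw [coefAp, coef_single hq₀ hq₁ u (u + 1) (2 * i + 1 - u + 1) (2 * (i + 1) + 1)
    (by push_cast; linarith) (by push_cast; linarith) (by push_cast; linarith)
    (by push_cast; linarith) hu]
  ring

/-- The two terms of A⁰ differ by one power of q⁻¹ - q, which is absorbed through 1 - q² = q(q⁻¹ -
q). -/
theorem coefA0_eq (hq₀ : 0 < q) (hq₁ : q < 1) (hj : j = i + 1 / 2) (hm : m₁ = u - i - 1 / 2) :
    coefA0 q j m₁ = q ^ (2 * i) * (q ^ (2 * u) * qb q 2 * qb q (2 * i + 1 - u) -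
      qb q 1 * qb q (2 * i + 1)) / (qb q (2 * i + 1) * qb q (2 * (i + 1) + 1)) := by
  have h0 : 0 < q⁻¹ - q := by
    have := one_lt_inv_iff₀.2 ⟨hq₀, hq₁⟩
    linarith
  have hq := hq₀.ne'
  have h2 : (q : ℝ) ^ (-2 : ℝ) = (q ^ 2)⁻¹ := by rw [Real.rpow_neg hq₀.le]; norm_cast
  have e1 : qb q 1 = q * (q⁻¹ - q) := by
    rw [qb]; norm_num; field_simp
  have e2 : j + m₁ + 1 = (u + 1 : ℤ) := by push_cast; linarith
  have e3 := qb_odd_ne_zero hq₀ hq₁ i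
  have e4 := qb_odd_ne_zero hq₀ hq₁ (i + 1)
  rw [coefA0, e1, qnum_eq hq₀ (a := 2) (a' := 2) (by norm_num),
    qnum_eq hq₀ (a := j - m₁) (a' := 2 * i + 1 - u) (by push_cast; linarith),
    qnum_eq hq₀ (a := 2 * j) (a' := 2 * i + 1) (by push_cast; linarith),
    qnum_eq hq₀ (a := 2 * j + 2) (a' := 2 * (i + 1) + 1) (by push_cast; linarith),
    e2, show j - m₁ = (2 * i + 1 - u : ℤ) by push_cast; linarith,
    show 2 * j = (2 * i + 1 : ℤ) by push_cast; linarith,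
    show ((2 * i + 1 : ℤ) : ℝ) + 2 = (2 * (i + 1) + 1 : ℤ) by push_cast; ring, h2]
  have e5 : (q : ℝ) ^ (2 * i) = q ^ i * q ^ i := by rw [two_mul, zpow_add₀ hq]
  have e6 : (q : ℝ) ^ (2 * u) = q ^ u * q ^ u := by rw [two_mul, zpow_add₀ hq]
  have e7 : (q : ℝ) ^ (2 * (i + 1)) = q ^ i * q ^ i * q ^ 2 := by
    rw [mul_add, zpow_add₀ hq, e5]; norm_cast
  simp only [Real.rpow_neg hq₀.le, Real.rpow_intCast, zpow_sub₀ hq, zpow_add₀ hq, e5, e6, e7,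
    zpow_one]
  have n1 := zpow_ne_zero i hq
  have n2 := zpow_ne_zero u hq
  generalize q⁻¹ - q = c₀ at *
  have := h0.ne'
  generalize q ^ i = x1 at *
  generalize q ^ u = x2 at *
  generalize qb q (2 * i + 1) = x3 at *
  generalize qb q (2 * (i + 1) + 1) = x4 at *
  norm_num
  field_simp

theorem coefBp_eq (hq₀ : 0 < q) (hq₁ : q < 1) (hj : j = i + 1 / 2) (hm : m₁ = u - i - 1 / 2)
    (hu : 0 ≤ u + 1) : coefBp q j m₁ = 1 / qb q (2 * (i + 1) + 1) *
      (sq q (u + 1) * sq q (u + 2)) := by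
  rw [coefBp, coef_single hq₀ hq₁ 0 (u + 1) (u + 2) (2 * (i + 1) + 1)
    (by push_cast; linarith) (by push_cast; linarith) (by push_cast; linarith)
    (by push_cast; linarith) hu, zpow_zero]
  ring

/-- Here 1 + q² = q[2] brings the coefficient to the shape of `coef_double`. -/
theorem coefB0_eq (hq₀ : 0 < q) (hq₁ : q < 1) (hj : j = i + 1 / 2) (hm : m₁ = u - i - 1 / 2)
    (hu : 0 ≤ 2 * i + 1 - u) : coefB0 q j m₁ =
      qb q 2 * q ^ (2 * i + 1 + u) / (qb q (2 * i + 1) * qb q (2 * (i + 1) + 1)) *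
      (sq q (2 * i + 1 - u) * sq q (u + 1)) := by
  have h0 : 0 < q⁻¹ - q := by
    have := one_lt_inv_iff₀.2 ⟨hq₀, hq₁⟩
    linarith
  have h1 : (1 + q ^ 2) = qnum q 2 * q := by
    rw [eq_comm, ← mul_right_cancel_iff_of_pos h0, mul_right_comm, qnum_two_mul hq₀ hq₁,
      Real.rpow_neg hq₀.le, qb]
    norm_cast
    have := hq₀.ne'
    field_simp
    ring
  have h2 : (1 + q ^ 2) * q ^ (m₁ - 1 / 2) = qnum q 2 * q ^ (m₁ + 1 / 2) := by
    rw [h1, mul_assoc, mul_comm q, ← Real.rpow_add_one hq₀.ne']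
    congr 2; ring
  rw [coefB0, h2, coef_double hq₀ hq₁ (2 * i + 1 + u) (2 * i + 1 - u) (u + 1) (2 * i + 1)
    (2 * (i + 1) + 1)
    (by push_cast; linarith) (by push_cast; linarith) (by push_cast; linarith)
    (by push_cast; linarith) (by push_cast; linarith) hu]
  ring

theorem coefBm_eq (hq₀ : 0 < q) (hq₁ : q < 1) (hj : j = i + 1 / 2) (hm : m₁ = u - i - 1 / 2)
    (hu : 0 ≤ 2 * i + 1 - u) : coefBm q j m₁ = -(q ^ (2 * u + 1) / qb q (2 * i + 1)) *
      (sq q (2 * i + 1 - u) * sq q (2 * i + 1 - u - 1)) := by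
  rw [coefBm, coef_single hq₀ hq₁ (2 * u + 1) (2 * i + 1 - u) (2 * i + 1 - u - 1) (2 * i + 1)
    (by push_cast; linarith) (by push_cast; linarith) (by push_cast; linarith)
    (by push_cast; linarith) hu]
  ring

end Coefficients

/-- `0 ≤ j + m₁` and `0 ≤ j - m₁`. -/
def SpinMem (i u : ℤ) : Prop := 0 ≤ u ∧ u ≤ 2 * i + 1

theorem lab_mem_iff {i u h N : ℤ} {e : Bool} :
    lab i u h N e ∈ spinorLabels ↔ SpinMem i u ∧ CellMem i h N := by
  rw [lab_mem, SpinMem, CellMem]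
  omega

set_option linter.unusedSimpArgs false in
theorem spin_lab (hq₀ : 0 < q) (hq₁ : q < 1) (g k : Fin 3) {i u : ℤ} (h N : ℤ) (e : Bool)
    (hs : SpinMem i u) (ht : SpinMem (i + dlt k) (u + dlt k + stepB g)) :
    spin q g k (lab i u h N e).j (lab i u h N e).m₁ =
      spinArr q g k i u * spinProd (hop q) g k i u := by
  obtain ⟨hu, hv⟩ := hs
  obtain ⟨hu', hv'⟩ := ht
  obtain ⟨j, hj⟩ : ∃ j, j = (lab i u h N e).j := ⟨_, rfl⟩
  obtain ⟨m, hm⟩ : ∃ m, m = (lab i u h N e).m₁ := ⟨_, rfl⟩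
  rw [← hj, ← hm]
  simp only [lab] at hj hm
  have hj' : j + dlt k = (i + dlt k : ℤ) + 1 / 2 := by push_cast; linarith
  have hm' : m + stepB g = (u + dlt k + stepB g : ℤ) - (i + dlt k : ℤ) - 1 / 2 := by
    push_cast; linarith
  generalize hj₀ : j + dlt k = j' at hj'
  generalize hm₀ : m + stepB g = m' at hm'
  generalize hi₀ : i + dlt k = i' at *
  generalize hu₀ : u + dlt k + stepB g = u' at *
  fin_cases g <;> fin_cases k <;>
    simp [spin, spinArr, dlt, stepB, ← sub_eq_add_neg, - one_div] at hm₀ hj₀ hi₀ hu₀ ⊢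
  all_goals
    first
      | rw [coefAp_eq hq₀ hq₁ hj hm (by omega)]
      | rw [coefA0_eq hq₀ hq₁ hj hm]
      | rw [coefBp_eq hq₀ hq₁ hj hm (by omega)]
      | rw [coefB0_eq hq₀ hq₁ hj hm (by omega)]
      | rw [coefBm_eq hq₀ hq₁ hj hm (by omega)]
      | rw [hj₀, hm₀]
        first
        | rw [coefAp_eq hq₀ hq₁ hj' hm' (by omega)]
        | rw [coefBp_eq hq₀ hq₁ hj' hm' (by omega)]
        | rw [coefB0_eq hq₀ hq₁ hj' hm' (by omega)]
        | rw [coefBm_eq hq₀ hq₁ hj' hm' (by omega)]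
  all_goals
    clear hj hm hj' hm' hj₀ hm₀ hu hu' hv hv'
    subst hi₀ hu₀
    simp [spinProd, hop, stepB, dlt, -mul_eq_mul_left_iff, -mul_eq_mul_right_iff] <;> ring_nf

/-- The part of the weight of a label which depends on `(i, u)`. -/
def gSpin (q : ℝ) (i u : ℤ) : ℝ := wt₁ q u.toNat * wt₁ q (2 * i + 1 - u).toNat

theorem gSpin_pos (hq₀ : 0 < q) (hq₁ : q < 1) (i u : ℤ) : 0 < gSpin q i u :=
  mul_pos (wt₁_pos hq₀ hq₁ _) (wt₁_pos hq₀ hq₁ _)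

theorem gSpin_mul (hq₀ : 0 < q) (hq₁ : q < 1) (g k : Fin 3) {i u : ℤ}
    (hs : SpinMem i u) (ht : SpinMem (i + dlt k) (u + dlt k + stepB g)) :
    gSpin q i u * spinProd (hop q) g k i u =
      spinProd (hopW q) g k i u * gSpin q (i + dlt k) (u + dlt k + stepB g) := by
  obtain ⟨hu, hv⟩ := hs
  obtain ⟨hu', hv'⟩ := ht
  have h3 : (-2 ≤ dlt k + stepB g ∧ dlt k + stepB g ≤ 2) ∧
      (-2 ≤ dlt k - stepB g ∧ dlt k - stepB g ≤ 2) := by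
    clear hu' hv'
    revert g k; decide
  have w1 := wt₁_mul_hop hq₀ hq₁ (z := u) (z' := u + dlt k + stepB g) hu hu' (by ring) h3.1
  have w2 := wt₁_mul_hop hq₀ hq₁ (z := 2 * i + 1 - u)
    (z' := 2 * (i + dlt k) + 1 - (u + dlt k + stepB g)) (by omega) (by omega) (by ring) h3.2
  rw [gSpin, gSpin, spinProd, spinProd, mul_mul_mul_comm, w1, w2]
  ring

/-- The coordinates j ± m₁ rise by at most 2. To come from a negative value to a nonnegative one,
such a coordinate must pass from -1 to 0, and the corresponding factor is 1 - q^0. -/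
theorem spinProd_hopW_eq_zero (g k : Fin 3) {i u : ℤ}
    (hs : ¬ SpinMem i u) (ht : SpinMem (i + dlt k) (u + dlt k + stepB g)) :
    spinProd (hopW q) g k i u = 0 := by
  obtain ⟨hu', hv'⟩ := ht
  have h3 : dlt k + stepB g ≤ 2 ∧ dlt k - stepB g ≤ 2 := by
    clear hu' hv'
    revert g k; decide
  have key : ∀ z δ : ℤ, z < 0 → 0 ≤ z + δ → δ ≤ 2 → hopW q z δ = 0 := by
    intro z δ hz hδ h2
    rcases (by omega : (z = -1 ∧ δ = 2) ∨ (z = -2 ∧ δ = 2) ∨ (z = -1 ∧ δ = 1)) with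
      ⟨rfl, rfl⟩ | ⟨rfl, rfl⟩ | ⟨rfl, rfl⟩ <;> simp [hopW, qb_zero]
  rw [SpinMem, not_and_or] at hs
  unfold spinProd
  rcases hs with hs | hs
  · rw [key u _ (by omega) (by omega) h3.1, zero_mul]
  · rw [key (2 * i + 1 - u) _ (by omega) (by omega) h3.2, mul_zero]

/-! ### Bounds -/

theorem qb_le_one (hq₀ : 0 < q) (n : ℤ) : qb q n ≤ 1 := by
  have := zpow_pos hq₀ (2 * n)
  unfold qb; linarith

theorem qb_mono (hq₀ : 0 < q) (hq₁ : q < 1) {m n : ℤ} (h : m ≤ n) : qb q m ≤ qb q n := by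
  have := zpow_le_zpow_right_of_le_one₀ hq₀ hq₁.le (show 2 * m ≤ 2 * n by omega)
  unfold qb; linarith

theorem sq_nonneg' (n : ℤ) : 0 ≤ sq q n := Real.sqrt_nonneg _

theorem sq_le_one (hq₀ : 0 < q) (n : ℤ) : sq q n ≤ 1 :=
  Real.sqrt_le_one.2 (qb_le_one hq₀ n)

theorem abs_sq_le_one (hq₀ : 0 < q) (n : ℤ) : |sq q n| ≤ 1 := by
  rw [abs_of_nonneg (sq_nonneg' n)]; exact sq_le_one hq₀ n

theorem abs_mul_le_one {a b : ℝ} (ha : |a| ≤ 1) (hb : |b| ≤ 1) : |a * b| ≤ 1 := by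
  rw [abs_mul]; exact mul_le_one₀ ha (abs_nonneg _) hb

theorem abs_stp_le_one (hq₀ : 0 < q) (z δ : ℤ) : |stp q z δ| ≤ 1 := by
  unfold stp
  split_ifs
  exacts [abs_sq_le_one hq₀ _, abs_sq_le_one hq₀ _, by simp]

theorem abs_hop_le_one (hq₀ : 0 < q) (z δ : ℤ) : |hop q z δ| ≤ 1 := by
  have h := abs_sq_le_one hq₀
  unfold hop
  split_ifs
  exacts [abs_mul_le_one (h _) (h _), h _, h _, abs_mul_le_one (h _) (h _), by simp]

theorem abs_cellProd_le_one {F : ℤ → ℤ → ℝ} (hF : ∀ z δ, |F z δ| ≤ 1) (f : Fin 5) (d : Fin 3)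
    (i h N : ℤ) (e : Bool) : |cellProd F f d i h N e| ≤ 1 :=
  abs_mul_le_one (abs_mul_le_one (abs_mul_le_one (hF _ _) (hF _ _)) (hF _ _)) (hF _ _)

/-- The constant is chosen to serve one and two denominators alike, as (1 - q²)² ≤ 1 - q² ≤ 1 -
q^{2m}. The factor 2 leaves room for numerators with two terms. -/
theorem abs_div_qb_le (hq₀ : 0 < q) (hq₁ : q < 1) {x y : ℝ} {m : ℤ} (hx : |x| ≤ 2 * y)
    (hm : 1 ≤ m) : |x / qb q m| ≤ 2 / qb q 1 ^ 2 * y := by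
  have h1 := qb_pos hq₀ hq₁ one_pos
  have h2 := qb_le_one hq₀ 1
  have h3 := qb_mono hq₀ hq₁ hm
  have h4 : qb q 1 ^ 2 ≤ qb q m := by nlinarith
  have h5 := (abs_nonneg x).trans hx
  rw [abs_div, abs_of_pos (h1.trans_le h3), div_mul_eq_mul_div]
  exact div_le_div₀ h5 hx (by positivity) h4

theorem abs_div_qb_qb_le (hq₀ : 0 < q) (hq₁ : q < 1) {x y : ℝ} {m n : ℤ} (hx : |x| ≤ 2 * y)
    (hm : 1 ≤ m) (hn : 1 ≤ n) : |x / (qb q m * qb q n)| ≤ 2 / qb q 1 ^ 2 * y := by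
  have h1 := qb_pos hq₀ hq₁ one_pos
  have h3 := qb_mono hq₀ hq₁ hm
  have h4 := qb_mono hq₀ hq₁ hn
  have h5 := (abs_nonneg x).trans hx
  rw [abs_div, abs_of_pos (mul_pos (h1.trans_le h3) (h1.trans_le h4)), div_mul_eq_mul_div, pow_two]
  exact div_le_div₀ h5 hx (by positivity) (mul_le_mul h3 h4 h1.le (h1.trans_le h3).le)

theorem abs_zpow_le (hq₀ : 0 < q) (hq₁ : q < 1) {n m : ℤ} (h : m ≤ n) : |q ^ n| ≤ q ^ m := by
  rw [abs_of_pos (zpow_pos hq₀ n)]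
  exact zpow_le_zpow_right_of_le_one₀ hq₀ hq₁.le h

theorem abs_qb_le_one (hq₀ : 0 < q) (hq₁ : q < 1) {n : ℤ} (hn : 0 ≤ n) : |qb q n| ≤ 1 := by
  rw [abs_of_nonneg (qb_nonneg hq₀ hq₁ hn)]; exact qb_le_one hq₀ n

theorem abs_mul_le_of_le_one {a b y : ℝ} (ha : |a| ≤ 1) (hb : |b| ≤ y) : |a * b| ≤ y := by
  rw [abs_mul]
  exact (mul_le_of_le_one_left (abs_nonneg _) ha).trans hb

theorem abs_mul_le_of_le_one' {a b y : ℝ} (hb : |b| ≤ y) (ha : |a| ≤ 1) : |b * a| ≤ y := by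
  rw [mul_comm]; exact abs_mul_le_of_le_one ha hb

theorem abs_le_two {x y : ℝ} (h : |x| ≤ y) : |x| ≤ 2 * y := by
  linarith [abs_nonneg x]

/-- The order of decay of the arrows: `0` for those which survive in the limit of large `j`. -/
def decay : Fin 5 → Fin 3 → ℤ := ![![0, 1, 1], ![0, 0, 0], ![1, 1, 0], ![0, 1, 1], ![1, 1, 0]]

/-- The decay comes from powers of q whose exponent contains i, or h with h ≥ i. Family 1 has no
decay of its own; for x₀ and x₁ its smallness comes from A⁰ and B⁰. -/
theorem abs_arr_le (hq₀ : 0 < q) (hq₁ : q < 1) {σ : ℝ} (hσ : |σ| ≤ 1) (f : Fin 5) (d : Fin 3)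
    {i h N : ℤ} (e : Bool) (hs : CellMem i h N) :
    |arr q σ f d i h N e| ≤ 2 / qb q 1 ^ 2 * q ^ (decay f d * i) := by
  obtain ⟨hi, hN, hh⟩ := hs
  have hb : bi e = 0 ∨ bi e = 1 := by cases e <;> simp
  have h2 := abs_qb_le_one hq₀ hq₁ (show (0 : ℤ) ≤ 2 by norm_num)
  have hs2 := abs_mul_le_one hσ h2
  fin_cases f <;> fin_cases d <;> simp only [arr]
  all_goals try rw [← neg_div]
  all_goals
    first
      | refine abs_div_qb_le hq₀ hq₁ (abs_le_two ?_) (by omega)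
        first
          | rw [abs_neg]
            refine abs_zpow_le hq₀ hq₁ ?_
          | refine abs_zpow_le hq₀ hq₁ ?_
          | (rw [abs_one]; simp [decay])
      | refine abs_div_qb_qb_le hq₀ hq₁ (abs_le_two ?_) (by omega) (by omega)
        refine abs_mul_le_of_le_one hs2 ?_
        first
          | refine abs_zpow_le hq₀ hq₁ ?_
          | cases e <;> simp only [Bool.false_eq_true, if_false, if_true, abs_neg] <;>
              refine abs_zpow_le hq₀ hq₁ ?_
      | skip
  all_goals try simp [decay]
  all_goals try (cases e <;> simp <;> omega)
  all_goals try omega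
  -- The diagonal coefficient H⁰ is a difference of two products of numbers of modulus at most 1.
  · cases e <;> simp only [Bool.false_eq_true, if_false, if_true] <;>
    refine (abs_div_qb_qb_le hq₀ hq₁ (y := 1) ?_ (by omega) (by omega)).trans_eq (mul_one _) <;>
    refine abs_mul_le_of_le_one hσ ?_ <;>
    refine (abs_sub _ _).trans ?_
    · have a1 := abs_zpow_le hq₀ hq₁ (show 0 ≤ 2 * (h - i) + 2 by omega)
      have a2 := abs_zpow_le hq₀ hq₁ (show 0 ≤ 2 * (h + i) + 4 by omega)
      rw [zpow_zero] at *
      have b := @abs_qb_le_one q hq₀ hq₁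
      have := abs_mul_le_one (abs_mul_le_one a1 (b (show 0 ≤ 2 * (h - N) + 3 by omega)))
        (b (show 0 ≤ 2 * (i + N) + 3 by omega))
      have := abs_mul_le_one (abs_mul_le_one a2 (b (show 0 ≤ 2 * (h - i - N) + 2 by omega)))
        (b (show 0 ≤ 2 * N by omega))
      linarith
    · have a1 := abs_zpow_le hq₀ hq₁ (show 0 ≤ 2 * (h - i) by omega)
      have a2 := abs_zpow_le hq₀ hq₁ (show 0 ≤ 2 * (h + i) + 6 by omega)
      rw [zpow_zero] at *
      have b := @abs_qb_le_one q hq₀ hq₁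
      have := abs_mul_le_one (abs_mul_le_one a1 (b (show 0 ≤ 2 * (h - N) + 3 by omega)))
        (b (show 0 ≤ 2 * (i + N) + 3 by omega))
      have := abs_mul_le_one (abs_mul_le_one a2 (b (show 0 ≤ 2 * (h - i - N) by omega)))
        (b (show 0 ≤ 2 * N + 2 by omega))
      linarith

/-- The order of decay of the factors `A` and `B`. -/
def spinDecay : Fin 3 → ℤ := ![0, 1, 0]

/-- The condition on the target excludes u = 0 where the power q^{u-1} occurs; without it that power
would exceed the bound. -/
theorem abs_spinArr_le (hq₀ : 0 < q) (hq₁ : q < 1) (g k : Fin 3) {i u : ℤ} (hs : SpinMem i u)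
    (ht : SpinMem (i + dlt k) (u + dlt k + stepB g)) :
    |spinArr q g k i u| ≤ 2 / qb q 1 ^ 2 * q ^ (spinDecay k * i) := by
  obtain ⟨hu, hv⟩ := hs
  obtain ⟨hu', hv'⟩ := ht
  have h1 := abs_qb_le_one hq₀ hq₁ (show (0 : ℤ) ≤ 1 by norm_num)
  have h2 := abs_qb_le_one hq₀ hq₁ (show (0 : ℤ) ≤ 2 by norm_num)
  fin_cases g <;> fin_cases k <;> simp [dlt, stepB] at hu' hv' <;> simp only [spinArr]
  all_goals try rw [← neg_div]
  all_goals
    first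
      | refine abs_div_qb_le hq₀ hq₁ (abs_le_two ?_) (by omega)
        first
          | rw [abs_neg]
            refine abs_zpow_le hq₀ hq₁ ?_
          | refine abs_zpow_le hq₀ hq₁ ?_
          | (rw [abs_one]; simp [spinDecay])
      | refine abs_div_qb_qb_le hq₀ hq₁ (abs_le_two ?_) (by omega) (by omega)
        refine abs_mul_le_of_le_one h2 (abs_zpow_le hq₀ hq₁ ?_)
      | skip
  all_goals try simp [spinDecay]
  all_goals try omega
  refine abs_div_qb_qb_le hq₀ hq₁ ?_ (by omega) (by omega)
  rw [abs_mul, mul_comm]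
  refine mul_le_mul ((abs_sub _ _).trans ?_) (abs_zpow_le hq₀ hq₁ (by omega)) (abs_nonneg _)
    (by norm_num)
  have a1 := abs_zpow_le hq₀ hq₁ (show 0 ≤ 2 * u by omega)
  rw [zpow_zero] at a1
  have b := @abs_qb_le_one q hq₀ hq₁
  have := abs_mul_le_one (abs_mul_le_one a1 h2) (b (show 0 ≤ 2 * i + 1 - u by omega))
  have := abs_mul_le_one h1 (b (show 0 ≤ 2 * i + 1 by omega))
  linarith

/-! ### The operators on the space of spinors -/

/-- The sign `±` as a real number. -/
def sg (s : ℤˣ) : ℝ := ((s : ℤ) : ℝ)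

theorem sg_sq (s : ℤˣ) : sg s ^ 2 = 1 := by
  rcases Int.units_eq_one_or s with rfl | rfl <;> simp [sg]

theorem abs_sg_le (s : ℤˣ) : |sg s| ≤ 1 := by
  rcases Int.units_eq_one_or s with rfl | rfl <;> simp [sg]

/-- The label at the end of an arrow. -/
abbrev arrow (f : Fin 5) (d : Fin 3) (b : ℤ) : Equiv.Perm Label :=
  LabelSpace.translate (dlt d) b (stepM f) (stepJ f)

/-- A matrix element: the product of a factor which depends on `j`, `m₁` and a factor which depends
on `l`, `j`, `m₂`. -/
abbrev mat (q : ℝ) (c : ℝ → ℝ → ℝ) (f : Fin 5) (d : Fin 3) (t : Label) (s : ℤˣ) : ℝ :=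
  c t.j t.m₁ * red q f d t.l t.j t.m₂ (sg s)

/-- The operator given by a family of arrows, the step `b` in `m₁`, and the factor `c`. -/
def famOp (q : ℝ) (f : Fin 5) (b : ℤ) (c : ℝ → ℝ → ℝ) :
    Sp spinorLabels →L[ℂ] Sp spinorLabels :=
  ∑ d, W spinorLabels (arrow f d b) (mat q c f d)

/-- `c` is the factor of the arrows from `(i, u)`, and `a` the factor between weighted vectors. -/
def SpinFactor (q : ℝ) (f : Fin 5) (b : ℤ) (c : ℝ → ℝ → ℝ) (a : ℤ → ℤ → ℝ) : Prop :=
  (∃ B : ℝ, 0 ≤ B ∧ ∀ i u h N e, SpinMem i u → SpinMem (i + stepJ f) (u + stepJ f + b) →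
    |c (lab i u h N e).j (lab i u h N e).m₁| ≤ B) ∧
  ∀ i u, SpinMem (i + stepJ f) (u + stepJ f + b) →
    (SpinMem i u → ∀ h N e, gSpin q i u * c (lab i u h N e).j (lab i u h N e).m₁ =
      a i u * gSpin q (i + stepJ f) (u + stepJ f + b)) ∧ (¬ SpinMem i u → a i u = 0)

theorem abs_red_le (hq₀ : 0 < q) (hq₁ : q < 1) (f : Fin 5) (d : Fin 3) {i h N : ℤ} {e : Bool}
    (u : ℤ) {σ : ℝ} (hσ : |σ| ≤ 1) (hs : CellMem i h N)
    (ht : CellMem (i + stepJ f) (h + dlt d) (N + stepN f d e)) :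
    |red q f d (lab i u h N e).l (lab i u h N e).j (lab i u h N e).m₂ σ| ≤
      2 / qb q 1 ^ 2 * q ^ (decay f d * i) := by
  rw [red_lab hq₀ hq₁ f d u σ hs ht]
  exact abs_mul_le_of_le_one' (abs_arr_le hq₀ hq₁ hσ f d e hs)
    (abs_cellProd_le_one (abs_stp_le_one hq₀) _ _ _ _ _ _)

theorem abs_red_le' (hq₀ : 0 < q) (hq₁ : q < 1) (f : Fin 5) (d : Fin 3) {i h N : ℤ} {e : Bool}
    (u : ℤ) {σ : ℝ} (hσ : |σ| ≤ 1) (hs : CellMem i h N)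
    (ht : CellMem (i + stepJ f) (h + dlt d) (N + stepN f d e)) :
    |red q f d (lab i u h N e).l (lab i u h N e).j (lab i u h N e).m₂ σ| ≤ 2 / qb q 1 ^ 2 := by
  refine (abs_red_le hq₀ hq₁ f d u hσ hs ht).trans ?_
  have h1 := qb_pos hq₀ hq₁ one_pos
  refine mul_le_of_le_one_right (by positivity) (zpow_le_one₀ hq₀ hq₁.le (mul_nonneg ?_ hs.1))
  clear ht; revert f d; decide

theorem arrow_mem {f : Fin 5} {d : Fin 3} {b i u h N : ℤ} {e : Bool}
    (ht : lab i u h N e ∈ spinorLabels) (ht' : arrow f d b (lab i u h N e) ∈ spinorLabels) :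
    (SpinMem i u ∧ SpinMem (i + stepJ f) (u + stepJ f + b)) ∧
      CellMem i h N ∧ CellMem (i + stepJ f) (h + dlt d) (N + stepN f d e) := by
  rw [translate_lab, lab_mem_iff] at ht'
  rw [lab_mem_iff] at ht
  tauto

theorem bddCoef_mat (hq₀ : 0 < q) (hq₁ : q < 1) {f : Fin 5} {b : ℤ} {c : ℝ → ℝ → ℝ}
    {a : ℤ → ℤ → ℝ} (hc : SpinFactor q f b c a) (d : Fin 3) :
    BddCoef spinorLabels (arrow f d b) (mat q c f d) := by
  obtain ⟨⟨B, h0, hB⟩, -⟩ := hc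
  have h1 := qb_pos hq₀ hq₁ one_pos
  refine ⟨B * (2 / qb q 1 ^ 2), by positivity, fun t ht ht' s => ?_⟩
  obtain ⟨i, u, h, N, e, rfl⟩ := exists_lab ht
  obtain ⟨⟨a1, a2⟩, a3, a4⟩ := arrow_mem ht ht'
  rw [abs_mul]
  exact mul_le_mul (hB _ _ _ _ _ a1 a2) (abs_red_le' hq₀ hq₁ f d u (abs_sg_le s) a3 a4)
    (abs_nonneg _) h0

theorem coe_smul_sp {I : Set Label} (r : ℝ) (x : Sp I) : (r : ℂ) • x = r • x := rfl

/-- Formal combinations of cells as vectors, in the weighted basis. -/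
def toSp (q : ℝ) (i u : ℤ) (s : ℤˣ) : Cells →ₗ[ℝ] Sp spinorLabels :=
  Finsupp.linearCombination ℝ fun c => (gSpin q i u * gCell q i c.1 c.2.1 c.2.2) •
    vec spinorLabels (lab i u c.1 c.2.1 c.2.2) s

theorem toSp_cell (q : ℝ) (i u : ℤ) (s : ℤˣ) (h N : ℤ) (e : Bool) :
    toSp q i u s (cell h N e) = (gSpin q i u * gCell q i h N e) •
      vec spinorLabels (lab i u h N e) s := by
  simp [toSp, cell]

/-- The truncation to labels is compatible with the formal operators: arrows leaving the index set
end in the zero vector, and arrows entering it have coefficient 0. Thus every identity between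
formal operators holds on spinors, boundary included. -/
theorem famOp_toSp (hq₀ : 0 < q) (hq₁ : q < 1) {f : Fin 5} {b : ℤ} {c : ℝ → ℝ → ℝ}
    {a : ℤ → ℤ → ℝ} (hc : SpinFactor q f b c a) (i u : ℤ) (s : ℤˣ) (x : Cells) :
    famOp q f b c (toSp q i u s x) =
      a i u • toSp q (i + stepJ f) (u + stepJ f + b) s (opFam q (sg s) f i x) := by
  have key : ((famOp q f b c).restrictScalars ℝ : Sp spinorLabels →ₗ[ℝ] Sp spinorLabels) ∘ₗ
      toSp q i u s =
      a i u • toSp q (i + stepJ f) (u + stepJ f + b) s ∘ₗ opFam q (sg s) f i := by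
    refine cell_ext fun h N e => ?_
    simp only [LinearMap.comp_apply, LinearMap.smul_apply, ContinuousLinearMap.coe_coe,
      ContinuousLinearMap.coe_restrictScalars', toSp_cell, opFam_cell, map_sum, map_smul]
    rw [famOp, sum_apply, Finset.smul_sum, Finset.smul_sum]
    refine Finset.sum_congr rfl fun d _ => ?_
    rw [smul_smul, smul_smul]
    by_cases ht' : lab (i + stepJ f) (u + stepJ f + b) (h + dlt d) (N + stepN f d e) (newE f d e) ∈
      spinorLabels
    · obtain ⟨hs', hc'⟩ := lab_mem_iff.1 ht'
      obtain ⟨h1, h2⟩ := hc.2 i u hs'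
      by_cases ht : lab i u h N e ∈ spinorLabels
      · obtain ⟨hs, hc₀⟩ := lab_mem_iff.1 ht
        rw [W_vec (bddCoef_mat hq₀ hq₁ hc d) ht, translate_lab, coe_smul_sp, smul_smul]
        congr 1
        rw [mat, red_lab hq₀ hq₁ f d u _ hc₀ hc']
        linear_combination (gCell q i h N e * arr q (sg s) f d i h N e *
          cellProd (stp q) f d i h N e) * h1 hs h N e + a i u * arr q (sg s) f d i h N e *
            gSpin q (i + stepJ f) (u + stepJ f + b) * gCell_mul hq₀ hq₁ f d hc₀ hc'
      · rw [vec_of_notMem ht, map_zero, smul_zero]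
        -- The source vector is 0 while the target is not, so the coefficient must vanish: through
        -- the cell factor if (i, u) is admissible (then i ≥ 0), and through the spin factor
        -- otherwise.
        by_cases hs : SpinMem i u
        · have hc₀ : ¬ CellMem i h N := fun h => ht (lab_mem_iff.2 ⟨hs, h⟩)
          rw [cellProd_stpW_eq_zero f d (by unfold SpinMem at hs; omega) hc₀ hc']
          simp
        · rw [h2 hs]
          simp
    · rw [vec_of_notMem ht', smul_zero]
      by_cases ht : lab i u h N e ∈ spinorLabels
      · rw [W_vec (bddCoef_mat hq₀ hq₁ hc d) ht, translate_lab, vec_of_notMem ht', smul_zero,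
          smul_zero]
      · rw [vec_of_notMem ht, map_zero, smul_zero]
  exact LinearMap.congr_fun key x

/-- The weights are nonzero, so images of cells exhaust the basis vectors up to scalars. That the
map has a large kernel does no harm. -/
theorem toSp_ext (hq₀ : 0 < q) (hq₁ : q < 1) {S T : Sp spinorLabels →L[ℂ] Sp spinorLabels}
    (H : ∀ i u s x, S (toSp q i u s x) = T (toSp q i u s x)) : S = T := by
  refine clm_ext fun t ht s => ?_
  obtain ⟨i, u, h, N, e, rfl⟩ := exists_lab ht
  have h1 := H i u s (cell h N e)
  have h2 := (mul_pos (gSpin_pos hq₀ hq₁ i u) (gCell_pos hq₀ hq₁ i h N e)).ne'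
  rw [toSp_cell, ContinuousLinearMap.map_smul_of_tower, ContinuousLinearMap.map_smul_of_tower] at h1
  exact smul_right_injective _ h2 h1

/-- The inclusion of the families of `x_0`, `x_1`. -/
def fam : Fin 3 → Fin 5 := ![0, 1, 2]

theorem stepJ_fam (k : Fin 3) : stepJ (fam k) = dlt k := by revert k; decide

theorem spinFactor_spin (hq₀ : 0 < q) (hq₁ : q < 1) (g k : Fin 3) :
    SpinFactor q (fam k) (stepB g) (spin q g k)
      (fun i u => spinArr q g k i u * spinProd (hopW q) g k i u) := by
  have h1 := qb_pos hq₀ hq₁ one_pos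
  rw [SpinFactor]
  simp only [stepJ_fam]
  refine ⟨⟨2 / qb q 1 ^ 2, by positivity, fun i u h N e hs ht => ?_⟩, fun i u ht =>
    ⟨fun hs h N e => ?_, fun hs => ?_⟩⟩
  · rw [spin_lab hq₀ hq₁ g k h N e hs ht, spinProd]
    refine (abs_mul_le_of_le_one' (abs_spinArr_le hq₀ hq₁ g k hs ht)
      (abs_mul_le_one (abs_hop_le_one hq₀ _ _) (abs_hop_le_one hq₀ _ _))).trans ?_
    refine mul_le_of_le_one_right (by positivity) (zpow_le_one₀ hq₀ hq₁.le (mul_nonneg ?_ ?_))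
    · clear hs ht; revert k; decide
    · unfold SpinMem at hs; omega
  · rw [spin_lab hq₀ hq₁ g k h N e hs ht]
    linear_combination spinArr q g k i u * gSpin_mul hq₀ hq₁ g k hs ht
  · rw [spinProd_hopW_eq_zero g k hs ht, mul_zero]

theorem spinFactor_one {f : Fin 5} (hf : stepJ f = 0) :
    SpinFactor q f 0 (fun _ _ => 1) (fun _ _ => 1) := by
  refine ⟨⟨1, zero_le_one, fun i u h N e _ _ => by simp⟩, fun i u ht => ?_⟩
  simp only [hf, add_zero] at *
  simp [ht]

/-- The operators of `x_0`, `x_1` and of the adjoint of `x_1`. -/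
def opX (q : ℝ) (g : Fin 3) : Sp spinorLabels →L[ℂ] Sp spinorLabels :=
  ∑ k, famOp q (fam k) (stepB g) (spin q g k)

/-- The operator of `x_2` and its adjoint. -/
def opY (q : ℝ) (f : Fin 5) : Sp spinorLabels →L[ℂ] Sp spinorLabels :=
  famOp q f 0 fun _ _ => 1

theorem opY_toSp (hq₀ : 0 < q) (hq₁ : q < 1) {f : Fin 5} (hf : stepJ f = 0) (i u : ℤ) (s : ℤˣ)
    (x : Cells) : opY q f (toSp q i u s x) = toSp q i u s (opFam q (sg s) f i x) := by
  rw [opY, famOp_toSp hq₀ hq₁ (spinFactor_one hf), one_smul]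
  simp [hf]

theorem opX_toSp (hq₀ : 0 < q) (hq₁ : q < 1) (g : Fin 3) (i u : ℤ) (s : ℤˣ) (x : Cells) :
    opX q g (toSp q i u s x) = ∑ k, (spinArr q g k i u * spinProd (hopW q) g k i u) •
      toSp q (i + dlt k) (u + dlt k + stepB g) s (opFam q (sg s) (fam k) i x) := by
  simp only [opX, sum_apply, famOp_toSp hq₀ hq₁ (spinFactor_spin hq₀ hq₁ g _),
    stepJ_fam]

theorem opX_zero_toSp (hq₀ : 0 < q) (hq₁ : q < 1) (i u : ℤ) (s : ℤˣ) (x : Cells) :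
    opX q 0 (toSp q i u s x) =
      (q ^ u * qb q (u + 1) * qb q (2 * i + 2 - u) / qb q (2 * (i + 1) + 1)) •
        toSp q (i + 1) (u + 1) s (opC q (sg s) i x) +
      (q ^ (2 * i) * (q ^ (2 * u) * qb q 2 * qb q (2 * i + 1 - u) - qb q 1 * qb q (2 * i + 1)) /
        (qb q (2 * i + 1) * qb q (2 * (i + 1) + 1))) • toSp q i u s (opH q (sg s) i x) +
      (q ^ (u - 1) / qb q (2 * i + 1)) • toSp q (i - 1) (u - 1) s (opT q (sg s) i x) := by
  rw [opX_toSp hq₀ hq₁]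
  simp [Fin.sum_univ_three, spinArr, spinProd, hopW, dlt, stepB, opFam, fam, ← sub_eq_add_neg]
  match_scalars <;> ring_nf

theorem opX_one_toSp (hq₀ : 0 < q) (hq₁ : q < 1) (i u : ℤ) (s : ℤˣ) (x : Cells) :
    opX q 1 (toSp q i u s x) =
      (qb q (u + 1) * qb q (u + 2) / qb q (2 * (i + 1) + 1)) •
        toSp q (i + 1) (u + 2) s (opC q (sg s) i x) +
      (qb q 2 * q ^ (2 * i + 1 + u) * qb q (u + 1) / (qb q (2 * i + 1) * qb q (2 * (i + 1) + 1))) •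
        toSp q i (u + 1) s (opH q (sg s) i x) +
      (-(q ^ (2 * u + 1) / qb q (2 * i + 1))) • toSp q (i - 1) u s (opT q (sg s) i x) := by
  rw [opX_toSp hq₀ hq₁]
  simp [Fin.sum_univ_three, spinArr, spinProd, hopW, dlt, stepB, opFam, fam, ← sub_eq_add_neg,
    add_assoc]
  match_scalars <;> ring_nf

theorem opX_two_toSp (hq₀ : 0 < q) (hq₁ : q < 1) (i u : ℤ) (s : ℤˣ) (x : Cells) :
    opX q 2 (toSp q i u s x) =
      (-(q ^ (2 * u + 1) * qb q (2 * i + 2 - u) * qb q (2 * i + 3 - u) / qb q (2 * (i + 1) + 1))) •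
        toSp q (i + 1) u s (opC q (sg s) i x) +
      (qb q 2 * q ^ (2 * i + u) * qb q (2 * i + 2 - u) /
        (qb q (2 * i + 1) * qb q (2 * (i + 1) + 1))) •
        toSp q i (u - 1) s (opH q (sg s) i x) +
      (1 / qb q (2 * i + 1)) • toSp q (i - 1) (u - 2) s (opT q (sg s) i x) := by
  rw [opX_toSp hq₀ hq₁]
  simp [Fin.sum_univ_three, spinArr, spinProd, hopW, dlt, stepB, opFam, fam, ← sub_eq_add_neg,
    sub_sub]
  match_scalars <;> ring_nf

theorem clm_mul_apply {E : Type*} [NormedAddCommGroup E] [NormedSpace ℂ E] (S T : E →L[ℂ] E)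
    (x : E) : (S * T) x = S (T x) := rfl

theorem clm_one_apply {E : Type*} [NormedAddCommGroup E] [NormedSpace ℂ E] (x : E) :
    (1 : E →L[ℂ] E) x = x := rfl

/-- Each of the raising, preserving and lowering parts q²-commutes with `opD`, and x₂ does not
affect the factors in (i, u). -/
theorem opX_comm_opY (hq₀ : 0 < q) (hq₁ : q < 1) (g : Fin 3) :
    opX q g * opY q 3 = (q : ℂ) ^ 2 • (opY q 3 * opX q g) := by
  refine toSp_ext hq₀ hq₁ fun i u s x => ?_
  obtain ⟨-, -, h1, h2, h3, -⟩ := op_relations hq₀ hq₁ (sg_sq s) i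
  have hc := stepJ_fam
  have key : ∀ k : Fin 3, opFam q (sg s) (fam k) i (opFam q (sg s) 3 i x) =
      q ^ 2 • opFam q (sg s) 3 (i + dlt k) (opFam q (sg s) (fam k) i x) := by
    intro k
    fin_cases k
    · exact LinearMap.congr_fun h1 x
    · simpa [dlt, opFam, fam] using LinearMap.congr_fun h3 x
    · exact LinearMap.congr_fun h2 x
  have e : (q : ℂ) ^ 2 = ((q ^ 2 : ℝ) : ℂ) := by push_cast; rfl
  rw [smul_apply, clm_mul_apply,
    clm_mul_apply, opY_toSp hq₀ hq₁ (by rfl), opX_toSp hq₀ hq₁, opX_toSp hq₀ hq₁,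
    map_sum, e, coe_smul_sp, Finset.smul_sum]
  refine Finset.sum_congr rfl fun k _ => ?_
  rw [ContinuousLinearMap.map_smul_of_tower, opY_toSp hq₀ hq₁ (by rfl), key, map_smul, smul_comm]

-- After rewriting by `op_relations`, products of two generators are combinations of CC, CH, TH, TT
-- and 1 - DE. Comparing their coefficients leaves identities between rational functions of q^u and
-- q^i.
set_option maxHeartbeats 4000000 in
theorem opX_relations (hq₀ : 0 < q) (hq₁ : q < 1) :
    opX q 0 * opX q 1 = (q : ℂ) ^ 2 • (opX q 1 * opX q 0) ∧
    opX q 0 * opX q 0 + opX q 1 * opX q 2 = 1 - opY q 3 * opY q 4 ∧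
    opX q 2 * opX q 1 - opX q 1 * opX q 2 = (1 - (q : ℂ) ^ 4) • (opX q 0 * opX q 0) := by
  have e₂ : (q : ℂ) ^ 2 = ((q ^ 2 : ℝ) : ℂ) := by push_cast; rfl
  have e₄ : 1 - (q : ℂ) ^ 4 = ((1 - q ^ 4 : ℝ) : ℂ) := by push_cast; rfl
  rw [e₂, e₄]
  refine ⟨?_, ?_, ?_⟩ <;> refine toSp_ext hq₀ hq₁ fun i u s x => ?_
  all_goals
    obtain ⟨hCH, hTH, -, -, -, hTC, hCT, hHH, -⟩ := op_relations hq₀ hq₁ (sg_sq s) i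
    replace hCH := LinearMap.congr_fun hCH x
    replace hTH := LinearMap.congr_fun hTH x
    replace hTC := LinearMap.congr_fun hTC x
    replace hCT := LinearMap.congr_fun hCT x
    replace hHH := LinearMap.congr_fun hHH x
    simp only [LinearMap.comp_apply, LinearMap.sub_apply, Module.End.one_apply]
      at hCH hTH hTC hCT hHH
    have k₁ : u + 2 - 1 = u + 1 := by ring
    have k₂ : u - 1 + 2 = u + 1 := by ring
    have k₃ : u - 1 - 1 = u - 2 := by ring
    have k₄ : u - 2 + 1 = u - 1 := by ring
    have k₅ : u + 1 - 2 = u - 1 := by ring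
    have hY : ∀ f : Fin 5, stepJ f = 0 → ∀ x, opY q f (toSp q i u s x) =
      toSp q i u s (opFam q (sg s) f i x) := fun f hf x => opY_toSp hq₀ hq₁ hf i u s x
    have h3 : opFam q (sg s) 3 = opD q (sg s) := rfl
    have h4 : opFam q (sg s) 4 = opE q (sg s) := rfl
    simp only [smul_apply, add_apply, sub_apply, clm_mul_apply, clm_one_apply,
      opX_zero_toSp hq₀ hq₁, opX_one_toSp hq₀ hq₁, opX_two_toSp hq₀ hq₁, map_add, map_sub,
      ContinuousLinearMap.map_smul_of_tower, ← hCH, ← hTH, hTC, hCT, hHH, add_sub_cancel_right,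
      sub_add_cancel, add_assoc, Int.reduceAdd, k₁, k₂, k₃, k₄, k₅, hY 3 rfl, hY 4 rfl, h3, h4,
      coe_smul_sp]
    -- Two successive steps in j produce denominators at these four indices only.
    have n₀ := qb_odd_ne_zero hq₀ hq₁ (i - 1)
    have n₁ := qb_odd_ne_zero hq₀ hq₁ i
    have n₂ := qb_odd_ne_zero hq₀ hq₁ (i + 1)
    have n₃ := qb_odd_ne_zero hq₀ hq₁ (i + 2)
    generalize d₀ : qb q (2 * (i - 1) + 1) = x₀ at *
    generalize d₁ : qb q (2 * i + 1) = x₁ at *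
    generalize d₂ : qb q (2 * (i + 1) + 1) = x₂ at *
    generalize d₃ : qb q (2 * (i + 2) + 1) = x₃ at *
    have hq := hq₀.ne'
    have hx := zpow_ne_zero u hq
    have hy := zpow_ne_zero i hq
    clear hCH hTH hTC hCT hHH
    match_scalars <;>
      simp only [qb, zpow_add₀ hq, zpow_sub₀ hq, zpow_mul', zpow_ofNat, mul_one] at * <;>
      generalize q ^ u = x at * <;> generalize q ^ i = y at * <;>
      field_simp <;> subst d₀ d₁ d₂ d₃ 
  all_goals first | ring1 | (field_simp; ring1)
theorem opY_relation (hq₀ : 0 < q) (hq₁ : q < 1) : opY q 4 * opY q 3 =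
    (1 - (q : ℂ) ^ 4) • 1 + (q : ℂ) ^ 4 • (opY q 3 * opY q 4) := by
  have e₄ : (q : ℂ) ^ 4 = ((q ^ 4 : ℝ) : ℂ) := by push_cast; rfl
  have e₅ : 1 - (q : ℂ) ^ 4 = ((1 - q ^ 4 : ℝ) : ℂ) := by push_cast; rfl
  rw [e₅, e₄]
  refine toSp_ext hq₀ hq₁ fun i u s x => ?_
  obtain ⟨-, -, -, -, -, -, -, -, h⟩ := op_relations hq₀ hq₁ (sg_sq s) i
  simp only [smul_apply, add_apply, clm_mul_apply, clm_one_apply, coe_smul_sp,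
    opY_toSp hq₀ hq₁ (f := 3) rfl, opY_toSp hq₀ hq₁ (f := 4) rfl]
  rw [← map_smul, ← map_smul, ← map_add]
  exact congrArg _ (LinearMap.congr_fun h x)

/-! ### Adjoints and the defining relations on spinors -/

theorem star_matOp (hq₀ : 0 < q) (hq₁ : q < 1) {f f' : Fin 5} {b : ℤ} {c c' : ℝ → ℝ → ℝ}
    {a : ℤ → ℤ → ℝ} (hc : SpinFactor q f b c a) (d : Fin 3)
    (hf : stepM f' = -stepM f ∧ stepJ f' = -stepJ f)
    (hcc : ∀ j m₁ : ℝ, c' j m₁ = c (j - stepJ f) (m₁ - b))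
    (hr : ∀ l j m₂ σ : ℝ, red q f' d.rev l j m₂ σ =
      red q f d (l - dlt d) (j - stepJ f) (m₂ - stepM f) σ) :
    star (W spinorLabels (arrow f d b) (mat q c f d)) =
      W spinorLabels (arrow f' d.rev (-b)) (mat q c' f' d.rev) := by
  have hd : dlt d.rev = -dlt d := by clear hr; revert d; decide
  have e : (arrow f d b).symm = arrow f' d.rev (-b) := by
    ext t <;> simp [arrow, LabelSpace.translate, hf, hd, sub_eq_add_neg]
  rw [star_W (bddCoef_mat hq₀ hq₁ hc d), ← e]
  congr 1
  funext t s
  rw [mat, mat, hcc, hr]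
  rfl

/-- The tables `red` and `spin` give a reversed arrow the coefficient of the original one at the
shifted label. Summing over the steps in l, with d replaced by `d.rev`, yields the adjoint. -/
theorem star_famOp (hq₀ : 0 < q) (hq₁ : q < 1) {f f' : Fin 5} {b : ℤ} {c c' : ℝ → ℝ → ℝ}
    {a : ℤ → ℤ → ℝ} (hc : SpinFactor q f b c a)
    (hf : stepM f' = -stepM f ∧ stepJ f' = -stepJ f)
    (hcc : ∀ j m₁ : ℝ, c' j m₁ = c (j - stepJ f) (m₁ - b))
    (hr : ∀ d : Fin 3, ∀ l j m₂ σ : ℝ, red q f' d.rev l j m₂ σ =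
      red q f d (l - dlt d) (j - stepJ f) (m₂ - stepM f) σ) :
    star (famOp q f b c) = famOp q f' (-b) c' := by
  rw [famOp, famOp, star_sum]
  conv_rhs => rw [← Equiv.sum_comp Fin.revPerm]
  exact Finset.sum_congr rfl fun d _ => star_matOp hq₀ hq₁ hc d hf hcc (hr d)

theorem red_rev (q : ℝ) (k d : Fin 3) (l j m₂ σ : ℝ) : red q (fam k.rev) d.rev l j m₂ σ =
    red q (fam k) d (l - dlt d) (j - stepJ (fam k)) (m₂ - stepM (fam k)) σ := by
  fin_cases k <;> fin_cases d <;> simp [red, fam, dlt, stepJ, stepM, Fin.rev]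

theorem star_opX (hq₀ : 0 < q) (hq₁ : q < 1) {g g' : Fin 3} (hg : stepB g' = -stepB g)
    (h : ∀ (k : Fin 3) (j m₁ : ℝ), spin q g' k.rev j m₁ = spin q g k (j - dlt k) (m₁ - stepB g)) :
    star (opX q g) = opX q g' := by
  rw [opX, opX, star_sum]
  conv_rhs => rw [← Equiv.sum_comp Fin.revPerm]
  refine Finset.sum_congr rfl fun k _ => ?_
  rw [hg]
  refine star_famOp hq₀ hq₁ (spinFactor_spin hq₀ hq₁ g k) ?_ ?_ (red_rev q k)
  · revert k; decide
  · simpa only [stepJ_fam, Fin.revPerm_apply] using h k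

theorem star_opX_zero (hq₀ : 0 < q) (hq₁ : q < 1) : star (opX q 0) = opX q 0 := by
  refine star_opX hq₀ hq₁ rfl fun k j m => ?_
  fin_cases k <;> simp [spin, dlt, stepB, Fin.rev]

theorem star_opX_one (hq₀ : 0 < q) (hq₁ : q < 1) : star (opX q 1) = opX q 2 := by
  refine star_opX hq₀ hq₁ rfl fun k j m => ?_
  fin_cases k <;> simp [spin, dlt, stepB, Fin.rev]

theorem star_opY (hq₀ : 0 < q) (hq₁ : q < 1) : star (opY q 3) = opY q 4 := by
  refine star_famOp hq₀ hq₁ (spinFactor_one rfl) (by decide) (fun _ _ => rfl) fun d l j m σ => ?_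
  fin_cases d <;> simp [red, dlt, stepJ, stepM, Fin.rev]

/-- The operators of the generators. -/
def opGen (q : ℝ) : Fin 3 → Sp spinorLabels →L[ℂ] Sp spinorLabels :=
  ![opX q 0, opX q 1, opY q 3]

theorem opGen_rel (hq₀ : 0 < q) (hq₁ : q < 1) (a b : FreeStarAlg (Fin 3)) (h : Sphere4Rel q a b) :
    FreeStarAlg.lift (opGen q) a = FreeStarAlg.lift (opGen q) b := by
  have hg : ∀ i, FreeStarAlg.lift (opGen q) (.gen i) = opGen q i := FreeStarAlg.lift_gen _
  have g0 : opGen q 0 = opX q 0 := rfl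
  have g1 : opGen q 1 = opX q 1 := rfl
  have g2 : opGen q 2 = opY q 3 := rfl
  obtain ⟨r1, r2, r3⟩ := opX_relations hq₀ hq₁
  have r4 := opX_comm_opY hq₀ hq₁
  have r5 := opY_relation hq₀ hq₁
  have s0 := star_opX_zero hq₀ hq₁
  have s1 := star_opX_one hq₀ hq₁
  have s2 := star_opY hq₀ hq₁
  -- The relations with x_i^* on the left and i > k are the adjoints of those already proved.
  have a1 := congrArg star r1
  have a2 := congrArg star (r4 0)
  have a3 := congrArg star (r4 2)
  have s1' : star (opX q 2) = opX q 1 := by rw [← s1, star_star]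
  simp only [star_mul, star_smul, s0, s1, s2, s1', star_pow, Complex.star_def,
    Complex.conj_ofReal] at a1 a2 a3
  cases h with
  | selfadj => rw [map_star, hg, g0, s0]
  | comm i k hik =>
    have : (i = 0 ∧ k = 1) ∨ (i = 0 ∧ k = 2) ∨ (i = 1 ∧ k = 2) := by omega
    rcases this with ⟨rfl, rfl⟩ | ⟨rfl, rfl⟩ | ⟨rfl, rfl⟩ <;>
      simp only [map_mul, map_smul, hg, g0, g1, g2]
    exacts [r1, r4 0, r4 1]
  | comm_star i k hik =>
    have : (i = 0 ∧ k = 1) ∨ (i = 0 ∧ k = 2) ∨ (i = 1 ∧ k = 2) ∨ (i = 1 ∧ k = 0) ∨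
      (i = 2 ∧ k = 0) ∨ (i = 2 ∧ k = 1) := by omega
    rcases this with ⟨rfl, rfl⟩ | ⟨rfl, rfl⟩ | ⟨rfl, rfl⟩ | ⟨rfl, rfl⟩ | ⟨rfl, rfl⟩ | ⟨rfl, rfl⟩ <;>
      simp only [map_mul, map_smul, map_star, hg, g0, g1, g2, s0, s1, s2]
    exacts [r1, r4 0, r4 2, a1, a2, a3]
  | bracket₁ =>
    simp only [map_mul, map_sub, map_smul, map_star, map_pow, hg, g0, g1, s1, pow_two (opX q 0), r3]
  | bracket₂ =>
    simp only [map_mul, map_sub, map_smul, map_star, hg, g1, g2, s1, s2]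
    -- With the first bracket, x₁^*x₁ - q⁴x₁x₁^* equals (1 - q⁴)(x₀² + x₁x₁^*), that is (1 - q⁴)(1 -
    -- x₂x₂^*), which is also x₂^*x₂ - x₂x₂^*.
    have r2' : opX q 0 * opX q 0 = 1 - opY q 3 * opY q 4 - opX q 1 * opX q 2 := by
      rw [← r2]; abel
    have r3' : opX q 2 * opX q 1 = opX q 1 * opX q 2 +
      (1 - (q : ℂ) ^ 4) • (opX q 0 * opX q 0) := by rw [← r3]; abel
    rw [r5, r3', r2']
    module
  | radius =>
    simp only [map_mul, map_add, map_one, map_star, map_pow, hg, g0, g1, g2, s1, s2,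
      pow_two (opX q 0), r2]
    abel

/-- The spinor representation. -/
def spinorRep (hq₀ : 0 < q) (hq₁ : q < 1) : Sphere4Alg q →⋆ₐ[ℂ] (SpinorSpace →L[ℂ] SpinorSpace) :=
  StarPresented.lift (opGen q) (opGen_rel hq₀ hq₁)

theorem spinorRep_sphx (hq₀ : 0 < q) (hq₁ : q < 1) (i : Fin 3) :
    spinorRep hq₀ hq₁ (sphx q i) = opGen q i :=
  StarPresented.lift_gen _ _ _

theorem ket_eq_vec (l m₁ m₂ j : ℝ) (s : ℤˣ) :
    ket l m₁ m₂ j s = vec spinorLabels ⟨l, m₁, m₂, j⟩ s := rfl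

theorem famOp_vec (hq₀ : 0 < q) (hq₁ : q < 1) {f : Fin 5} {b : ℤ} {c : ℝ → ℝ → ℝ}
    {a : ℤ → ℤ → ℝ} (hc : SpinFactor q f b c a) {t : Label} (ht : t ∈ spinorLabels) (s : ℤˣ) :
    famOp q f b c (vec spinorLabels t s) =
      ∑ d, (mat q c f d t s : ℂ) • vec spinorLabels (arrow f d b t) s := by
  rw [famOp, sum_apply]
  exact Finset.sum_congr rfl fun d _ => W_vec (bddCoef_mat hq₀ hq₁ hc d) ht s

theorem opX_vec (hq₀ : 0 < q) (hq₁ : q < 1) (g : Fin 3) {t : Label} (ht : t ∈ spinorLabels)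
    (s : ℤˣ) : opX q g (vec spinorLabels t s) = ∑ k, ∑ d,
      (mat q (spin q g k) (fam k) d t s : ℂ) •
        vec spinorLabels (arrow (fam k) d (stepB g) t) s := by
  rw [opX, sum_apply]
  exact Finset.sum_congr rfl fun k _ => famOp_vec hq₀ hq₁ (spinFactor_spin hq₀ hq₁ g k) ht s

theorem isSpinorRep_spinorRep (hq₀ : 0 < q) (hq₁ : q < 1) :
    IsSpinorRep q (spinorRep hq₀ hq₁) := by
  refine ⟨fun t ht s => ?_, fun t ht s => ?_, fun t ht s => ?_⟩
  · rw [spinorRep_sphx, ket_eq_vec]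
    refine (opX_vec hq₀ hq₁ 0 ht s).trans ?_
    simp only [Fin.sum_univ_three, x0Ket, ket_eq_vec, arrow, LabelSpace.translate, Equiv.coe_fn_mk,
      mat, spin, red, sg, fam, stepB, stepM, stepJ, dlt]
    simp [← sub_eq_add_neg]
    module
  · rw [spinorRep_sphx, ket_eq_vec]
    refine (opX_vec hq₀ hq₁ 1 ht s).trans ?_
    simp only [Fin.sum_univ_three, x1Ket, ket_eq_vec, arrow, LabelSpace.translate, Equiv.coe_fn_mk,
      mat, spin, red, sg, fam, stepB, stepM, stepJ, dlt]
    simp [← sub_eq_add_neg]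
    module
  · rw [spinorRep_sphx, ket_eq_vec]
    refine (famOp_vec hq₀ hq₁ (spinFactor_one (f := 3) rfl) ht s).trans ?_
    simp only [Fin.sum_univ_three, x2Ket, ket_eq_vec, arrow, LabelSpace.translate, Equiv.coe_fn_mk,
      mat, red, sg, stepM, stepJ, dlt]
    simp [← sub_eq_add_neg]

theorem starHom_ext {Y C : Type} {r : FreeStarAlg Y → FreeStarAlg Y → Prop} [Ring C] [Algebra ℂ C]
    [StarRing C] {φ ψ : StarPresented r →⋆ₐ[ℂ] C}
    (h : ∀ y, φ (StarPresented.gen r y) = ψ (StarPresented.gen r y)) : φ = ψ := by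
  ext x
  obtain ⟨a, rfl⟩ := StarPresented.mkAlg_surjective x
  induction a using FreeStarAlg.induction with
  | h_scalar c => rw [AlgHom.commutes]; exact (φ.commutes c).trans (ψ.commutes c).symm
  | h_gen p =>
    rcases p with ⟨y, _ | _⟩
    · exact h y
    · have e : FreeStarAlg.letter (y, true) = star (FreeStarAlg.gen y) :=
        (FreeStarAlg.star_letter (y, false)).symm
      rw [e, StarPresented.mkAlg_star, map_star, map_star]
      exact congrArg star (h y)
  | h_mul a b ha hb => rw [map_mul, map_mul, map_mul, ha, hb]
  | h_add a b ha hb => rw [map_add, map_add, map_add, ha, hb]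

theorem IsSpinorRep.unique {ρ ρ' : Sphere4Alg q →⋆ₐ[ℂ] (SpinorSpace →L[ℂ] SpinorSpace)}
    (h : IsSpinorRep q ρ) (h' : IsSpinorRep q ρ') : ρ = ρ' := by
  refine starHom_ext fun y => clm_ext (F := SpinorSpace) fun t ht s => ?_
  fin_cases y
  · exact (h.x0 t ht s).trans (h'.x0 t ht s).symm
  · exact (h.x1 t ht s).trans (h'.x1 t ht s).symm
  · exact (h.x2 t ht s).trans (h'.x2 t ht s).symm

end Reduced

/-! ### Products of weighted shifts -/

namespace LabelSpace

variable {I : Set Label} {σ τ : Equiv.Perm Label} {c d : Label → ℤˣ → ℝ}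

/-- If the intermediate label left the index set, truncation would spoil the product formula; this
is harmless exactly when the first coefficient vanishes there. -/
theorem W_W_vec (hc : BddCoef I σ c) (hd : BddCoef I τ d) {t : Label} (ht : t ∈ I) (s : ℤˣ)
    (h : τ t ∈ I ∨ d t s = 0) :
    (W I σ c * W I τ d) (vec I t s) = ((d t s * c (τ t) s : ℝ) : ℂ) • vec I (σ (τ t)) s := by
  rw [Reduced.clm_mul_apply, W_vec hd ht, map_smul]
  by_cases h' : τ t ∈ I
  · rw [W_vec hc h', smul_smul]; push_cast; rfl
  · rw [h.resolve_left h']; simp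

theorem W_comm (hc : BddCoef I σ c) (hd : BddCoef I τ d)
    (h : ∀ t ∈ I, ∀ s, (τ t ∈ I ∨ d t s = 0) ∧ (σ t ∈ I ∨ c t s = 0)) {k : ℝ}
    (hστ : ∀ t, σ (τ t) = τ (σ t))
    (hcd : ∀ t ∈ I, ∀ s, d t s * c (τ t) s = k * (c t s * d (σ t) s)) :
    W I σ c * W I τ d = (k : ℂ) • (W I τ d * W I σ c) := by
  refine clm_ext fun t ht s => ?_
  rw [smul_apply, W_W_vec hc hd ht s (h t ht s).1, W_W_vec hd hc ht s (h t ht s).2,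
    hcd t ht s, hστ, smul_smul]
  push_cast
  rfl

theorem clm_eq_one {T : Sp I →L[ℂ] Sp I} (h : ∀ t ∈ I, ∀ s, T (vec I t s) = vec I t s) : T = 1 :=
  clm_ext h

end LabelSpace

/-! ### The representation on the larger space -/

namespace Hat

open LabelSpace

variable {q : ℝ}

/-- The hypothesis on `star z` covers the letters y^*: the adjoint of a relation between y and z^*
is one between y^* and z. -/
theorem commute_of_gen {Y C : Type} {r : FreeStarAlg Y → FreeStarAlg Y → Prop} [Ring C]
    [Algebra ℂ C] [StarRing C] (φ : StarPresented r →⋆ₐ[ℂ] C) {z : C}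
    (h : ∀ y, Commute (φ (StarPresented.gen r y)) z)
    (h' : ∀ y, Commute (φ (StarPresented.gen r y)) (star z)) (x : StarPresented r) :
    Commute (φ x) z := by
  obtain ⟨a, rfl⟩ := StarPresented.mkAlg_surjective x
  induction a using FreeStarAlg.induction with
  | h_scalar c =>
    rw [AlgHom.commutes]
    exact (φ.commutes c).symm ▸ Algebra.commutes c z
  | h_gen p =>
    rcases p with ⟨y, _ | _⟩
    · exact h y
    · have e : FreeStarAlg.letter (y, true) = star (FreeStarAlg.gen y) :=
        (FreeStarAlg.star_letter (y, false)).symm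
      rw [e, StarPresented.mkAlg_star, map_star, ← star_star z]
      exact (h' y).star_star
  | h_mul a b ha hb => rw [map_mul, map_mul]; exact ha.mul_left hb
  | h_add a b ha hb => rw [map_add, map_add]; exact ha.add_left hb

/-- `q^{j + m₁}`. -/
def wtU (q : ℝ) (t : Label) : ℝ := q ^ (t.j + t.m₁)

/-- `q^{l - j + m₂ - ε}`. -/
def wtA (q : ℝ) (t : Label) : ℝ := q ^ (t.l - t.j + t.m₂ - eps t.l t.j t.m₂)

/-- The shifts of labels of `α`, `β`, `B`. -/
def shα : Equiv.Perm Label := LabelSpace.translate (1 / 2) (1 / 2) 0 (1 / 2)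
def shβ : Equiv.Perm Label := LabelSpace.translate (1 / 2) (-(1 / 2)) 0 (1 / 2)
def shB : Equiv.Perm Label := LabelSpace.translate 1 0 1 0

/-- The matrix elements of `α` and `B`. -/
def cα (q : ℝ) (t : Label) (_ : ℤˣ) : ℝ := √(1 - (q * wtU q t) ^ 2)
def cB (q : ℝ) (t : Label) (_ : ℤˣ) : ℝ := √(1 - (q ^ 2 * wtA q t) ^ 2)

theorem wtU_α (hq₀ : 0 < q) (t : Label) : wtU q (shα t) = q * wtU q t := by
  rw [wtU, wtU, mul_comm, ← Real.rpow_add_one hq₀.ne']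
  congr 1; simp [shα, LabelSpace.translate]; ring

theorem wtU_β (t : Label) : wtU q (shβ t) = wtU q t := by
  rw [wtU, wtU]
  congr 1; simp [shβ, LabelSpace.translate]; ring

theorem wtU_B (t : Label) : wtU q (shB t) = wtU q t := by
  rw [wtU, wtU]
  congr 1; simp [shB, LabelSpace.translate]

/-- ε depends only on l - j - m₂, which the shifts of α, β and B all preserve. -/
theorem eps_congr {l j m₂ l' j' m₂' : ℝ} (h : l - j - m₂ = l' - j' - m₂') :
    eps l j m₂ = eps l' j' m₂' := by
  unfold eps
  rw [show l + 1 / 2 - j - m₂ = l' + 1 / 2 - j' - m₂' by linarith]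

theorem wtA_α (t : Label) : wtA q (shα t) = wtA q t := by
  rw [wtA, wtA, eps_congr (l' := t.l) (j' := t.j) (m₂' := t.m₂)]
  · congr 1; simp [shα, LabelSpace.translate]
  · simp [shα, LabelSpace.translate]

theorem wtA_β (t : Label) : wtA q (shβ t) = wtA q t := by
  rw [wtA, wtA, eps_congr (l' := t.l) (j' := t.j) (m₂' := t.m₂)]
  · congr 1; simp [shβ, LabelSpace.translate]
  · simp [shβ, LabelSpace.translate]

theorem wtA_B (hq₀ : 0 < q) (t : Label) : wtA q (shB t) = q ^ 2 * wtA q t := by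
  rw [wtA, wtA, eps_congr (l' := t.l) (j' := t.j) (m₂' := t.m₂), mul_comm, ← Real.rpow_natCast q 2,
    ← Real.rpow_add hq₀]
  · congr 1; simp [shB, LabelSpace.translate]; ring
  · simp [shB, LabelSpace.translate]; ring

theorem wtU_α_symm (hq₀ : 0 < q) (t : Label) : q * wtU q (shα.symm t) = wtU q t := by
  rw [← wtU_α hq₀, Equiv.apply_symm_apply]

theorem wtU_β_symm (t : Label) : wtU q (shβ.symm t) = wtU q t := by
  rw [← wtU_β, Equiv.apply_symm_apply]

theorem wtU_B_symm (t : Label) : wtU q (shB.symm t) = wtU q t := by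
  rw [← wtU_B, Equiv.apply_symm_apply]

theorem wtA_B_symm (hq₀ : 0 < q) (t : Label) : q ^ 2 * wtA q (shB.symm t) = wtA q t := by
  rw [← wtA_B hq₀, Equiv.apply_symm_apply]

/-- The index set is cut out by m = l + 1/2 - j + m₂ ≥ 0 and j + m₁ ≥ 0. Since ε records the parity
of m, subtracting it rounds m down to the even number 2N; so A is diagonal with entries q^{2N}. -/
theorem hat_coord {t : Label} (ht : t ∈ hatLabels) : ∃ n N : ℕ, t.j + t.m₁ = n ∧
    t.l - t.j + t.m₂ - eps t.l t.j t.m₂ = 2 * N ∧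
      (t.l + 1 / 2 - t.j + t.m₂ = 2 * N ∨ t.l + 1 / 2 - t.j + t.m₂ = 2 * N + 1) := by
  obtain ⟨⟨a, ha⟩, ⟨b, hb⟩, ⟨n, hn⟩, ⟨m, hm⟩⟩ := ht
  have key : t.l + 1 / 2 - t.j - t.m₂ = -m + 2 * (a - b) + 1 := by linarith
  rcases Nat.even_or_odd' m with ⟨N, rfl | rfl⟩
  · refine ⟨n, N, hn, ?_, Or.inl (by rw [hm]; push_cast; ring)⟩
    have he : eps t.l t.j t.m₂ = -(1 / 2) := by
      rw [eps, if_neg]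
      rintro ⟨k, hk⟩
      rw [key] at hk
      have : (-(2 * N : ℕ) + 2 * (a - b) + 1 : ℤ) = 2 * k := by exact_mod_cast hk
      omega
    rw [he]; push_cast at hm; linarith
  · refine ⟨n, N, hn, ?_, Or.inr (by rw [hm]; push_cast; ring)⟩
    have he : eps t.l t.j t.m₂ = 1 / 2 := by
      rw [eps, if_pos]
      exact ⟨-N + a - b, by rw [key]; push_cast; ring⟩
    rw [he]; push_cast at hm; linarith

theorem wtU_mem (hq₀ : 0 < q) (hq₁ : q < 1) {t : Label} (ht : t ∈ hatLabels) :
    0 ≤ wtU q t ∧ wtU q t ≤ 1 := by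
  obtain ⟨n, N, hn, -⟩ := hat_coord ht
  rw [wtU, hn, Real.rpow_natCast]
  exact ⟨by positivity, pow_le_one₀ hq₀.le hq₁.le⟩

theorem wtA_mem (hq₀ : 0 < q) (hq₁ : q < 1) {t : Label} (ht : t ∈ hatLabels) :
    0 ≤ wtA q t ∧ wtA q t ≤ 1 := by
  obtain ⟨n, N, -, hN, -⟩ := hat_coord ht
  rw [wtA, hN, show (2 * N : ℝ) = ((2 * N : ℕ) : ℝ) by push_cast; rfl, Real.rpow_natCast]
  exact ⟨by positivity, pow_le_one₀ hq₀.le hq₁.le⟩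

theorem mem_α {t : Label} (ht : t ∈ hatLabels) : shα t ∈ hatLabels := by
  obtain ⟨⟨a, ha⟩, ⟨b, hb⟩, ⟨n, hn⟩, ⟨m, hm⟩⟩ := ht
  refine ⟨⟨a + 1, ?_⟩, ⟨b + 1, ?_⟩, ⟨n + 1, ?_⟩, ⟨m, ?_⟩⟩ <;>
    simp only [shα, LabelSpace.translate, Equiv.coe_fn_mk] <;> push_cast <;> linarith

theorem mem_β {t : Label} (ht : t ∈ hatLabels) : shβ t ∈ hatLabels := by
  obtain ⟨⟨a, ha⟩, ⟨b, hb⟩, ⟨n, hn⟩, ⟨m, hm⟩⟩ := ht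
  refine ⟨⟨a + 1, ?_⟩, ⟨b + 1, ?_⟩, ⟨n, ?_⟩, ⟨m, ?_⟩⟩ <;>
    simp only [shβ, LabelSpace.translate, Equiv.coe_fn_mk] <;> push_cast <;> linarith

theorem mem_β_symm {t : Label} (ht : t ∈ hatLabels) : shβ.symm t ∈ hatLabels := by
  obtain ⟨⟨a, ha⟩, ⟨b, hb⟩, ⟨n, hn⟩, ⟨m, hm⟩⟩ := ht
  refine ⟨⟨a - 1, ?_⟩, ⟨b - 1, ?_⟩, ⟨n, ?_⟩, ⟨m, ?_⟩⟩ <;>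
    simp only [shβ, LabelSpace.translate, Equiv.coe_fn_symm_mk] <;> push_cast <;> linarith

theorem mem_B {t : Label} (ht : t ∈ hatLabels) : shB t ∈ hatLabels := by
  obtain ⟨⟨a, ha⟩, ⟨b, hb⟩, ⟨n, hn⟩, ⟨m, hm⟩⟩ := ht
  refine ⟨⟨a + 2, ?_⟩, ⟨b + 1, ?_⟩, ⟨n, ?_⟩, ⟨m + 2, ?_⟩⟩ <;>
    simp only [shB, LabelSpace.translate, Equiv.coe_fn_mk] <;> push_cast <;> linarith

/-- Lowering fails only at j + m₁ = 0, where the coefficient is √(1 - 1). So the relations hold at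
the boundary too. -/
theorem mem_α_symm (hq₀ : 0 < q) {t : Label} (ht : t ∈ hatLabels) (s : ℤˣ) :
    shα.symm t ∈ hatLabels ∨ cα q (shα.symm t) s = 0 := by
  obtain ⟨⟨a, ha⟩, ⟨b, hb⟩, ⟨n, hn⟩, ⟨m, hm⟩⟩ := ht
  rcases n with - | n
  · right
    rw [cα, wtU_α_symm hq₀, wtU, hn]
    simp
  · left
    refine ⟨⟨a - 1, ?_⟩, ⟨b - 1, ?_⟩, ⟨n, ?_⟩, ⟨m, ?_⟩⟩ <;>
      simp only [shα, LabelSpace.translate, Equiv.coe_fn_symm_mk] <;> push_cast at * <;> linarith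

theorem mem_B_symm (hq₀ : 0 < q) {t : Label} (ht : t ∈ hatLabels) (s : ℤˣ) :
    shB.symm t ∈ hatLabels ∨ cB q (shB.symm t) s = 0 := by
  obtain ⟨-, N, -, hN, hm⟩ := hat_coord ht
  obtain ⟨⟨a, ha⟩, ⟨b, hb⟩, ⟨n, hn⟩, -⟩ := ht
  rcases N with - | N
  · right
    rw [cB, wtA_B_symm hq₀, wtA, hN]
    simp
  · left
    -- The shift of B^* lowers m by 2, which is possible as soon as N ≥ 1.
    have : ∃ m : ℕ, t.l + 1 / 2 - t.j + t.m₂ = m + 2 := by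
      rcases hm with hm | hm
      · exact ⟨2 * N, by rw [hm]; push_cast; ring⟩
      · exact ⟨2 * N + 1, by rw [hm]; push_cast; ring⟩
    obtain ⟨m, hm⟩ := this
    refine ⟨⟨a - 2, ?_⟩, ⟨b - 1, ?_⟩, ⟨n, ?_⟩, ⟨m, ?_⟩⟩ <;>
      simp only [shB, LabelSpace.translate, Equiv.coe_fn_symm_mk] <;> push_cast <;> linarith

theorem abs_sqrt_one_sub_le (x : ℝ) : |√(1 - x ^ 2)| ≤ 1 := by
  rw [abs_of_nonneg (Real.sqrt_nonneg _)]
  exact Real.sqrt_le_one.2 (by nlinarith [sq_nonneg x])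

theorem bdd_α (q : ℝ) : BddCoef hatLabels shα (cα q) :=
  ⟨1, zero_le_one, fun _ _ _ _ => abs_sqrt_one_sub_le _⟩

theorem bdd_B (q : ℝ) : BddCoef hatLabels shB (cB q) :=
  ⟨1, zero_le_one, fun _ _ _ _ => abs_sqrt_one_sub_le _⟩

theorem bdd_β (hq₀ : 0 < q) (hq₁ : q < 1) : BddCoef hatLabels shβ (fun t _ => wtU q t) :=
  ⟨1, zero_le_one, fun t ht _ _ => by
    obtain ⟨h, h'⟩ := wtU_mem hq₀ hq₁ ht; rwa [abs_of_nonneg h]⟩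

theorem bdd_A (hq₀ : 0 < q) (hq₁ : q < 1) : 
    BddCoef hatLabels (1 : Equiv.Perm Label) (fun t _ => wtA q t) :=
  ⟨1, zero_le_one, fun t ht _ _ => by
    obtain ⟨h, h'⟩ := wtA_mem hq₀ hq₁ ht; rwa [abs_of_nonneg h]⟩

/-- The operators of `α`, `β`, `A`, `B`. -/
def hatα (q : ℝ) : Sp hatLabels →L[ℂ] Sp hatLabels := W hatLabels shα (cα q)
def hatβ (q : ℝ) : Sp hatLabels →L[ℂ] Sp hatLabels := W hatLabels shβ fun t _ => wtU q t
def hatA (q : ℝ) : Sp hatLabels →L[ℂ] Sp hatLabels := W hatLabels 1 fun t _ => wtA q t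
def hatB (q : ℝ) : Sp hatLabels →L[ℂ] Sp hatLabels := W hatLabels shB (cB q)

theorem star_α (q : ℝ) : star (hatα q) = W hatLabels shα.symm (fun t => cα q (shα.symm t)) :=
  star_W (bdd_α q)

theorem star_β (hq₀ : 0 < q) (hq₁ : q < 1) :
    star (hatβ q) = W hatLabels shβ.symm (fun t _ => wtU q (shβ.symm t)) :=
  star_W (bdd_β hq₀ hq₁)

theorem star_A (hq₀ : 0 < q) (hq₁ : q < 1) : star (hatA q) = hatA q :=
  star_W (bdd_A hq₀ hq₁)

theorem star_B (q : ℝ) : star (hatB q) = W hatLabels shB.symm (fun t => cB q (shB.symm t)) :=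
  star_W (bdd_B q)

theorem shβ_shα (t : Label) : shβ (shα t) = shα (shβ t) := by
  ext <;> simp [shα, shβ, LabelSpace.translate]

theorem symm_comm {σ τ : Equiv.Perm Label} (h : ∀ t, σ (τ t) = τ (σ t)) (t : Label) :
    σ.symm (τ t) = τ (σ.symm t) := by
  rw [Equiv.symm_apply_eq, h, Equiv.apply_symm_apply]

theorem shβ_shB (t : Label) : shβ (shB t) = shB (shβ t) := by
  ext <;> simp [shB, shβ, LabelSpace.translate]; ring

theorem shα_shB (t : Label) : shα (shB t) = shB (shα t) := by
  ext <;> simp [shB, shα, LabelSpace.translate]; ring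

/-- The operators of `α`, `β`. -/
def suGen (q : ℝ) : Fin 2 → Sp hatLabels →L[ℂ] Sp hatLabels := ![hatα q, hatβ q]

/-- The operators of `A`, `B`. -/
def podGen (q : ℝ) : Fin 2 → Sp hatLabels →L[ℂ] Sp hatLabels := ![hatA q, hatB q]

theorem sqrt_mul_sqrt {x : ℝ} (hx : 0 ≤ x ∧ x ≤ 1) : √(1 - x ^ 2) * √(1 - x ^ 2) = 1 - x ^ 2 :=
  Real.mul_self_sqrt (by nlinarith [hx.1, hx.2])

theorem suGen_rel (hq₀ : 0 < q) (hq₁ : q < 1) (a b : FreeStarAlg (Fin 2)) (h : SURel q a b) :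
    FreeStarAlg.lift (suGen q) a = FreeStarAlg.lift (suGen q) b := by
  have hg : ∀ i, FreeStarAlg.lift (suGen q) (.gen i) = suGen q i := FreeStarAlg.lift_gen _
  have g0 : suGen q 0 = hatα q := rfl
  have g1 : suGen q 1 = hatβ q := rfl
  cases h with
  | βα =>
    simp only [map_mul, map_smul, hg, g0, g1]
    refine W_comm (bdd_β hq₀ hq₁) (bdd_α q)
      (fun t ht s => ⟨.inl (mem_α ht), .inl (mem_β ht)⟩) shβ_shα fun t ht s => ?_
    rw [wtU_α hq₀, cα, cα, wtU_β]; ring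
  | βsα =>
    simp only [map_mul, map_smul, map_star, hg, g0, g1, star_β hq₀ hq₁]
    refine W_comm (bdd_β hq₀ hq₁).symm (bdd_α q)
      (fun t ht s => ⟨.inl (mem_α ht), .inl (mem_β_symm ht)⟩) (symm_comm shβ_shα) fun t ht s => ?_
    rw [wtU_β_symm, wtU_β_symm, wtU_α hq₀, cα, cα, wtU_β_symm]; ring
  | normal =>
    simp only [map_mul, map_star, hg, g1, star_β hq₀ hq₁]
    refine clm_ext fun t ht s => ?_
    rw [hatβ, W_W_vec (bdd_β hq₀ hq₁) (bdd_β hq₀ hq₁).symm ht s (.inl (mem_β_symm ht)),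
      W_W_vec (bdd_β hq₀ hq₁).symm (bdd_β hq₀ hq₁) ht s (.inl (mem_β ht))]
    simp [wtU_β_symm]
  | unit =>
    simp only [map_mul, map_add, map_one, map_star, hg, g0, g1, star_β hq₀ hq₁, star_α]
    refine clm_eq_one fun t ht s => ?_
    rw [hatβ, hatα, add_apply, W_W_vec (bdd_β hq₀ hq₁) (bdd_β hq₀ hq₁).symm ht s
      (.inl (mem_β_symm ht)), W_W_vec (bdd_α q) (bdd_α q).symm ht s (mem_α_symm hq₀ ht s)]
    rw [cα, wtU_α_symm hq₀, wtU_β_symm, Equiv.apply_symm_apply, Equiv.apply_symm_apply,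
      ← add_smul, ← Complex.ofReal_add, sqrt_mul_sqrt (wtU_mem hq₀ hq₁ ht)]
    simp [← pow_two]
  | unit' =>
    simp only [map_mul, map_add, map_one, map_smul, map_star, hg, g0, g1, star_β hq₀ hq₁, star_α]
    refine clm_eq_one fun t ht s => ?_
    rw [hatβ, hatα, add_apply, smul_apply, W_W_vec (bdd_β hq₀ hq₁).symm (bdd_β hq₀ hq₁) ht s
      (.inl (mem_β ht)), W_W_vec (bdd_α q).symm (bdd_α q) ht s (.inl (mem_α ht))]
    -- The radicand is 1 minus the square of the weight of the raised label, which lies in [0, 1],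
    -- so squaring the root gives it back.
    rw [Equiv.symm_apply_apply, Equiv.symm_apply_apply, cα, ← wtU_α hq₀,
      sqrt_mul_sqrt (wtU_mem hq₀ hq₁ (mem_α ht)),
      smul_smul, ← add_smul, wtU_α hq₀]
    convert one_smul ℂ _
    push_cast; ring

theorem podGen_rel (hq₀ : 0 < q) (hq₁ : q < 1) (a b : FreeStarAlg (Fin 2)) (h : PodlesRel q a b) :
    FreeStarAlg.lift (podGen q) a = FreeStarAlg.lift (podGen q) b := by
  have hg : ∀ i, FreeStarAlg.lift (podGen q) (.gen i) = podGen q i := FreeStarAlg.lift_gen _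
  have g0 : podGen q 0 = hatA q := rfl
  have g1 : podGen q 1 = hatB q := rfl
  cases h with
  | selfadj => rw [map_star, hg, g0, star_A hq₀ hq₁]
  | AB =>
    simp only [map_mul, map_smul, hg, g0, g1]
    rw [show (q : ℂ) ^ 2 = ((q ^ 2 : ℝ) : ℂ) by push_cast; rfl]
    refine W_comm (bdd_A hq₀ hq₁) (bdd_B q)
      (fun t ht s => ⟨.inl (mem_B ht), .inl ht⟩) (fun _ => rfl) fun t ht s => ?_
    rw [wtA_B hq₀]; simp only [Equiv.Perm.one_apply]; ring
  | unit =>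
    simp only [map_mul, map_add, map_one, map_pow, map_star, hg, g0, g1, star_B]
    refine clm_eq_one fun t ht s => ?_
    rw [hatB, hatA, add_apply, W_W_vec (bdd_B q) (bdd_B q).symm ht s (mem_B_symm hq₀ ht s),
      pow_two, W_W_vec (bdd_A hq₀ hq₁) (bdd_A hq₀ hq₁) ht s (.inl ht)]
    rw [cB, wtA_B_symm hq₀, Equiv.apply_symm_apply, sqrt_mul_sqrt (wtA_mem hq₀ hq₁ ht)]
    simp only [Equiv.Perm.one_apply]
    rw [← add_smul]
    convert one_smul ℂ _
    push_cast; ring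
  | unit' =>
    simp only [map_mul, map_add, map_one, map_pow, map_smul, map_star, hg, g0, g1, star_B]
    refine clm_eq_one fun t ht s => ?_
    rw [hatB, hatA, add_apply, smul_apply, W_W_vec (bdd_B q).symm (bdd_B q) ht s (.inl (mem_B ht)),
      pow_two (W hatLabels 1 _), W_W_vec (bdd_A hq₀ hq₁) (bdd_A hq₀ hq₁) ht s (.inl ht)]
    rw [Equiv.symm_apply_apply, cB, ← wtA_B hq₀,
      sqrt_mul_sqrt (wtA_mem hq₀ hq₁ (mem_B ht)), wtA_B hq₀]
    simp only [Equiv.Perm.one_apply]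
    rw [smul_smul, ← add_smul]
    convert one_smul ℂ _
    push_cast; ring

/-- The representations of `A(SU_q(2))` and `A(S²_q)`. -/
def suRep (hq₀ : 0 < q) (hq₁ : q < 1) : SUAlg q →⋆ₐ[ℂ] (HatSpace →L[ℂ] HatSpace) :=
  StarPresented.lift (suGen q) (suGen_rel hq₀ hq₁)

def podRep (hq₀ : 0 < q) (hq₁ : q < 1) : PodlesAlg q →⋆ₐ[ℂ] (HatSpace →L[ℂ] HatSpace) :=
  StarPresented.lift (podGen q) (podGen_rel hq₀ hq₁)

theorem suRep_gen (hq₀ : 0 < q) (hq₁ : q < 1) (i : Fin 2) :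
    suRep hq₀ hq₁ (StarPresented.gen (SURel q) i) = suGen q i :=
  StarPresented.lift_gen _ _ _

theorem podRep_gen (hq₀ : 0 < q) (hq₁ : q < 1) (i : Fin 2) :
    podRep hq₀ hq₁ (StarPresented.gen (PodlesRel q) i) = podGen q i :=
  StarPresented.lift_gen _ _ _

theorem commute_gen (hq₀ : 0 < q) (hq₁ : q < 1) (i k : Fin 2) :
    Commute (suGen q i) (podGen q k) ∧ Commute (suGen q i) (star (podGen q k)) := by
  have one : ∀ S T : Sp hatLabels →L[ℂ] Sp hatLabels, S * T = ((1 : ℝ) : ℂ) • (T * S) →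
    Commute S T := fun S T h => (by simpa using h : S * T = T * S)
  fin_cases i <;> fin_cases k
  · change Commute (hatα q) (hatA q) ∧ Commute (hatα q) (star (hatA q))
    rw [star_A hq₀ hq₁, and_self]
    refine one _ _ (W_comm (bdd_α q) (bdd_A hq₀ hq₁)
      (fun t ht s => ⟨.inl ht, .inl (mem_α ht)⟩) (fun _ => rfl) fun t ht s => ?_)
    rw [wtA_α]; simp only [Equiv.Perm.one_apply]; ring
  · change Commute (hatα q) (hatB q) ∧ Commute (hatα q) (star (hatB q))
    rw [star_B]
    refine ⟨one _ _ (W_comm (bdd_α q) (bdd_B q)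
      (fun t ht s => ⟨.inl (mem_B ht), .inl (mem_α ht)⟩) shα_shB fun t ht s => ?_),
      one _ _ (W_comm (bdd_α q) (bdd_B q).symm
      (fun t ht s => ⟨mem_B_symm hq₀ ht s, .inl (mem_α ht)⟩)
        (fun t => (symm_comm (fun t => (shα_shB t).symm) t).symm) fun t ht s => ?_)⟩
    · rw [cα, cα, cB, cB, wtU_B, wtA_α]; ring
    · rw [cα, cα, cB, cB, wtU_B_symm, wtA_B_symm hq₀, wtA_B_symm hq₀, wtA_α]; ring
  · change Commute (hatβ q) (hatA q) ∧ Commute (hatβ q) (star (hatA q))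
    rw [star_A hq₀ hq₁, and_self]
    refine one _ _ (W_comm (bdd_β hq₀ hq₁) (bdd_A hq₀ hq₁)
      (fun t ht s => ⟨.inl ht, .inl (mem_β ht)⟩) (fun _ => rfl) fun t ht s => ?_)
    rw [wtA_β]; simp only [Equiv.Perm.one_apply]; ring
  · change Commute (hatβ q) (hatB q) ∧ Commute (hatβ q) (star (hatB q))
    rw [star_B]
    refine ⟨one _ _ (W_comm (bdd_β hq₀ hq₁) (bdd_B q)
      (fun t ht s => ⟨.inl (mem_B ht), .inl (mem_β ht)⟩) shβ_shB fun t ht s => ?_),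
      one _ _ (W_comm (bdd_β hq₀ hq₁) (bdd_B q).symm
      (fun t ht s => ⟨mem_B_symm hq₀ ht s, .inl (mem_β ht)⟩)
        (fun t => (symm_comm (fun t => (shβ_shB t).symm) t).symm) fun t ht s => ?_)⟩
    · rw [cB, cB, wtU_B, wtA_β]; ring
    · rw [cB, cB, wtU_B_symm, wtA_B_symm hq₀, wtA_B_symm hq₀, wtA_β]; ring

/-- Two passes of `commute_of_gen`: first the second leg against the generators of the first, then
the first leg against everything in the second. -/
theorem commute_rep (hq₀ : 0 < q) (hq₁ : q < 1) (x : SUAlg q) (y : PodlesAlg q) :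
    Commute (suRep hq₀ hq₁ x) (podRep hq₀ hq₁ y) := by
  have key : ∀ i y, Commute (podRep hq₀ hq₁ y) (suGen q i) ∧
      Commute (podRep hq₀ hq₁ y) (star (suGen q i)) := by
    intro i y
    refine ⟨commute_of_gen _ (fun k => ?_) (fun k => ?_) y,
      commute_of_gen _ (fun k => ?_) (fun k => ?_) y⟩ <;> rw [podRep_gen]
    · exact (commute_gen hq₀ hq₁ i k).1.symm
    · simpa using (commute_gen hq₀ hq₁ i k).2.symm.star_star
    · simpa using (commute_gen hq₀ hq₁ i k).2.symm.star_star
    · rw [star_star]; exact (commute_gen hq₀ hq₁ i k).1.symm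
  refine commute_of_gen _ (fun i => ?_) (fun i => ?_) x <;> rw [suRep_gen]
  · exact (key i y).1.symm
  · rw [← map_star]; exact (key i _).1.symm

/-- The representation of `A(SU_q(2)) ⊗ A(S²_q)`, as a homomorphism of algebras. -/
def hatAlgHom (hq₀ : 0 < q) (hq₁ : q < 1) :
    SUAlg q ⊗[ℂ] PodlesAlg q →ₐ[ℂ] (HatSpace →L[ℂ] HatSpace) :=
  Algebra.TensorProduct.lift (suRep hq₀ hq₁ : SUAlg q →ₐ[ℂ] HatSpace →L[ℂ] HatSpace)
    (podRep hq₀ hq₁ : PodlesAlg q →ₐ[ℂ] HatSpace →L[ℂ] HatSpace)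
    (fun x y => commute_rep hq₀ hq₁ x y)

theorem hatAlgHom_tmul (hq₀ : 0 < q) (hq₁ : q < 1) (x : SUAlg q) (y : PodlesAlg q) :
    hatAlgHom hq₀ hq₁ (x ⊗ₜ y) = suRep hq₀ hq₁ x * podRep hq₀ hq₁ y :=
  Algebra.TensorProduct.lift_tmul _ _ (fun x y => commute_rep hq₀ hq₁ x y) _ _

/-- The representation of `A(SU_q(2)) ⊗ A(S²_q)`. -/
def hatRep (hq₀ : 0 < q) (hq₁ : q < 1) :
    SUAlg q ⊗[ℂ] PodlesAlg q →⋆ₐ[ℂ] (HatSpace →L[ℂ] HatSpace) :=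
  { hatAlgHom hq₀ hq₁ with
    map_star' := by
      intro x
      change hatAlgHom hq₀ hq₁ (star x) = star (hatAlgHom hq₀ hq₁ x)
      induction x using TensorProduct.induction_on with
      | zero => simp
      | add x y hx hy => rw [star_add, map_add, map_add, star_add, hx, hy]
      | tmul x y =>
        rw [TensorProduct.star_tmul, hatAlgHom_tmul, hatAlgHom_tmul, map_star, map_star, star_mul,
          ← map_star, ← map_star]
        exact commute_rep hq₀ hq₁ _ _ }

theorem hatRep_tmul (hq₀ : 0 < q) (hq₁ : q < 1) (x : SUAlg q) (y : PodlesAlg q) :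
    hatRep hq₀ hq₁ (x ⊗ₜ y) = suRep hq₀ hq₁ x * podRep hq₀ hq₁ y :=
  hatAlgHom_tmul hq₀ hq₁ x y

theorem hatKet_eq_vec (l m₁ m₂ j : ℝ) (s : ℤˣ) :
    hatKet l m₁ m₂ j s = vec hatLabels ⟨l, m₁, m₂, j⟩ s := rfl

theorem isHatRep_hatRep (hq₀ : 0 < q) (hq₁ : q < 1) : IsHatRep q (hatRep hq₀ hq₁) := by
  refine ⟨fun t ht s => ?_, fun t ht s => ?_, fun t ht s => ?_, fun t ht s => ?_⟩ <;>
    rw [hatRep_tmul, map_one]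
  · rw [mul_one, suα, suRep_gen]
    refine (W_vec (bdd_α q) ht s).trans ?_
    have e : q ^ (2 * (t.j + t.m₁ + 1)) = (q * wtU q t) ^ 2 := by
      rw [wtU, mul_comm q, ← Real.rpow_add_one hq₀.ne', ← Real.rpow_natCast _ 2,
        ← Real.rpow_mul hq₀.le]
      congr 1; push_cast; ring
    rw [cα, e]
    congr 2
    ext <;> simp [shα, LabelSpace.translate]
  · rw [mul_one, suβ, suRep_gen]
    refine (W_vec (bdd_β hq₀ hq₁) ht s).trans ?_
    rw [hatKet_eq_vec, wtU]
    congr 2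
    ext <;> simp [shβ, LabelSpace.translate]; ring
  · rw [one_mul, podA, podRep_gen]
    exact W_vec (bdd_A hq₀ hq₁) ht s
  · rw [one_mul, podB, podRep_gen]
    refine (W_vec (bdd_B q) ht s).trans ?_
    have e : q ^ (2 * (t.l - t.j + t.m₂ + 2 - eps t.l t.j t.m₂)) = (q ^ 2 * wtA q t) ^ 2 := by
      rw [wtA, mul_comm (q ^ 2), ← Real.rpow_natCast q 2, ← Real.rpow_add hq₀,
        ← Real.rpow_natCast _ 2, ← Real.rpow_mul hq₀.le]
      congr 1; push_cast; ring
    rw [cB, e, hatKet_eq_vec]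
    congr 2
    ext <;> simp [shB, LabelSpace.translate]

theorem algHom_ext {Y C : Type} {r : FreeStarAlg Y → FreeStarAlg Y → Prop} [Ring C]
    [Algebra ℂ C] {f g : StarPresented r →ₐ[ℂ] C}
    (h : ∀ y, f (StarPresented.gen r y) = g (StarPresented.gen r y))
    (h' : ∀ y, f (star (StarPresented.gen r y)) = g (star (StarPresented.gen r y)))
    (x : StarPresented r) : f x = g x := by
  obtain ⟨a, rfl⟩ := StarPresented.mkAlg_surjective x
  induction a using FreeStarAlg.induction with
  | h_scalar c => simp only [AlgHom.commutes]
  | h_gen p =>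
    rcases p with ⟨y, _ | _⟩
    · exact h y
    · have e : FreeStarAlg.letter (y, true) = star (FreeStarAlg.gen y) :=
        (FreeStarAlg.star_letter (y, false)).symm
      rw [e, StarPresented.mkAlg_star]
      exact h' y
  | h_mul a b ha hb => rw [map_mul, map_mul, map_mul, ha, hb]
  | h_add a b ha hb => rw [map_add, map_add, map_add, ha, hb]

theorem IsHatRep.unique {π π' : SUAlg q ⊗[ℂ] PodlesAlg q →⋆ₐ[ℂ] (HatSpace →L[ℂ] HatSpace)}
    (h : IsHatRep q π) (h' : IsHatRep q π') : π = π' := by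
  have l : ∀ i, π (StarPresented.gen (SURel q) i ⊗ₜ 1) =
      π' (StarPresented.gen (SURel q) i ⊗ₜ 1) := by
    intro i
    refine clm_ext fun t ht s => ?_
    fin_cases i
    · exact (h.α t ht s).trans (h'.α t ht s).symm
    · exact (h.β t ht s).trans (h'.β t ht s).symm
  have r : ∀ i, π (1 ⊗ₜ StarPresented.gen (PodlesRel q) i) =
      π' (1 ⊗ₜ StarPresented.gen (PodlesRel q) i) := by
    intro i
    refine clm_ext fun t ht s => ?_
    fin_cases i
    · exact (h.A t ht s).trans (h'.A t ht s).symm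
    · exact (h.B t ht s).trans (h'.B t ht s).symm
  have hl : ∀ x, π (x ⊗ₜ 1) = π' (x ⊗ₜ 1) := by
    refine algHom_ext (f := π.toAlgHom.comp (Algebra.TensorProduct.includeLeft : SUAlg q →ₐ[ℂ] _))
      (g := π'.toAlgHom.comp (Algebra.TensorProduct.includeLeft : SUAlg q →ₐ[ℂ] _)) l fun i => ?_
    have e : star (StarPresented.gen (SURel q) i) ⊗ₜ[ℂ] (1 : PodlesAlg q) =
      star (StarPresented.gen (SURel q) i ⊗ₜ 1) := by rw [TensorProduct.star_tmul, star_one]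
    change π (star (StarPresented.gen (SURel q) i) ⊗ₜ 1) =
      π' (star (StarPresented.gen (SURel q) i) ⊗ₜ 1)
    rw [e, map_star, map_star, l]
  have hr : ∀ y, π (1 ⊗ₜ y) = π' (1 ⊗ₜ y) := by
    refine algHom_ext
      (f := π.toAlgHom.comp (Algebra.TensorProduct.includeRight : PodlesAlg q →ₐ[ℂ] _))
      (g := π'.toAlgHom.comp (Algebra.TensorProduct.includeRight : PodlesAlg q →ₐ[ℂ] _))
      r fun i => ?_
    have e : (1 : SUAlg q) ⊗ₜ[ℂ] star (StarPresented.gen (PodlesRel q) i) =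
      star (1 ⊗ₜ StarPresented.gen (PodlesRel q) i) := by rw [TensorProduct.star_tmul, star_one]
    change π (1 ⊗ₜ star (StarPresented.gen (PodlesRel q) i)) =
      π' (1 ⊗ₜ star (StarPresented.gen (PodlesRel q) i))
    rw [e, map_star, map_star, r]
  refine StarAlgHom.ext fun x => ?_
  induction x using TensorProduct.induction_on with
  | zero => rw [map_zero, map_zero]
  | add x y hx hy => rw [map_add, map_add, hx, hy]
  | tmul x y =>
    have e : x ⊗ₜ[ℂ] y = (x ⊗ₜ 1) * (1 ⊗ₜ y) := by
      rw [Algebra.TensorProduct.tmul_mul_tmul, mul_one, one_mul]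
    rw [e, map_mul, map_mul, hl, hr]

end Hat

namespace LabelSpace

variable {I J K : Set Label}

/-! ### Smoothness of finite sums of homogeneous operators -/

/-- The finite sums of bounded homogeneous operators. -/
def Graded (I J : Set Label) : Submodule ℂ (Sp I →L[ℂ] Sp J) :=
  Submodule.span ℂ {T | ∃ k, IsHomog k T}

theorem Graded.comp {S : Sp J →L[ℂ] Sp K} {T : Sp I →L[ℂ] Sp J} (hS : S ∈ Graded J K)
    (hT : T ∈ Graded I J) : S ∘L T ∈ Graded I K := by
  induction hS using Submodule.span_induction with
  | mem S hS =>
    induction hT using Submodule.span_induction with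
    | mem T hT =>
      obtain ⟨k, hk⟩ := hS
      obtain ⟨k', hk'⟩ := hT
      exact Submodule.subset_span ⟨_, hk.comp hk'⟩
    | zero => rw [ContinuousLinearMap.comp_zero]; exact zero_mem _
    | add x y _ _ hx hy => rw [ContinuousLinearMap.comp_add]; exact add_mem hx hy
    | smul c x _ hx => rw [ContinuousLinearMap.comp_smul]; exact Submodule.smul_mem _ _ hx
  | zero => rw [ContinuousLinearMap.zero_comp]; exact zero_mem _
  | add x y _ _ hx hy => rw [ContinuousLinearMap.add_comp]; exact add_mem hx hy
  | smul c x _ hx => rw [ContinuousLinearMap.smul_comp]; exact Submodule.smul_mem _ _ hx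

theorem graded_W (a b c' d : ℝ) (c : Label → ℤˣ → ℝ) :
    W I (translate a b c' d) c ∈ Graded I I :=
  Submodule.subset_span ⟨_, isHomog_W a b c' d c⟩

theorem graded_algebraMap (c : ℂ) : algebraMap ℂ (Sp I →L[ℂ] Sp I) c ∈ Graded I I := by
  rw [Algebra.algebraMap_eq_smul_one]
  refine Submodule.smul_mem _ _ (Submodule.subset_span ⟨0, fun x y h i => ?_⟩)
  simp [h]

/-- Homogeneity is the coordinate form of |D|T = T|D| + kT. Its right-hand side is square summable
for x in the domain of |D|, which puts Tx in that domain. -/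
theorem isDelta_of_isHomog {k : ℝ} {T : SpinorSpace →L[ℂ] SpinorSpace} (h : IsHomog k T) :
    IsDelta T ((k : ℂ) • T) := by
  intro x
  have e := h x (absDirac x) fun _ => rfl
  have hx : T x ∈ absDirac.domain := by
    refine (congrArg (Memℓp · 2) (funext fun i => ?_)).mp
      (lp.memℓp (T (absDirac x) + (k : ℂ) • T x))
    exact (e i).symm
  refine ⟨hx, ?_⟩
  ext i
  have e' : (absDirac ⟨T x, hx⟩ : SpinorSpace) i = _ := e i
  rw [lp.coeFn_sub, Pi.sub_apply, e', lp.coeFn_add, Pi.add_apply, add_sub_cancel_left]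
  rfl

/-- The span of the homogeneous operators is stable under δ, so δ can be iterated on it
indefinitely. -/
theorem exists_isDelta {T : SpinorSpace →L[ℂ] SpinorSpace}
    (hT : T ∈ Graded spinorLabels spinorLabels) :
    ∃ S ∈ Graded spinorLabels spinorLabels, IsDelta T S := by
  induction hT using Submodule.span_induction with
  | mem T hT =>
    obtain ⟨k, hk⟩ := hT
    exact ⟨_, Submodule.smul_mem _ _ (Submodule.subset_span ⟨k, hk⟩), isDelta_of_isHomog hk⟩
  | zero =>
    refine ⟨0, zero_mem _, fun x => ⟨absDirac.domain.zero_mem, ?_⟩⟩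
    have : (⟨(0 : SpinorSpace →L[ℂ] SpinorSpace) x, absDirac.domain.zero_mem⟩ :
      absDirac.domain) = 0 := rfl
    rw [this, LinearPMap.map_zero]
    simp
  | add T T' _ _ h h' =>
    obtain ⟨S, hS, h⟩ := h
    obtain ⟨S', hS', h'⟩ := h'
    refine ⟨S + S', add_mem hS hS', fun x => ?_⟩
    obtain ⟨m, e⟩ := h x
    obtain ⟨m', e'⟩ := h' x
    refine ⟨absDirac.domain.add_mem m m', ?_⟩
    rw [add_apply S, ← e, ← e', add_apply T T' (absDirac x)]
    have : (⟨(T + T') x, absDirac.domain.add_mem m m'⟩ : absDirac.domain) =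
      ⟨T x, m⟩ + ⟨T' x, m'⟩ := rfl
    rw [this, LinearPMap.map_add]
    abel
  | smul c T _ h =>
    obtain ⟨S, hS, h⟩ := h
    refine ⟨c • S, Submodule.smul_mem _ _ hS, fun x => ?_⟩
    obtain ⟨m, e⟩ := h x
    refine ⟨absDirac.domain.smul_mem c m, ?_⟩
    change _ - c • T (absDirac x) = c • S x
    rw [← e]
    have : (⟨(c • T) x, absDirac.domain.smul_mem c m⟩ : absDirac.domain) = c • ⟨T x, m⟩ := rfl
    rw [this, LinearPMap.map_smul, smul_sub]

theorem mem_OP0 {T : SpinorSpace →L[ℂ] SpinorSpace} (hT : T ∈ Graded spinorLabels spinorLabels) :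
    T ∈ OP0 := by
  refine Set.mem_iInter.2 fun n => ?_
  induction n generalizing T with
  | zero => trivial
  | succ n ih =>
    obtain ⟨S, hS, h⟩ := exists_isDelta hT
    exact ⟨S, h, ih hS⟩

/-! ### The inclusion of the spinors -/

theorem projP_vec {t : Label} (ht : t ∈ hatLabels) (s : ℤˣ) :
    projP (vec hatLabels t s) = vec spinorLabels t s := projP_hatKet ht s

theorem inclQ_vec {t : Label} (ht : t ∈ spinorLabels) (s : ℤˣ) :
    inclQ (vec spinorLabels t s) = vec hatLabels t s := inclQ_ket ht s

theorem coord_inclQ (x : SpinorSpace) {t : Label} (ht : t ∈ hatLabels) (s : ℤˣ) :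
    coord (inclQ x) (t, s) = coord (I := spinorLabels) x (t, s) := by
  rw [← inner_vec, inclQ, ContinuousLinearMap.adjoint_inner_right, projP_vec ht, inner_vec]

theorem projP_comp_inclQ : projP ∘L inclQ = ContinuousLinearMap.id ℂ SpinorSpace := by
  refine clm_ext (I := spinorLabels) fun t ht s => ?_
  rw [ContinuousLinearMap.comp_apply, inclQ_vec ht, projP_vec (spinorLabels_subset ht)]
  rfl

theorem graded_projP : projP ∈ Graded hatLabels spinorLabels :=
  Submodule.subset_span ⟨0, fun x y h i => by
    simp only [Complex.ofReal_zero, zero_smul, add_zero]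
    exact (h (labelIncl i)).symm⟩

theorem graded_inclQ : inclQ ∈ Graded spinorLabels hatLabels := by
  refine Submodule.subset_span ⟨0, fun x y h i => ?_⟩
  have e : ∀ z : SpinorSpace, inclQ z i = coord (I := spinorLabels) z (i.1, i.2) := fun z => by
    rw [← coord_inclQ z i.1.2]
    exact (coord_mk (I := hatLabels) (inclQ z) i).symm
  simp only [Complex.ofReal_zero, zero_smul, add_zero]
  rw [e, e, coord, coord]
  split_ifs with h'
  · exact (h (⟨i.1.1, h'⟩, i.2)).symm
  · simp

/-! ### A criterion for the trace class -/

/-- Both squares equal ⟪x, T^*T x⟫, because |T|² = T^*T. -/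
theorem norm_abs_apply {E : Type} [NormedAddCommGroup E] [InnerProductSpace ℂ E] [CompleteSpace E]
    (T : E →L[ℂ] E) (x : E) : ‖CFC.abs T x‖ = ‖T x‖ := by
  have h1 : star (CFC.abs T) = CFC.abs T := (CFC.abs_nonneg T).isSelfAdjoint
  have h2 : CFC.abs T * CFC.abs T = star T * T := CFC.abs_mul_abs T
  have key : ∀ S : E →L[ℂ] E, ⟪S x, S x⟫_ℂ = ⟪x, (star S * S) x⟫_ℂ := fun S => by
    rw [ContinuousLinearMap.star_eq_adjoint, Reduced.clm_mul_apply,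
      ContinuousLinearMap.adjoint_inner_right]
  have h3 := key (CFC.abs T)
  rw [h1, h2, ← key, inner_self_eq_norm_sq_to_K, inner_self_eq_norm_sq_to_K] at h3
  have h4 : ‖CFC.abs T x‖ ^ 2 = ‖T x‖ ^ 2 := by exact_mod_cast h3
  exact (pow_left_inj₀ (norm_nonneg _) (norm_nonneg _) two_ne_zero).1 h4

/-- By Cauchy-Schwarz ⟪b, |T| b⟫ is at most ‖|T| b‖ = ‖T b‖. This bound by column norms is crude,
but enough for rapidly decaying columns. -/
theorem isTraceClass_of_summable {T : SpinorSpace →L[ℂ] SpinorSpace}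
    (h : Summable fun i : spinorLabels × ℤˣ => ‖T (vec spinorLabels i.1 i.2)‖) :
    IsTraceClass T := by
  classical
  let b : HilbertBasis (spinorLabels × ℤˣ) ℂ SpinorSpace :=
    HilbertBasis.ofRepr (LinearIsometryEquiv.refl ℂ SpinorSpace)
  have hb : ∀ i, b i = vec spinorLabels i.1 i.2 := fun i => by
    rw [vec, dif_pos i.1.2, ← HilbertBasis.repr_symm_single]
    rfl
  refine ⟨_, b, Summable.of_norm_bounded h fun i => ?_⟩
  rw [hb]
  refine (RCLike.norm_re_le_norm _).trans ((norm_inner_le_norm _ _).trans ?_)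
  rw [norm_abs_apply]
  exact mul_le_of_le_one_left (norm_nonneg _) (norm_vec_le _ _)

theorem absDiracNegPow_vec {p : ℝ} (hp : 0 ≤ p) {t : Label} (ht : t ∈ spinorLabels) (s : ℤˣ) :
    absDiracNegPow p hp (vec spinorLabels t s) =
      (((t.l + 3 / 2) ^ (-p) : ℝ) : ℂ) • vec spinorLabels t s := by
  classical
  ext ⟨t', s'⟩
  change (((t'.1.l + 3 / 2) ^ (-p) : ℝ) : ℂ) * vec spinorLabels t s (t', s') =
    (((t.l + 3 / 2) ^ (-p) : ℝ) : ℂ) * vec spinorLabels t s (t', s')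
  by_cases h : t'.1 = t
  · rw [h]
  · have : vec spinorLabels t s (t', s') = 0 := by
      rw [← coord_mk, coord_vec ht, if_neg]
      simp [h]
    rw [this, mul_zero, mul_zero]

end LabelSpace

/-! ### Operators whose columns decay as q^j -/

namespace Reduced

open LabelSpace

variable {q : ℝ}

/-- The condition i + N ≤ h is weakened to N ≤ h, which decouples (h, N) from (i, u) and makes the
sum over labels a product of two sums. -/
theorem exists_nat_lab {t : Label} (ht : t ∈ spinorLabels) :
    ∃ (c : (Σ h : ℕ, Fin (h + 1)) × (Σ i : ℕ, Fin (2 * i + 2))) (e : Bool),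
      t = lab c.2.1 (c.2.2 : ℕ) c.1.1 (c.1.2 : ℕ) e := by
  obtain ⟨i, u, h, N, e, rfl⟩ := exists_lab ht
  obtain ⟨⟨h1, h2⟩, h3, h4⟩ := lab_mem.1 ht
  have hi : 0 ≤ i := by omega
  lift i to ℕ using hi
  lift u to ℕ using h1
  lift N to ℕ using h3
  have hh : 0 ≤ h := by omega
  lift h to ℕ using hh
  exact ⟨(⟨h, N, by omega⟩, ⟨i, u, by omega⟩), e, rfl⟩

/-- The matrix elements of `T` decay as `q^j`. -/
def Small (q : ℝ) {J : Set Label} (T : Sp spinorLabels →L[ℂ] Sp J) : Prop :=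
  ∃ C, 0 ≤ C ∧ ∀ i u h N e, lab i u h N e ∈ spinorLabels → ∀ s,
    ‖T (vec spinorLabels (lab i u h N e) s)‖ ≤ C * q ^ i

/-- Summation over N gives (h + 1)(h + 2)^{-p} ≤ (h + 2)^{1-p}, summable precisely because p > 2;
summation over u gives (2i + 2)q^i. -/
theorem summable_labels (hq₀ : 0 < q) (hq₁ : q < 1) {p : ℝ} (hp : 2 < p) :
    Summable fun c : (Σ h : ℕ, Fin (h + 1)) × (Σ i : ℕ, Fin (2 * i + 2)) =>
      ((c.1.1 : ℝ) + 2) ^ (-p) * q ^ c.2.1 := by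
  refine Summable.mul_of_nonneg (f := fun c : Σ h : ℕ, Fin (h + 1) => ((c.1 : ℝ) + 2) ^ (-p))
    (g := fun c : Σ i : ℕ, Fin (2 * i + 2) => q ^ c.1) ?_ ?_
    (fun _ => by positivity) (fun _ => by positivity)
  · refine (summable_sigma_of_nonneg fun _ => by positivity).2
      ⟨fun h => summable_of_hasFiniteSupport (Set.toFinite _), ?_⟩
    simp only [tsum_fintype, Finset.sum_const, Finset.card_univ, Fintype.card_fin, nsmul_eq_mul]
    have h1 : Summable fun n : ℕ => ((n : ℝ) + 2) ^ (-(p - 1)) := by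
      have := (summable_nat_add_iff 2).2 (Real.summable_nat_rpow (p := -(p - 1)).2 (by linarith))
      simpa using this
    refine Summable.of_nonneg_of_le (fun _ => by positivity) (fun n => ?_) h1
    rw [show -(p - 1) = 1 + -p by ring, Real.rpow_add (by positivity), Real.rpow_one]
    push_cast
    gcongr
    norm_num
  · refine (summable_sigma_of_nonneg fun _ => by positivity).2
      ⟨fun h => summable_of_hasFiniteSupport (Set.toFinite _), ?_⟩
    simp only [tsum_fintype, Finset.sum_const, Finset.card_univ, Fintype.card_fin, nsmul_eq_mul]
    have h1 := summable_pow_mul_geometric_of_norm_lt_one 1 (r := q)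
      (by rwa [Real.norm_of_nonneg hq₀.le])
    have h2 := summable_geometric_of_lt_one hq₀.le hq₁
    refine ((h1.mul_left 2).add (h2.mul_left 2)).congr fun n => ?_
    push_cast; ring

theorem Small.isTraceClass (hq₀ : 0 < q) (hq₁ : q < 1) {T : SpinorSpace →L[ℂ] SpinorSpace}
    (hT : Small q (J := spinorLabels) T) {p : ℝ} (hp : 2 < p) :
    IsTraceClass (T ∘L absDiracNegPow p (zero_le_two.trans hp.le)) := by
  obtain ⟨C, hC, hT⟩ := hT
  refine isTraceClass_of_summable ?_
  choose c e hc using fun t : spinorLabels => exists_nat_lab t.2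
  have hs := (summable_labels hq₀ hq₁ hp).mul_of_nonneg (g := fun _ : Bool × ℤˣ => (1 : ℝ))
    (summable_of_hasFiniteSupport (Set.toFinite _)) (fun _ => by positivity) (fun _ => zero_le_one)
  let F : spinorLabels × ℤˣ → _ := fun i => (c i.1, (e i.1, i.2))
  have hF : Function.Injective F := by
    rintro ⟨t, s⟩ ⟨t', s'⟩ h
    simp only [F, Prod.mk.injEq] at h
    have : t = t' := Subtype.ext (by rw [hc t, hc t', h.1, h.2.1])
    rw [this, h.2.2]
  refine Summable.of_nonneg_of_le (fun _ => norm_nonneg _) (fun i => ?_)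
    ((hs.comp_injective hF).mul_left C)
  obtain ⟨t, s⟩ := i
  rw [ContinuousLinearMap.comp_apply, absDiracNegPow_vec _ t.2, map_smul, norm_smul,
    Complex.norm_real]
  have hm := t.2
  have h1 := hT _ _ _ _ _ (hc t ▸ hm) s
  rw [← hc t, zpow_natCast] at h1
  -- The eigenvalue of |D| is h + 2, as l = h + 1/2.
  have h2 : (t : Label).l + 3 / 2 = (c t).1.1 + 2 := by
    rw [congrArg Label.l (hc t)]
    simp only [lab]; push_cast; ring
  have h3 : (0 : ℝ) ≤ ((c t).1.1 + 2) ^ (-p) := by positivity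
  rw [h2, Real.norm_of_nonneg h3]
  calc _ ≤ (((c t).1.1 : ℝ) + 2) ^ (-p) * (C * q ^ (c t).2.1) := mul_le_mul_of_nonneg_left h1 h3
    _ = _ := by simp only [Function.comp_apply, F]; ring

section Small

variable {J K : Set Label} {S T : Sp spinorLabels →L[ℂ] Sp J}

theorem Small.add (hS : Small q S) (hT : Small q T) : Small q (S + T) := by
  obtain ⟨C, hC, hS⟩ := hS
  obtain ⟨C', hC', hT⟩ := hT
  refine ⟨C + C', by positivity, fun i u h N e hm s => ?_⟩
  rw [add_apply, add_mul]
  exact (norm_add_le _ _).trans (add_le_add (hS _ _ _ _ _ hm s) (hT _ _ _ _ _ hm s))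

theorem small_zero : Small q (0 : Sp spinorLabels →L[ℂ] Sp J) :=
  ⟨0, le_rfl, fun i u h N e hm s => by simp⟩

theorem small_sum {ι : Type*} {F : ι → Sp spinorLabels →L[ℂ] Sp J} (s : Finset ι)
    (h : ∀ a ∈ s, Small q (F a)) : Small q (∑ a ∈ s, F a) :=
  Finset.sum_induction _ (Small q) (fun _ _ => Small.add) small_zero h

theorem Small.clm_comp (R : Sp J →L[ℂ] Sp K) (hT : Small q T) :
    Small q (R ∘L T) := by
  obtain ⟨C, hC, hT⟩ := hT
  refine ⟨‖R‖ * C, by positivity, fun i u h N e hm s => ?_⟩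
  rw [mul_assoc]
  exact (R.le_opNorm _).trans (mul_le_mul_of_nonneg_left (hT _ _ _ _ _ hm s) (norm_nonneg _))

/-- An arrow lowers j by at most 1, which costs a factor q^{-1}. -/
theorem Small.comp_W (hq₀ : 0 < q) (hq₁ : q < 1) (hT : Small q T) {f : Fin 5} {d : Fin 3} {b : ℤ}
    {c : Label → ℤˣ → ℝ} (hc : BddCoef spinorLabels (arrow f d b) c) :
    Small q (T ∘L W spinorLabels (arrow f d b) c) := by
  obtain ⟨C, hC, hT⟩ := hT
  obtain ⟨B, hB, hb⟩ := id hc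
  refine ⟨B * (C * q ^ (-1 : ℤ)), by positivity, fun i u h N e hm s => ?_⟩
  rw [ContinuousLinearMap.comp_apply, W_vec hc hm, map_smul, norm_smul, Complex.norm_real,
    Real.norm_eq_abs, mul_assoc, mul_assoc, ← zpow_add₀ hq₀.ne']
  by_cases ht : arrow f d b (lab i u h N e) ∈ spinorLabels
  · refine mul_le_mul (hb _ hm ht s) ?_ (norm_nonneg _) hB
    rw [translate_lab] at *
    refine (hT _ _ _ _ _ ht s).trans (mul_le_mul_of_nonneg_left ?_ hC)
    refine zpow_le_zpow_right_of_le_one₀ hq₀ hq₁.le ?_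
    have : -1 ≤ stepJ f := by clear hb hc ht; revert f; decide
    omega
  · rw [vec_of_notMem ht, map_zero, norm_zero, mul_zero]
    positivity

theorem Small.comp_famOp (hq₀ : 0 < q) (hq₁ : q < 1) (hT : Small q T) {f : Fin 5} {b : ℤ}
    {c : ℝ → ℝ → ℝ} {a : ℤ → ℤ → ℝ} (hc : SpinFactor q f b c a) :
    Small q (T ∘L famOp q f b c) := by
  rw [famOp, ContinuousLinearMap.comp_finsetSum]
  exact small_sum _ fun d _ => hT.comp_W hq₀ hq₁ (bddCoef_mat hq₀ hq₁ hc d)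

end Small

/-! ### Operators which agree in the limit of large `j` -/

/-- The matrix elements `c` and `c'` of an arrow agree in the limit of large `j`. -/
def Near (q : ℝ) (σ : Equiv.Perm Label) (c c' : Label → ℤˣ → ℝ) : Prop :=
  ∃ C, 0 ≤ C ∧ ∀ i u h N e, lab i u h N e ∈ spinorLabels → ∀ s,
    (σ (lab i u h N e) ∈ spinorLabels →
      |c (lab i u h N e) s - c' (lab i u h N e) s| ≤ C * q ^ i) ∧
    (σ (lab i u h N e) ∉ spinorLabels → |c' (lab i u h N e) s| ≤ C * q ^ i)

theorem near_zero (hq₀ : 0 < q) {σ : Equiv.Perm Label} {c : Label → ℤˣ → ℝ} {C : ℝ} (hC : 0 ≤ C)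
    (h : ∀ i u h N e, lab i u h N e ∈ spinorLabels → ∀ s, σ (lab i u h N e) ∈ spinorLabels →
      |c (lab i u h N e) s| ≤ C * q ^ i) : Near q σ c 0 :=
  ⟨C, hC, fun i u h' N e hm s => ⟨fun ht => by simpa using h i u h' N e hm s ht,
    fun _ => by simpa using mul_nonneg hC (zpow_pos hq₀ i).le⟩⟩

/-- The second clause of `Near` handles arrows that leave the spinor labels: there T contributes
nothing, so the coefficient of R must be small by itself. -/
theorem small_of_near {ι : Type*} [Fintype ι] {σ : ι → Equiv.Perm Label}
    {c c' : ι → Label → ℤˣ → ℝ} (hn : ∀ a, Near q (σ a) (c a) (c' a))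
    {T : SpinorSpace →L[ℂ] SpinorSpace} {R : HatSpace →L[ℂ] HatSpace}
    (hT : ∀ t ∈ spinorLabels, ∀ s, T (vec spinorLabels t s) =
      ∑ a, (c a t s : ℂ) • vec spinorLabels (σ a t) s)
    (hR : ∀ t ∈ spinorLabels, ∀ s, R (vec hatLabels t s) =
      ∑ a, (c' a t s : ℂ) • vec hatLabels (σ a t) s) :
    Small q (J := hatLabels) (inclQ ∘L T - R ∘L inclQ) := by
  choose C hC h using hn
  refine ⟨∑ a, C a, Finset.sum_nonneg fun a _ => hC a, fun i u h' N e hm s => ?_⟩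
  rw [sub_apply, ContinuousLinearMap.comp_apply, ContinuousLinearMap.comp_apply, inclQ_vec hm,
    hT _ hm, hR _ hm, map_sum, ← Finset.sum_sub_distrib, Finset.sum_mul]
  refine (norm_sum_le _ _).trans (Finset.sum_le_sum fun a _ => ?_)
  obtain ⟨h1, h2⟩ := h a i u h' N e hm s
  rw [map_smul]
  by_cases ht : σ a (lab i u h' N e) ∈ spinorLabels
  · rw [inclQ_vec ht, ← sub_smul, ← Complex.ofReal_sub, norm_smul, Complex.norm_real]
    exact (mul_le_of_le_one_right (norm_nonneg _) (norm_vec_le _ _)).trans (h1 ht)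
  · rw [vec_of_notMem ht, map_zero, smul_zero, zero_sub, norm_neg, norm_smul, Complex.norm_real]
    exact (mul_le_of_le_one_right (norm_nonneg _) (norm_vec_le _ _)).trans (h2 ht)

/-- `s` is a number between `0` and `1` with `c (1 - s) ≤ y`. -/
def Close (c y s : ℝ) : Prop := (0 ≤ s ∧ s ≤ 1) ∧ c * (1 - s) ≤ y

/-- From 1 - ss' = (1 - s) + s(1 - s'), errors add. -/
theorem Close.mul {c y y' s s' : ℝ} (hc : 0 ≤ c) (h : Close c y s) (h' : Close c y' s') :
    Close c (y + y') (s * s') := by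
  obtain ⟨⟨h1, h2⟩, h3⟩ := h
  obtain ⟨⟨h1', h2'⟩, h3'⟩ := h'
  refine ⟨⟨mul_nonneg h1 h1', mul_le_one₀ h2 h1' h2'⟩, ?_⟩
  nlinarith [mul_le_of_le_one_right (mul_nonneg hc (sub_nonneg.2 h2')) h2]

/-- The error is q^{k+2n}. Carrying the prefactor q^k is essential: n itself may stay small while j
grows, and then k has to be large. -/
theorem close_qb (hq₀ : 0 < q) (hq₁ : q < 1) {k i n : ℤ} (hn : 0 ≤ n) (h : i ≤ k + 2 * n) :
    Close (q ^ k) (q ^ i) (qb q n) := by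
  refine ⟨⟨qb_nonneg hq₀ hq₁ hn, qb_le_one hq₀ n⟩, ?_⟩
  rw [qb, sub_sub_cancel, ← zpow_add₀ hq₀.ne']
  exact zpow_le_zpow_right_of_le_one₀ hq₀ hq₁.le h

theorem close_sq (hq₀ : 0 < q) (hq₁ : q < 1) {k i n : ℤ} (hn : 0 ≤ n) (h : i ≤ k + 2 * n) :
    Close (q ^ k) (q ^ i) (sq q n) := by
  refine ⟨⟨sq_nonneg' n, sq_le_one hq₀ n⟩, le_trans ?_ (close_qb hq₀ hq₁ hn h).2⟩
  have h1 : qb q n ≤ sq q n := by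
    rw [← sq_sq hq₀ hq₁ hn]
    exact mul_le_of_le_one_left (sq_nonneg' n) (sq_le_one hq₀ n)
  have h2 := zpow_pos hq₀ k
  gcongr

/-- The difference is x(c(1 - d) - c(1 - s))/d, and both terms in the numerator are controlled. -/
theorem Close.div {c y y' s d δ x : ℝ} (hs : Close c y s) (hd : Close c y' d) (hc : 0 ≤ c)
    (hδ : 0 < δ) (hδd : δ ≤ d) (hx : |x| ≤ 1) : |x * (c * s / d) - x * c| ≤ (y + y') / δ := by
  obtain ⟨⟨h1, h2⟩, h3⟩ := hs
  obtain ⟨⟨h1', h2'⟩, h3'⟩ := hd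
  have hd0 := hδ.trans_le hδd
  have e : x * (c * s / d) - x * c = x * ((c * (1 - d) - c * (1 - s)) / d) := by
    field_simp; ring
  rw [e]
  refine abs_mul_le_of_le_one hx ?_
  rw [abs_div, abs_of_pos hd0]
  have p1 := mul_nonneg hc (sub_nonneg.2 h2)
  have p2 := mul_nonneg hc (sub_nonneg.2 h2')
  refine div_le_div₀ (by linarith) (abs_le.2 ⟨by linarith, by linarith⟩) hδ hδd

end Reduced

/-! ### Leading terms of x₀, x₁ and x₁^* -/

namespace Reduced

open LabelSpace Hat

variable {q : ℝ}

/-- The matrix elements of the images of `x_0`, `x_1` and the adjoint of `x_1` under the embedding,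
for `j ↦ j + dlt k`, in terms of the matrix elements `U` and `a` of `β` and `A`. -/
def lead (q : ℝ) (g k : Fin 3) (U a : ℝ) : ℝ :=
  match g, k with
  | 0, 0 => -(a * (U * √(1 - (q * U) ^ 2)))
  | 0, 2 => -(a * (√(1 - U ^ 2) * (q⁻¹ * U)))
  | 1, 0 => -(a * (√(1 - (q * U) ^ 2) * √(1 - (q * (q * U)) ^ 2)))
  | 1, 2 => q * (a * (U * U))
  | 2, 0 => q * (a * (U * U))
  | 2, 2 => -(a * (√(1 - U ^ 2) * √(1 - (q⁻¹ * U) ^ 2)))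
  | 0, 1 => 0
  | 1, 1 => 0
  | 2, 1 => 0

theorem sqrt_one_sub_zpow (n : ℤ) : √(1 - (q ^ n) ^ 2) = sq q n := by
  rw [sq, qb, mul_comm, zpow_mul]; rfl

theorem wtU_lab (i u h N : ℤ) (e : Bool) : wtU q (lab i u h N e) = q ^ u := by
  rw [wtU, ← Real.rpow_intCast]
  congr 1; simp only [lab]; ring

theorem wtA_lab (i u h N : ℤ) (e : Bool) : wtA q (lab i u h N e) = q ^ (2 * N) := by
  rw [wtA, ← Real.rpow_intCast]
  simp only [lab]
  rw [eps_lab e (h - i - N) (by push_cast; linarith [sgn_eq e])]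
  congr 1; push_cast; ring

theorem near_of_lab {f : Fin 5} {d : Fin 3} {b : ℤ} {c c' : Label → ℤˣ → ℝ} {C : ℝ} (hC : 0 ≤ C)
    (H : ∀ i u h N e s, SpinMem i u → CellMem i h N →
      (SpinMem (i + stepJ f) (u + stepJ f + b) →
        CellMem (i + stepJ f) (h + dlt d) (N + stepN f d e) →
        |c (lab i u h N e) s - c' (lab i u h N e) s| ≤ C * q ^ i) ∧
      (¬ (SpinMem (i + stepJ f) (u + stepJ f + b) ∧
        CellMem (i + stepJ f) (h + dlt d) (N + stepN f d e)) →
        |c' (lab i u h N e) s| ≤ C * q ^ i)) :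
    Near q (arrow f d b) c c' := by
  refine ⟨C, hC, fun i u h N e hm s => ?_⟩
  rw [translate_lab, lab_mem_iff]
  rw [lab_mem_iff] at hm
  exact ⟨fun ht => (H i u h N e s hm.1 hm.2).1 ht.1 ht.2, (H i u h N e s hm.1 hm.2).2⟩

theorem stepN_fam (e : Bool) : stepN 0 0 e = 0 ∧ stepN 2 2 e = 0 := by revert e; decide

/-- The number x collects what occurs in both matrix elements. At most four remaining square roots
contribute q^i each and the two denominators 2q^i, which gives the constant 6. -/
theorem Close.le (hq₀ : 0 < q) (hq₁ : q < 1) {y y' s x : ℝ} {k i m n : ℤ}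
    (hs : Close (q ^ k) y s) (hy : y ≤ 4 * q ^ i) (hx : |x| ≤ 1) (hm : 1 ≤ m) (hn : 1 ≤ n)
    (hm' : i ≤ k + 2 * m) (hn' : i ≤ k + 2 * n) (hy' : y' = x * q ^ k) :
    |x * (q ^ k * s / (qb q m * qb q n)) - y'| ≤ 6 / qb q 1 ^ 2 * q ^ i := by
  have h1 := qb_pos hq₀ hq₁ one_pos
  have h3 := qb_mono hq₀ hq₁ hm
  have h4 := qb_mono hq₀ hq₁ hn
  have hk := (zpow_pos hq₀ k).le
  subst hy'
  refine (hs.div ((close_qb hq₀ hq₁ (by omega) hm').mul hk (close_qb hq₀ hq₁ (by omega) hn')) hk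
    (δ := qb q 1 ^ 2) (by positivity) ?_ hx).trans ?_
  · rw [pow_two]; exact mul_le_mul h3 h4 h1.le (h1.trans_le h3).le
  · rw [div_mul_eq_mul_div]
    gcongr
    linarith

/-- The coefficient C⁺ tends to -q^{2N}, minus the entry of A, and A⁺, B⁺, B⁻ tend to the matrix
elements of the quadratic expressions in α, β. Raising l and j together never leaves the spinor
labels, so only the first clause of `Near` has content. -/
theorem near_lead_raise (hq₀ : 0 < q) (hq₁ : q < 1) (g : Fin 3) :
    Near q (arrow (fam 0) 0 (stepB g)) (mat q (spin q g 0) (fam 0) 0)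
      (fun t _ => lead q g 0 (wtU q t) (wtA q t)) := by
  have hb : ∀ e, bi e = 0 ∨ bi e = 1 := by decide
  have h1 := qb_pos hq₀ hq₁ one_pos
  have hq := hq₀.ne'
  refine near_of_lab (C := 6 / qb q 1 ^ 2) (by positivity)
    fun i u h N e s hs hc => ⟨fun hs' hc' => ?_, fun hn => absurd ?_ hn⟩
  · have hb := hb e
    obtain ⟨hu, hv⟩ := hs
    obtain ⟨hi, hN, hh⟩ := hc
    have z1 : q * q ^ u = q ^ (u + 1) := by rw [zpow_add_one₀ hq, mul_comm]
    have z2 : q * q ^ (u + 1) = q ^ (u + 2) := by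
      rw [mul_comm, ← zpow_add_one₀ hq, add_assoc]; rfl
    have z4 : q ^ (2 * u + 1) = q * (q ^ u * q ^ u) := by
      rw [zpow_add_one₀ hq, two_mul, zpow_add₀ hq, mul_comm]
    rw [wtU_lab, wtA_lab, mat]
    change |_ * coefCp q _ _ _ - _| ≤ _
    rw [coefCp_eq hq₀ hq₁ (l := (lab i u h N e).l) (j := (lab i u h N e).j)
      (m₂ := (lab i u h N e).m₂) (i := i) (h := h) (N := N) (e := e) rfl rfl rfl (by omega)]
    have c1 := fun k (hk : i ≤ k + 2 * (2 * (i + N) + 3 + 2 * bi e)) =>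
      close_sq hq₀ hq₁ (show 0 ≤ 2 * (i + N) + 3 + 2 * bi e by omega) hk
    have c2 := fun k (hk : i ≤ k + 2 * (2 * (h - N) + 5 - 2 * bi e)) =>
      close_sq hq₀ hq₁ (show 0 ≤ 2 * (h - N) + 5 - 2 * bi e by omega) hk
    fin_cases g
    · change |coefAp q _ _ * _ - lead q 0 0 _ _| ≤ _
      rw [coefAp_eq hq₀ hq₁ (j := (lab i u h N e).j)
        (m₁ := (lab i u h N e).m₁) (i := i) (u := u) rfl rfl (by omega), lead, z1,
        sqrt_one_sub_zpow]
      -- The root with argument 2i + 2 - u is far from 1 when u is near 2i + 1, but then the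
      -- prefactor q^u is of order q^{2i}.
      have hk := (zpow_pos hq₀ (u + 2 * N)).le
      refine le_of_eq_of_le ?_ (Close.le hq₀ hq₁ (k := u + 2 * N) (x := -sq q (u + 1))
        (m := 2 * (i + 1) + 1) (n := 2 * (h + 2) + 1)
        (((c1 _ (by omega)).mul hk (c2 _ (by omega))).mul hk (close_sq hq₀ hq₁
        (n := 2 * i + 1 - u + 1) (i := i) (by omega) (by omega))) (by linarith [zpow_pos hq₀ i])
        (by rw [abs_neg]; exact abs_sq_le_one hq₀ _)
        (by omega) (by omega) (by omega) (by omega) rfl)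
      rw [zpow_add₀ hq]
      congr 1; ring
    · change |coefBp q _ _ * _ - lead q 1 0 _ _| ≤ _
      rw [coefBp_eq hq₀ hq₁ (j := (lab i u h N e).j)
        (m₁ := (lab i u h N e).m₁) (i := i) (u := u) rfl rfl (by omega), lead, z1, z2,
        sqrt_one_sub_zpow,
        sqrt_one_sub_zpow]
      -- The roots with arguments u + 1 and u + 2 need not be near 1; they are matrix elements of α²
      -- and go into the common factor x.
      have hk := (zpow_pos hq₀ (2 * N)).le
      refine le_of_eq_of_le ?_ (Close.le hq₀ hq₁ (k := 2 * N) (x := -(sq q (u + 1) * sq q (u + 2)))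
        (m := 2 * (i + 1) + 1) (n := 2 * (h + 2) + 1) (i := i)
        ((c1 _ (by omega)).mul hk (c2 _ (by omega))) (by linarith [zpow_pos hq₀ i])
        (by rw [abs_neg]; exact abs_mul_le_one (abs_sq_le_one hq₀ _) (abs_sq_le_one hq₀ _))
        (by omega) (by omega) (by omega) (by omega) rfl)
      congr 1; ring
    · change |coefBm q ((lab i u h N e).j + 1) ((lab i u h N e).m₁ - 1) * _ - lead q 2 0 _ _| ≤ _
      rw [coefBm_eq hq₀ hq₁ (i := i + 1) (u := u) (by simp only [lab]; push_cast; ring)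
        (by simp only [lab]; push_cast; ring) (by omega), lead]
      have hk := (zpow_pos hq₀ (2 * u + 1 + 2 * N)).le
      refine le_of_eq_of_le ?_ (Close.le hq₀ hq₁ (k := 2 * u + 1 + 2 * N) (x := 1)
        (m := 2 * (i + 1) + 1) (n := 2 * (h + 2) + 1) (i := i)
        (((c1 _ (by omega)).mul hk (c2 _ (by omega))).mul hk ((close_sq hq₀ hq₁
        (n := 2 * (i + 1) + 1 - u) (i := i) (by omega) (by omega)).mul hk (close_sq hq₀ hq₁
        (n := 2 * (i + 1) + 1 - u - 1) (i := i) (by omega) (by omega))))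
        (by linarith [zpow_pos hq₀ i]) (by simp)
        (by omega) (by omega) (by omega) (by omega) rfl)
      rw [zpow_add₀ hq (2 * u + 1), z4]
      congr 1; ring
  · obtain ⟨hu, hv⟩ := hs
    obtain ⟨hi, hN, hh⟩ := hc
    have e1 : stepJ (fam 0) = 1 := rfl
    have e2 : stepN (fam 0) 0 e = 0 := (stepN_fam e).1
    have e3 : dlt 0 = 1 := rfl
    have e4 : -1 ≤ stepB g ∧ stepB g ≤ 1 := by clear hn; revert g; decide
    rw [e1, e2, e3]
    unfold SpinMem CellMem
    omega

theorem near_lead_lower (hq₀ : 0 < q) (hq₁ : q < 1) (g : Fin 3) :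
    Near q (arrow (fam 2) 2 (stepB g)) (mat q (spin q g 2) (fam 2) 2)
      (fun t _ => lead q g 2 (wtU q t) (wtA q t)) := by
  have hb : ∀ e, bi e = 0 ∨ bi e = 1 := by decide
  have h1 := qb_pos hq₀ hq₁ one_pos
  have h6 : 1 ≤ 6 / qb q 1 ^ 2 := by
    rw [one_le_div (by positivity)]
    nlinarith [qb_le_one hq₀ 1]
  have hq := hq₀.ne'
  refine near_of_lab (C := 6 / qb q 1 ^ 2) (by positivity) fun i u h N e s hs hc => ?_
  have hb := hb e
  have e1 : stepJ (fam 2) = -1 := rfl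
  have e2 : stepN (fam 2) 2 e = 0 := (stepN_fam e).2
  have e3 : dlt 2 = -1 := rfl
  rw [e1, e2, e3]
  obtain ⟨hu, hv⟩ := hs
  obtain ⟨hi, hN, hh⟩ := hc
  have z1 : q⁻¹ * q ^ u = q ^ (u - 1) := by rw [zpow_sub_one₀ hq, mul_comm]
  rw [wtU_lab, wtA_lab]
  refine ⟨fun hs' hc' => ?_, fun hn => ?_⟩
  · obtain ⟨hu', hv'⟩ := hs'
    have z4 : q ^ (2 * u + 1) = q * (q ^ u * q ^ u) := by
      rw [zpow_add_one₀ hq, two_mul, zpow_add₀ hq, mul_comm]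
    rw [mat]
    change |_ * coefCp q ((lab i u h N e).l - 1) ((lab i u h N e).j - 1) _ - _| ≤ _
    rw [coefCp_eq hq₀ hq₁ (i := i - 1) (h := h - 1) (N := N) (e := e)
      (by simp only [lab]; push_cast; ring) (by simp only [lab]; push_cast; ring)
      (by simp only [lab]; push_cast; ring) (by omega)]
    have c1 := fun k (hk : i ≤ k + 2 * (2 * (i - 1 + N) + 3 + 2 * bi e)) =>
      close_sq hq₀ hq₁ (show 0 ≤ 2 * (i - 1 + N) + 3 + 2 * bi e by omega) hk
    have c2 := fun k (hk : i ≤ k + 2 * (2 * (h - 1 - N) + 5 - 2 * bi e)) =>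
      close_sq hq₀ hq₁ (show 0 ≤ 2 * (h - 1 - N) + 5 - 2 * bi e by omega) hk
    fin_cases g <;> simp [stepB] at hu' hv'
    · change |coefAp q ((lab i u h N e).j - 1) _ * _ - lead q 0 2 _ _| ≤ _
      rw [coefAp_eq hq₀ hq₁ (i := i - 1) (u := u - 1) (by simp only [lab]; push_cast; ring)
        (by simp only [lab]; push_cast; ring) (by omega), lead, z1, sqrt_one_sub_zpow]
      have hk := (zpow_pos hq₀ (u - 1 + 2 * N)).le
      refine le_of_eq_of_le ?_ (Close.le hq₀ hq₁ (k := u - 1 + 2 * N) (x := -sq q u)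
        (m := 2 * (i - 1 + 1) + 1) (n := 2 * (h - 1 + 2) + 1)
        (((c1 _ (by omega)).mul hk (c2 _ (by omega))).mul hk (close_sq hq₀ hq₁
        (n := 2 * (i - 1) + 1 - (u - 1) + 1) (i := i) (by omega) (by omega)))
        (by linarith [zpow_pos hq₀ i])
        (by rw [abs_neg]; exact abs_sq_le_one hq₀ _)
        (by omega) (by omega) (by omega) (by omega) rfl)
      rw [zpow_add₀ hq (u - 1), sub_add_cancel]
      congr 1; ring_nf
    · change |coefBm q (lab i u h N e).j _ * _ - lead q 1 2 _ _| ≤ _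
      rw [coefBm_eq hq₀ hq₁ (j := (lab i u h N e).j)
        (m₁ := (lab i u h N e).m₁) (i := i) (u := u) rfl rfl (by omega), lead]
      have hk := (zpow_pos hq₀ (2 * u + 1 + 2 * N)).le
      refine le_of_eq_of_le ?_ (Close.le hq₀ hq₁ (k := 2 * u + 1 + 2 * N) (x := 1)
        (m := 2 * i + 1) (n := 2 * (h - 1 + 2) + 1) (i := i)
        (((c1 _ (by omega)).mul hk (c2 _ (by omega))).mul hk ((close_sq hq₀ hq₁
        (n := 2 * i + 1 - u) (i := i) (by omega) (by omega)).mul hk (close_sq hq₀ hq₁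
        (n := 2 * i + 1 - u - 1) (i := i) (by omega) (by omega))))
        (by linarith [zpow_pos hq₀ i]) (by simp)
        (by omega) (by omega) (by omega) (by omega) rfl)
      rw [zpow_add₀ hq (2 * u + 1), z4]
      congr 1; ring
    · change |coefBp q ((lab i u h N e).j - 1) ((lab i u h N e).m₁ - 1) * _ - lead q 2 2 _ _| ≤ _
      rw [coefBp_eq hq₀ hq₁ (i := i - 1) (u := u - 2) (by simp only [lab]; push_cast; ring)
        (by simp only [lab]; push_cast; ring) (by omega), lead, z1, sqrt_one_sub_zpow,
        sqrt_one_sub_zpow]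
      have hk := (zpow_pos hq₀ (2 * N)).le
      refine le_of_eq_of_le ?_ (Close.le hq₀ hq₁ (k := 2 * N) (x := -(sq q u * sq q (u - 1)))
        (m := 2 * (i - 1 + 1) + 1) (n := 2 * (h - 1 + 2) + 1) (i := i)
        ((c1 _ (by omega)).mul hk (c2 _ (by omega))) (by linarith [zpow_pos hq₀ i])
        (by rw [abs_neg]; exact abs_mul_le_one (abs_sq_le_one hq₀ _) (abs_sq_le_one hq₀ _))
        (by omega) (by omega) (by omega) (by omega) rfl)
      rw [show u - 2 + 1 = u - 1 by ring, sub_add_cancel u 2]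
      congr 1; ring
  · refine le_trans ?_ (le_mul_of_one_le_left (zpow_pos hq₀ i).le h6)
    -- Only the conditions on m₁ can fail: if they hold at spin index i - 1, then i - 1 ≥ 0 and the
    -- cell conditions follow. At j - m₁ too small the power of q^u is small; at j + m₁ too small a
    -- root vanishes.
    have hs' : ¬ SpinMem (i + -1) (u + -1 + stepB g) := fun hs' => hn ⟨hs', by
      unfold SpinMem at hs'
      unfold CellMem
      omega⟩
    have s0 : sq q 0 = 0 := by simp [sq, qb]
    unfold SpinMem at hs'
    fin_cases g <;> simp [stepB] at hs'
    · change |lead q 0 2 _ _| ≤ _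
      rw [lead, z1, sqrt_one_sub_zpow, abs_neg]
      rcases hu.eq_or_lt with rfl | hu
      · rw [s0, zero_mul, mul_zero, abs_zero]; exact (zpow_pos hq₀ i).le
      · rw [mul_left_comm, ← zpow_add₀ hq]
        exact abs_mul_le_of_le_one (abs_sq_le_one hq₀ _) (abs_zpow_le hq₀ hq₁ (by omega))
    · change |lead q 1 2 _ _| ≤ _
      rw [lead, ← zpow_add₀ hq, ← zpow_add₀ hq]
      exact abs_mul_le_of_le_one (by rw [abs_of_pos hq₀]; exact hq₁.le)
        (abs_zpow_le hq₀ hq₁ (by omega))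
    · change |lead q 2 2 _ _| ≤ _
      rw [lead, z1, sqrt_one_sub_zpow, sqrt_one_sub_zpow]
      have : u = 0 ∨ u = 1 := by omega
      rcases this with rfl | rfl <;> simp [s0, (zpow_pos hq₀ i).le]

/-- The matrix elements of the images of `x_0`, `x_1` and the adjoint of `x_1`. -/
def leadX (q : ℝ) (g : Fin 3) (k : Fin 3 × Fin 3) (t : Label) (_ : ℤˣ) : ℝ :=
  if k.1 = k.2 then lead q g k.1 (wtU q t) (wtA q t) else 0

/-- Seven of the nine arrows have combined decay at least 1 from the two factors and are compared
with 0; the other two are the leading ones. -/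
theorem near_leadX (hq₀ : 0 < q) (hq₁ : q < 1) (g : Fin 3) (k : Fin 3 × Fin 3) :
    Near q (arrow (fam k.1) k.2 (stepB g)) (mat q (spin q g k.1) (fam k.1) k.2) (leadX q g k) := by
  obtain ⟨k, d⟩ := k
  have h1 := qb_pos hq₀ hq₁ one_pos
  have key : 1 ≤ spinDecay k + decay (fam k) d ∨ (k = 0 ∧ d = 0) ∨ (k = 2 ∧ d = 2) := by
    revert k d; decide
  rcases key with hd | ⟨rfl, rfl⟩ | ⟨rfl, rfl⟩
  · have e : leadX q g (k, d) = 0 := by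
      ext t s
      rw [leadX]
      split_ifs with hk
      · have hk : k = d := hk
        have : k = 1 := by subst hk; revert k; decide
        subst this
        change lead q g 1 _ _ = 0
        fin_cases g <;> rfl
      · rfl
    rw [e]
    refine near_zero hq₀ (C := 2 / qb q 1 ^ 2 * (2 / qb q 1 ^ 2)) (by positivity)
      fun i u h N e hm s ht => ?_
    obtain ⟨⟨a1, a2⟩, a3, a4⟩ := arrow_mem hm ht
    rw [stepJ_fam] at a2
    rw [mat, spin_lab hq₀ hq₁ g k h N e a1 a2, abs_mul]
    have b1 : |spinArr q g k i u * spinProd (hop q) g k i u| ≤ _ :=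
      abs_mul_le_of_le_one' (abs_spinArr_le hq₀ hq₁ g k a1 a2)
        (abs_mul_le_one (abs_hop_le_one hq₀ _ _) (abs_hop_le_one hq₀ _ _))
    refine (mul_le_mul b1 (abs_red_le hq₀ hq₁ _ d u (abs_sg_le s) a3 a4) (abs_nonneg _)
      (by positivity)).trans ?_
    rw [mul_mul_mul_comm, ← zpow_add₀ hq₀.ne', ← add_mul]
    have := zpow_le_zpow_right_of_le_one₀ hq₀ hq₁.le
      (show i ≤ (spinDecay k + decay (fam k) d) * i by nlinarith [a3.1])
    gcongr
  · exact near_lead_raise hq₀ hq₁ g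
  · exact near_lead_lower hq₀ hq₁ g

end Reduced

/-! ### Leading terms of x₂ and x₂^* -/

namespace Reduced

open LabelSpace Hat

variable {q : ℝ}

/-- The matrix elements of `B` and its adjoint. -/
def leadY (q : ℝ) (f : Fin 5) (d : Fin 3) (t : Label) (_ : ℤˣ) : ℝ :=
  if f = 3 ∧ d = 0 then √(1 - (q ^ 2 * wtA q t) ^ 2) else
    if f = 4 ∧ d = 2 then √(1 - wtA q t ^ 2) else 0

theorem near_leadY (hq₀ : 0 < q) (hq₁ : q < 1) {f : Fin 5} (hf : f = 3 ∨ f = 4) (d : Fin 3) :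
    Near q (arrow f d (0 : ℤ)) (mat q (fun _ _ => 1) f d) (leadY q f d) := by
  have h1 := qb_pos hq₀ hq₁ one_pos
  have hq := hq₀.ne'
  have hb : ∀ e, (bi e = 0 ∨ bi e = 1) ∧ stepN 3 0 e = 1 ∧ stepN 4 2 e = -1 := by decide
  have h6 : 0 < 2 / qb q 1 := by positivity
  -- Here x is the matrix element of B or B^*; the other root and the denominator are both 1 +
  -- O(q^i).
  have close : ∀ {i m n : ℤ} {x : ℝ}, 0 ≤ n → i ≤ 2 * n → 1 ≤ m → i ≤ 2 * m → |x| ≤ 1 →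
      |1 * (1 / qb q m * (sq q n * x)) - x| ≤ 2 / qb q 1 * q ^ i := by
    intro i m n x hn hn' hm hm' hx
    have := (close_sq hq₀ hq₁ (k := 0) (i := i) hn (by omega)).div
      (close_qb hq₀ hq₁ (k := 0) (i := i) (n := m) (by omega) (by omega))
      (by rw [zpow_zero]; exact zero_le_one) h1 (qb_mono hq₀ hq₁ hm) hx
    rw [zpow_zero] at this
    refine (le_of_eq_of_le ?_ this).trans_eq (by ring)
    congr 1; ring
  by_cases hd : 1 ≤ decay f d
  · have e : leadY q f d = 0 := by
      ext t s
      rw [leadY, if_neg, if_neg]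
      · rfl
      · rintro ⟨rfl, rfl⟩; revert hd; decide
      · rintro ⟨rfl, rfl⟩; revert hd; decide
    rw [e]
    refine near_zero hq₀ (C := 2 / qb q 1 ^ 2) (by positivity) fun i u h N e hm s ht => ?_
    obtain ⟨⟨a1, a2⟩, a3, a4⟩ := arrow_mem hm ht
    rw [mat, one_mul]
    refine (abs_red_le hq₀ hq₁ _ d u (abs_sg_le s) a3 a4).trans ?_
    have := zpow_le_zpow_right_of_le_one₀ hq₀ hq₁.le
      (show i ≤ decay f d * i by nlinarith [a3.1])
    gcongr
  · have : (f = 3 ∧ d = 0) ∨ (f = 4 ∧ d = 2) := by revert f d; decide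
    rcases this with ⟨rfl, rfl⟩ | ⟨rfl, rfl⟩
    · refine near_of_lab h6.le fun i u h N e s hs hc => ?_
      obtain ⟨hb, e2, -⟩ := hb e
      have e1 : stepJ 3 = 0 := rfl
      have e3 : dlt 0 = 1 := rfl
      rw [e1, e2, e3]
      obtain ⟨hi, hN, hh⟩ := hc
      refine ⟨fun _ hc' => ?_, fun hn => absurd ⟨?_, ?_⟩ hn⟩
      · have z : q ^ 2 * q ^ (2 * N) = q ^ (2 * N + 2) := by
          rw [zpow_add₀ hq, mul_comm]; rfl
        rw [mat, leadY, if_pos ⟨rfl, rfl⟩, wtA_lab, z, sqrt_one_sub_zpow]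
        change |1 * coefDp q _ _ _ - _| ≤ _
        rw [coefDp_eq hq₀ hq₁ (l := (lab i u h N e).l) (j := (lab i u h N e).j)
          (m₂ := (lab i u h N e).m₂) (i := i) (h := h) (N := N) (e := e) rfl rfl rfl (by omega)]
        exact close (by omega) (by omega) (by omega) (by omega) (abs_sq_le_one hq₀ _)
      · simpa using hs
      · unfold CellMem; omega
    · refine near_of_lab h6.le fun i u h N e s hs hc => ?_
      obtain ⟨hb, -, e2⟩ := hb e
      have e1 : stepJ 4 = 0 := rfl
      have e3 : dlt 2 = -1 := rfl
      rw [e1, e2, e3, leadY, if_neg (by decide), if_pos ⟨rfl, rfl⟩, wtA_lab, sqrt_one_sub_zpow]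
      obtain ⟨hi, hN, hh⟩ := hc
      refine ⟨fun _ hc' => ?_, fun hn => ?_⟩
      · obtain ⟨-, hN', -⟩ := hc'
        rw [mat]
        change |1 * coefDp q ((lab i u h N e).l - 1) (lab i u h N e).j
          ((lab i u h N e).m₂ - 1) - _| ≤ _
        rw [coefDp_eq hq₀ hq₁ (l := (lab i u h N e).l - 1) (j := (lab i u h N e).j)
          (m₂ := (lab i u h N e).m₂ - 1) (i := i) (h := h - 1) (N := N - 1) (e := e)
          (by simp only [lab]; push_cast; ring) rfl
          (by simp only [lab]; push_cast; ring) (by omega),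
          show 2 * (N - 1) + 2 = 2 * N by ring]
        exact close (by omega) (by omega) (by omega) (by omega) (abs_sq_le_one hq₀ _)
      -- Lowering h and N together can only violate N ≥ 0, and at N = 0 the coefficient of B^* is
      -- already 0.
      · have : N = 0 := by
          by_contra hN0
          refine hn ⟨by simpa using hs, ?_⟩
          unfold CellMem; omega
        subst this
        have s0 : sq q (2 * 0) = 0 := by simp [sq, qb]
        rw [s0, abs_zero]
        have := zpow_pos hq₀ i
        positivity

end Reduced

/-! ### The images of the generators on the larger space -/

namespace Hat

open LabelSpace Reduced

variable {q : ℝ}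

/-- The operators of the images of `x_0`, `x_1` and the adjoint of `x_1`. -/
def hatX (q : ℝ) : Fin 3 → Sp hatLabels →L[ℂ] Sp hatLabels :=
  ![-((hatα q * hatβ q + star (hatβ q) * star (hatα q)) * hatA q),
    (-hatα q ^ 2 + (q : ℂ) • star (hatβ q) ^ 2) * hatA q,
    (-star (hatα q) ^ 2 + (q : ℂ) • hatβ q ^ 2) * hatA q]

theorem W_W_A_vec (hq₀ : 0 < q) (hq₁ : q < 1) {σ τ ν : Equiv.Perm Label} {c d : Label → ℤˣ → ℝ}
    (hc : BddCoef hatLabels σ c) (hd : BddCoef hatLabels τ d) {t : Label} (ht : t ∈ hatLabels)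
    (s : ℤˣ) (h : τ t ∈ hatLabels ∨ d t s = 0) (hν : ν t = σ (τ t)) :
    (W hatLabels σ c * W hatLabels τ d * hatA q) (vec hatLabels t s) =
      ((wtA q t * (d t s * c (τ t) s) : ℝ) : ℂ) • vec hatLabels (ν t) s := by
  rw [clm_mul_apply, hatA, W_vec (bdd_A hq₀ hq₁) ht, map_smul, Equiv.Perm.one_apply,
    W_W_vec hc hd ht s h, smul_smul, hν]
  push_cast
  rfl

theorem wtU_symm_α (hq₀ : 0 < q) (t : Label) : wtU q (shα.symm t) = q⁻¹ * wtU q t := by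
  rw [← wtU_α_symm hq₀ t, inv_mul_cancel_left₀ hq₀.ne']

theorem hatX_vec (hq₀ : 0 < q) (hq₁ : q < 1) (g : Fin 3) {t : Label} (ht : t ∈ spinorLabels)
    (s : ℤˣ) : hatX q g (vec hatLabels t s) = ∑ k : Fin 3 × Fin 3,
      (leadX q g k t s : ℂ) • vec hatLabels (arrow (fam k.1) k.2 (stepB g) t) s := by
  have ht := spinorLabels_subset ht
  rw [Fintype.sum_prod_type]
  simp only [Fin.sum_univ_three, leadX]
  fin_cases g
  · change (-((hatα q * hatβ q + star (hatβ q) * star (hatα q)) * hatA q)) _ = _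
    rw [add_mul, neg_apply, add_apply, star_α, star_β hq₀ hq₁, hatα, hatβ,
      W_W_A_vec hq₀ hq₁ (ν := arrow (fam 0) 0 (stepB 0)) (bdd_α q) (bdd_β hq₀ hq₁) ht s
        (.inl (mem_β ht)),
      W_W_A_vec hq₀ hq₁ (ν := arrow (fam 2) 2 (stepB 0)) (bdd_β hq₀ hq₁).symm (bdd_α q).symm ht s
        (mem_α_symm hq₀ ht s), cα, cα, wtU_α_symm hq₀, wtU_β_symm, wtU_symm_α hq₀, wtU_β]
    · simp [lead]
      module
    · ext <;> simp [shα, shβ, LabelSpace.translate, fam, stepJ, stepM, stepB, dlt] <;> ring_nf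
    · ext <;> simp [shα, shβ, LabelSpace.translate, fam, stepJ, stepM, stepB, dlt] <;> ring_nf
  · change ((-hatα q ^ 2 + (q : ℂ) • star (hatβ q) ^ 2) * hatA q) _ = _
    rw [add_mul, neg_mul, smul_mul_assoc, add_apply, neg_apply, smul_apply, pow_two, pow_two,
      star_β hq₀ hq₁, hatα,
      W_W_A_vec hq₀ hq₁ (ν := arrow (fam 0) 0 (stepB 1)) (bdd_α q) (bdd_α q) ht s
        (.inl (mem_α ht)),
      W_W_A_vec hq₀ hq₁ (ν := arrow (fam 2) 2 (stepB 1)) (bdd_β hq₀ hq₁).symm (bdd_β hq₀ hq₁).symm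
        ht s (.inl (mem_β_symm ht)), cα, cα, wtU_α hq₀, wtU_β_symm, wtU_β_symm, wtU_β_symm]
    · simp [lead]
      module
    · ext <;> simp [shβ, LabelSpace.translate, fam, stepJ, stepM, stepB, dlt] <;> ring_nf
    · ext <;> simp [shα, LabelSpace.translate, fam, stepJ, stepM, stepB, dlt] <;> ring_nf
  · change ((-star (hatα q) ^ 2 + (q : ℂ) • hatβ q ^ 2) * hatA q) _ = _
    rw [add_mul, neg_mul, smul_mul_assoc, add_apply, neg_apply, smul_apply, pow_two, pow_two,
      star_α, hatβ,
      W_W_A_vec hq₀ hq₁ (ν := arrow (fam 2) 2 (stepB 2)) (bdd_α q).symm (bdd_α q).symm ht s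
        (mem_α_symm hq₀ ht s),
      W_W_A_vec hq₀ hq₁ (ν := arrow (fam 0) 0 (stepB 2)) (bdd_β hq₀ hq₁) (bdd_β hq₀ hq₁)
        ht s (.inl (mem_β ht)), cα, cα, wtU_α_symm hq₀, wtU_α_symm hq₀, wtU_symm_α hq₀, wtU_β]
    · simp [lead]
      module
    · ext <;> simp [shβ, LabelSpace.translate, fam, stepJ, stepM, stepB, dlt] <;> ring_nf
    · ext <;> simp [shα, LabelSpace.translate, fam, stepJ, stepM, stepB, dlt] <;> ring_nf

theorem hatB_vec (hq₀ : 0 < q) {t : Label} (ht : t ∈ spinorLabels) (s : ℤˣ) :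
    hatB q (vec hatLabels t s) = ∑ d, (leadY q 3 d t s : ℂ) •
        vec hatLabels (arrow 3 d (0 : ℤ) t) s ∧
    star (hatB q) (vec hatLabels t s) = ∑ d, (leadY q 4 d t s : ℂ) •
        vec hatLabels (arrow 4 d (0 : ℤ) t) s := by
  have ht := spinorLabels_subset ht
  rw [star_B, hatB, W_vec (bdd_B q) ht, W_vec (bdd_B q).symm ht, cB, cB, wtA_B_symm hq₀]
  have e1 : shB t = arrow 3 0 (0 : ℤ) t := by
    ext <;> simp [shB, LabelSpace.translate, stepJ, stepM, dlt]
  have e2 : shB.symm t = arrow 4 2 (0 : ℤ) t := by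
    ext <;> simp [shB, LabelSpace.translate, stepJ, stepM, dlt] <;> ring
  rw [e1, e2]
  simp [Fin.sum_univ_three, leadY]
  constructor <;> module

end Hat

/-! ### From the generators to the whole algebra -/

namespace Reduced

open LabelSpace Hat

variable {q : ℝ}

theorem graded_famOp (f : Fin 5) (b : ℤ) (c : ℝ → ℝ → ℝ) :
    famOp q f b c ∈ Graded spinorLabels spinorLabels :=
  Submodule.sum_mem _ fun _ _ => graded_W _ _ _ _ _

theorem graded_opX (g : Fin 3) : opX q g ∈ Graded spinorLabels spinorLabels :=
  Submodule.sum_mem _ fun _ _ => graded_famOp _ _ _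

theorem graded_hat (hq₀ : 0 < q) (hq₁ : q < 1) :
    (∀ g, hatX q g ∈ Graded hatLabels hatLabels) ∧ hatB q ∈ Graded hatLabels hatLabels ∧
      star (hatB q) ∈ Graded hatLabels hatLabels := by
  have symm : ∀ (a b c' d : ℝ) (c : Label → ℤˣ → ℝ),
      W hatLabels (LabelSpace.translate a b c' d).symm c ∈ Graded hatLabels hatLabels := by
    intro a b c' d c
    have : (LabelSpace.translate a b c' d).symm = LabelSpace.translate (-a) (-b) (-c') (-d) := by
      ext t <;> simp [LabelSpace.translate, sub_eq_add_neg]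
    rw [this]
    exact graded_W _ _ _ _ _
  have gA : hatA q ∈ Graded hatLabels hatLabels := by
    have : (1 : Equiv.Perm Label) = LabelSpace.translate 0 0 0 0 := by
      ext t <;> simp [LabelSpace.translate]
    rw [hatA, this]
    exact graded_W _ _ _ _ _
  have gα : hatα q ∈ Graded hatLabels hatLabels := graded_W _ _ _ _ _
  have gβ : hatβ q ∈ Graded hatLabels hatLabels := graded_W _ _ _ _ _
  have gα' : star (hatα q) ∈ Graded hatLabels hatLabels := by
    rw [star_α]; exact symm _ _ _ _ _
  have gβ' : star (hatβ q) ∈ Graded hatLabels hatLabels := by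
    rw [star_β hq₀ hq₁]; exact symm _ _ _ _ _
  refine ⟨fun g => ?_, graded_W _ _ _ _ _, by rw [star_B]; exact symm _ _ _ _ _⟩
  fin_cases g
  · exact Submodule.neg_mem _ (Graded.comp (add_mem (Graded.comp gα gβ) (Graded.comp gβ' gα')) gA)
  · refine Graded.comp (add_mem (Submodule.neg_mem _ ?_) (Submodule.smul_mem _ _ ?_)) gA
    · rw [pow_two]; exact Graded.comp gα gα
    · rw [pow_two]; exact Graded.comp gβ' gβ'
  · refine Graded.comp (add_mem (Submodule.neg_mem _ ?_) (Submodule.smul_mem _ _ ?_)) gA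
    · rw [pow_two]; exact Graded.comp gα' gα'
    · rw [pow_two]; exact Graded.comp gβ gβ

/-- The pairs of operators on spinors and on the larger space which agree in the limit of
large `j`. -/
structure Agree (q : ℝ) (T : SpinorSpace →L[ℂ] SpinorSpace) (R : HatSpace →L[ℂ] HatSpace) :
    Prop where
  tame : ∀ S : SpinorSpace →L[ℂ] HatSpace, Small q (J := hatLabels) S →
    Small q (J := hatLabels) (S ∘L T)
  small : Small q (J := hatLabels) (inclQ ∘L T - R ∘L inclQ)
  graded : T ∈ Graded spinorLabels spinorLabels
  graded' : R ∈ Graded hatLabels hatLabels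

/-- The defect QT - RQ obeys a Leibniz rule: the product has defect (QT - RQ)T' + R(QT' - R'Q). The
first term is small by tameness of T', the second because R is bounded. -/
theorem Agree.mul {T T' : SpinorSpace →L[ℂ] SpinorSpace} {R R' : HatSpace →L[ℂ] HatSpace}
    (h : Agree q T R) (h' : Agree q T' R') : Agree q (T * T') (R * R') := by
  refine ⟨fun S hS => ?_, ?_, Graded.comp h.graded h'.graded,
    Graded.comp h.graded' h'.graded'⟩
  · rw [show S ∘L (T * T') = (S ∘L T) ∘L T' from rfl]
    exact h'.tame _ (h.tame _ hS)
  have e : inclQ ∘L (T * T') - (R * R') ∘L inclQ =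
      (inclQ ∘L T - R ∘L inclQ) ∘L T' + R ∘L (inclQ ∘L T' - R' ∘L inclQ) := by
    ext1 x
    simp only [sub_apply, add_apply, ContinuousLinearMap.comp_apply, clm_mul_apply, map_sub]
    abel
  rw [e]
  exact (h'.tame _ h.small).add (h'.small.clm_comp R)

theorem Agree.add {T T' : SpinorSpace →L[ℂ] SpinorSpace} {R R' : HatSpace →L[ℂ] HatSpace}
    (h : Agree q T R) (h' : Agree q T' R') : Agree q (T + T') (R + R') := by
  refine ⟨fun S hS => ?_, ?_, add_mem h.graded h'.graded, add_mem h.graded' h'.graded'⟩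
  · rw [ContinuousLinearMap.comp_add]
    exact (h.tame _ hS).add (h'.tame _ hS)
  · rw [ContinuousLinearMap.comp_add, ContinuousLinearMap.add_comp, add_sub_add_comm]
    exact h.small.add h'.small

theorem agree_algebraMap (c : ℂ) : Agree q (algebraMap ℂ _ c) (algebraMap ℂ _ c) := by
  refine ⟨fun S hS => ?_, ?_, graded_algebraMap c, graded_algebraMap c⟩
  · obtain ⟨C, hC, h⟩ := hS
    refine ⟨‖c‖ * C, by positivity, fun i u h' N e hm s => ?_⟩
    rw [Algebra.algebraMap_eq_smul_one, ContinuousLinearMap.comp_smul]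
    change ‖c • S (vec spinorLabels _ s)‖ ≤ _
    rw [norm_smul, mul_assoc]
    exact mul_le_mul_of_nonneg_left (h _ _ _ _ _ hm s) (norm_nonneg _)
  · have : inclQ ∘L algebraMap ℂ (SpinorSpace →L[ℂ] SpinorSpace) c -
        algebraMap ℂ (HatSpace →L[ℂ] HatSpace) c ∘L inclQ = 0 := by
      ext1 x
      rw [Algebra.algebraMap_eq_smul_one, Algebra.algebraMap_eq_smul_one]
      change inclQ (c • x) - c • inclQ x = 0
      rw [map_smul, sub_self]
    rw [this]
    exact small_zero

theorem agree_opX (hq₀ : 0 < q) (hq₁ : q < 1) (g : Fin 3) : Agree q (opX q g) (hatX q g) := by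
  refine ⟨fun S hS => ?_, ?_, graded_opX g, (graded_hat hq₀ hq₁).1 g⟩
  · rw [opX, ContinuousLinearMap.comp_finsetSum]
    exact small_sum _ fun k _ => hS.comp_famOp hq₀ hq₁ (spinFactor_spin hq₀ hq₁ g k)
  · refine small_of_near (near_leadX hq₀ hq₁ g) (fun t ht s => ?_) fun t ht s =>
      hatX_vec hq₀ hq₁ g ht s
    rw [opX_vec hq₀ hq₁ g ht, Fintype.sum_prod_type]

theorem agree_opY (hq₀ : 0 < q) (hq₁ : q < 1) :
    Agree q (opY q 3) (hatB q) ∧ Agree q (opY q 4) (star (hatB q)) := by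
  refine ⟨⟨fun S hS => ?_, ?_, graded_famOp _ _ _, (graded_hat hq₀ hq₁).2.1⟩,
    ⟨fun S hS => ?_, ?_, graded_famOp _ _ _, (graded_hat hq₀ hq₁).2.2⟩⟩
  · exact hS.comp_famOp hq₀ hq₁ (spinFactor_one rfl)
  · refine small_of_near (near_leadY hq₀ hq₁ (.inl rfl)) (fun t ht s => ?_) fun t ht s =>
      (hatB_vec hq₀ ht s).1
    exact (famOp_vec hq₀ hq₁ (spinFactor_one rfl) ht s)
  · exact hS.comp_famOp hq₀ hq₁ (spinFactor_one rfl)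
  · refine small_of_near (near_leadY hq₀ hq₁ (.inr rfl)) (fun t ht s => ?_) fun t ht s =>
      (hatB_vec hq₀ ht s).2
    exact (famOp_vec hq₀ hq₁ (spinFactor_one rfl) ht s)

theorem hatRep_embed (hq₀ : 0 < q) (hq₁ : q < 1) :
    hatRep hq₀ hq₁ (embed q (sphx q 0)) = hatX q 0 ∧
    hatRep hq₀ hq₁ (embed q (sphx q 1)) = hatX q 1 ∧
    hatRep hq₀ hq₁ (embed q (sphx q 2)) = hatB q := by
  have hα : suRep hq₀ hq₁ (suα q) = hatα q := suRep_gen hq₀ hq₁ 0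
  have hβ : suRep hq₀ hq₁ (suβ q) = hatβ q := suRep_gen hq₀ hq₁ 1
  have hA : podRep hq₀ hq₁ (podA q) = hatA q := podRep_gen hq₀ hq₁ 0
  have hB : podRep hq₀ hq₁ (podB q) = hatB q := podRep_gen hq₀ hq₁ 1
  have he : ∀ i, embed q (sphx q i) = embedGen q i := StarPresented.lift_gen _ _
  refine ⟨?_, ?_, ?_⟩ <;> rw [he]
  · change hatRep hq₀ hq₁ (-(_ ⊗ₜ _)) = _
    rw [map_neg, hatRep_tmul, map_add, map_mul, map_mul, map_star, map_star, hα, hβ, hA]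
    rfl
  · change hatRep hq₀ hq₁ (_ ⊗ₜ _) = _
    rw [hatRep_tmul, map_add, map_neg, map_smul, map_pow, map_pow, map_star, hα, hβ, hA]
    rfl
  · change hatRep hq₀ hq₁ (_ ⊗ₜ _) = _
    rw [hatRep_tmul, map_one, one_mul, hB]

theorem star_hatX (hq₀ : 0 < q) (hq₁ : q < 1) :
    star (hatX q 0) = hatX q 0 ∧ star (hatX q 1) = hatX q 2 := by
  have hc : ∀ x : SUAlg q, Commute (suRep hq₀ hq₁ x) (hatA q) := fun x => by
    rw [← show podRep hq₀ hq₁ (podA q) = hatA q from podRep_gen hq₀ hq₁ 0]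
    exact commute_rep hq₀ hq₁ x _
  have hα : Commute (hatα q) (hatA q) := (commute_gen hq₀ hq₁ 0 0).1
  have hβ : Commute (hatβ q) (hatA q) := (commute_gen hq₀ hq₁ 1 0).1
  have hα' := hα.star_star
  have hβ' := hβ.star_star
  rw [star_A hq₀ hq₁] at hα' hβ'
  constructor
  · change star (-((hatα q * hatβ q + star (hatβ q) * star (hatα q)) * hatA q)) =
      -((hatα q * hatβ q + star (hatβ q) * star (hatα q)) * hatA q)
    rw [star_neg, star_mul, star_add, star_mul, star_mul, star_star, star_star, star_A hq₀ hq₁,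
      add_comm]
    exact congrArg Neg.neg (((hα.mul_left hβ).add_left (hβ'.mul_left hα')).eq).symm
  · change star ((-hatα q ^ 2 + (q : ℂ) • star (hatβ q) ^ 2) * hatA q) =
      (-star (hatα q) ^ 2 + (q : ℂ) • hatβ q ^ 2) * hatA q
    rw [star_mul, star_add, star_neg, star_smul, star_pow, star_pow, star_star, star_A hq₀ hq₁,
      Complex.star_def, Complex.conj_ofReal]
    exact (((hα'.pow_left 2).neg_left.add_left ((hβ.pow_left 2).smul_left (q : ℂ))).eq).symm

/-- Smallness is a condition on columns and is not evidently preserved by adjoints, so the letters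
x_i and x_i^* are treated separately in the induction. -/
theorem agree_rep (hq₀ : 0 < q) (hq₁ : q < 1) (x : Sphere4Alg q) :
    Agree q (spinorRep hq₀ hq₁ x) (hatRep hq₀ hq₁ (embed q x)) := by
  obtain ⟨a, rfl⟩ := StarPresented.mkAlg_surjective x
  obtain ⟨e0, e1, e2⟩ := hatRep_embed hq₀ hq₁
  obtain ⟨s0, s1⟩ := star_hatX hq₀ hq₁
  obtain ⟨y1, y2⟩ := agree_opY hq₀ hq₁
  induction a using FreeStarAlg.induction with
  | h_scalar c =>
    have h : ∀ {A B : Type} [Ring A] [Algebra ℂ A] [Star A] [Ring B] [Algebra ℂ B] [Star B]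
      (φ : A →⋆ₐ[ℂ] B), φ (algebraMap ℂ A c) = algebraMap ℂ B c := fun φ => φ.commutes c
    rw [AlgHom.commutes, h, h, h]
    exact agree_algebraMap c
  | h_gen p =>
    rcases p with ⟨y, _ | _⟩
    · change Agree q (spinorRep hq₀ hq₁ (sphx q y)) (hatRep hq₀ hq₁ (embed q (sphx q y)))
      rw [spinorRep_sphx]
      fin_cases y
      · exact e0 ▸ agree_opX hq₀ hq₁ 0
      · exact e1 ▸ agree_opX hq₀ hq₁ 1
      · exact e2 ▸ y1
    · have e : FreeStarAlg.letter (y, true) = star (FreeStarAlg.gen y) :=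
        (FreeStarAlg.star_letter (y, false)).symm
      rw [e, StarPresented.mkAlg_star, map_star, map_star, map_star]
      change Agree q (star (spinorRep hq₀ hq₁ (sphx q y)))
        (star (hatRep hq₀ hq₁ (embed q (sphx q y))))
      rw [spinorRep_sphx]
      fin_cases y
      · change Agree q (star (opX q 0)) (star (hatRep hq₀ hq₁ (embed q (sphx q 0))))
        rw [e0, s0, star_opX_zero hq₀ hq₁]
        exact agree_opX hq₀ hq₁ 0
      · change Agree q (star (opX q 1)) (star (hatRep hq₀ hq₁ (embed q (sphx q 1))))
        rw [e1, s1, star_opX_one hq₀ hq₁]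
        exact agree_opX hq₀ hq₁ 2
      · change Agree q (star (opY q 3)) (star (hatRep hq₀ hq₁ (embed q (sphx q 2))))
        rw [e2, star_opY hq₀ hq₁]
        exact y2
  | h_mul a b ha hb => rw [map_mul, map_mul, map_mul, map_mul]; exact ha.mul hb
  | h_add a b ha hb => rw [map_add, map_add, map_add, map_add]; exact ha.add hb

/-- Since PQ = 1, the difference is P(QT - RQ), which inherits smallness; gradedness of all four
operators gives OP⁰. -/
theorem Agree.sub_mem_idealI (hq₀ : 0 < q) (hq₁ : q < 1) {T : SpinorSpace →L[ℂ] SpinorSpace}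
    {R : HatSpace →L[ℂ] HatSpace} (h : Agree q T R) : T - projP ∘L R ∘L inclQ ∈ idealI := by
  refine ⟨mem_OP0 (sub_mem h.graded (Graded.comp graded_projP
    (Graded.comp h.graded' graded_inclQ))),
    fun p hp => Small.isTraceClass hq₀ hq₁ ?_ hp⟩
  have e : T - projP ∘L R ∘L inclQ = projP ∘L (inclQ ∘L T - R ∘L inclQ) := by
    ext1 x
    have hx : projP (inclQ (T x)) = T x := DFunLike.congr_fun projP_comp_inclQ (T x)
    simp only [sub_apply, ContinuousLinearMap.comp_apply, map_sub, hx]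
  rw [e]
  exact h.small.clm_comp (K := spinorLabels) projP

end Reduced

end

theorem mainTheorem9 (q : ℝ) (hq₀ : 0 < q) (hq₁ : q < 1) :
    (∃! ρ, IsSpinorRep q ρ) ∧ (∃! π, IsHatRep q π) ∧
      ∀ ρ π, IsSpinorRep q ρ → IsHatRep q π →
        ∀ a : Sphere4Alg q, ρ a - projP ∘L π (embed q a) ∘L inclQ ∈ idealI := by
  refine ⟨⟨_, Reduced.isSpinorRep_spinorRep hq₀ hq₁, fun ρ h =>
      Reduced.IsSpinorRep.unique h (Reduced.isSpinorRep_spinorRep hq₀ hq₁)⟩,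
    ⟨_, Hat.isHatRep_hatRep hq₀ hq₁, fun π h =>
      Hat.IsHatRep.unique h (Hat.isHatRep_hatRep hq₀ hq₁)⟩, fun ρ π h h' a => ?_⟩
  -- By uniqueness the comparison is needed only for the two constructed representations.
  rw [Reduced.IsSpinorRep.unique h (Reduced.isSpinorRep_spinorRep hq₀ hq₁),
    Hat.IsHatRep.unique h' (Hat.isHatRep_hatRep hq₀ hq₁)]
  exact (Reduced.agree_rep hq₀ hq₁ a).sub_mem_idealI hq₀ hq₁
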